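/- Let $n\ge 1$ and let $T$ be a bounded linear operator on the real space $L^2(\mathbb R^n)$ which is a Calderón–Zygmund operator with kernel $K:\mathbb R^n\times\mathbb R^n\to\mathbb R$. This means that for every compactly supported $f\in L^2$ one has $Tf(x)=\int K(x,y)f(y)\,dy$ for a.e. $x\notin\operatorname{supp} f$, and that for some $\varepsilon>0$ and $C_0$, $|K(x,y)|\le C_0|x-y|^{-n}$ for $x\ne y$ and $|K(x+z,y)-K(x,y)|+|K(x,y+z)-K(x,y)|\le C_0|z|^{\varepsilon}|x-y|^{-n-\varepsilon}$ whenever $x\neq y$ and $2|z|<|x-y|$. Assume that: (i) $K$ is twice differentiable off the diagonal, and for some $C_1$ and all $x\ne y$, $|\nabla_{x,y}K(x,y)|\le C_1|x-y|^{-n-1}$ and $|\nabla^2_{x,y}K(x,y)|\le C_1|x-y|^{-n-2}$; (ii) $T(1)=0$ in $\mathrm{BMO}$, i.e. for every $R>0$ the function $x\mapsto T(\mathbf 1_{B(0,2R)})(x)+\int_{|y|\ge 2R}(K(x,y)-K(0,y))\,dy$ is a.e. equal to a constant on $B(0,R)$; (iii) there is $A<\infty$ such that for every $f\in W^{1,2}(\mathbb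 R^n)$ the function $Tf$ has a weak gradient in $L^2$ and $\|\nabla Tf\|_{2}\le A\|\nabla f\|_{2}$. For $\alpha\in\{0,\frac13\}^n$ let $\mathbb D^\alpha=\{2^{-k}([0,1]^n+m+(-1)^k\alpha): k\in\mathbb Z,\ m\in\mathbb Z^n\}$, and let $\mathbb D=\bigcup_\alpha\mathbb D^\alpha$. A collection $\mathcal S\subset\mathbb D$ is called $\eta$-sparse if there are pairwise disjoint measurable sets $E_Q\subset Q$, $Q\in\mathcal S$, with $|E_Q|\ge\eta|Q|$. Then there are $\eta\in(0,1)$ and $C<\infty$, independent of $f$, such that the following hold. (a) For every $f\in W^{1,2}(\mathbb R^n)$ there is an $\eta$-sparse collection $\mathcal S\subset\mathbb D$ such that for a.e. $x\in\mathbb R^n$ $$|\nabla Tf(x)|\le C\sum_{Q\in\mathcal S}\Big(\frac1{|Q|}\int_Q|\nabla f|\Big)\mathbf 1_Q(x).$$ (b) For every $f\in W^{1,2}(\mathbb R^n)$ with $|\nabla f|\in L^1(\mathbb R^n)$, $$\|\nabla Tf\|_{L^{1,\infty}}=\sup_{t>0}t\,\big|\{x:|\nabla Tf(x)|>t\}\big|\le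 C\,\|\nabla f\|_{L^1}.$$ -/

import Mathlib

open MeasureTheory Metric Set
open scoped ENNReal NNReal ContDiff

noncomputable section

/-- Real-valued square-integrable functions on `ℝⁿ` (classes modulo a.e. equality). -/
abbrev L2 (n : ℕ) : Type :=
  Lp ℝ 2 (volume : Measure (EuclideanSpace ℝ (Fin n)))

/-! ### Dyadic cubes and sparse collections -/

/-- The closed cube `2⁻ᵏ([0,1]ⁿ + m + (-1)ᵏ α)`. -/
def dyadicCube {n : ℕ} (α : Fin n → ℝ) (k : ℤ) (m : Fin n → ℤ) :
    Set (EuclideanSpace ℝ (Fin n)) :=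
  {x | ∀ i, x i ∈ Icc ((2 : ℝ) ^ (-k) * (m i + (-1 : ℝ) ^ k * α i))
    ((2 : ℝ) ^ (-k) * (1 + m i + (-1 : ℝ) ^ k * α i))}

/-- The collection `𝔻` of all dyadic cubes: the union over `α ∈ {0, 1/3}ⁿ` of the translated
dyadic grids `𝔻^α`. -/
def dyadicCubes (n : ℕ) : Set (Set (EuclideanSpace ℝ (Fin n))) :=
  {Q | ∃ α : Fin n → ℝ, (∀ i, α i = 0 ∨ α i = 1 / 3) ∧
    ∃ (k : ℤ) (m : Fin n → ℤ), Q = dyadicCube α k m}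

/-- `S` is an `η`-sparse collection of dyadic cubes: there are pairwise disjoint measurable sets
`E Q ⊆ Q`, `Q ∈ S`, with `|E Q| ≥ η |Q|`. -/
def IsSparse {n : ℕ} (η : ℝ) (S : Set (Set (EuclideanSpace ℝ (Fin n)))) : Prop :=
  S ⊆ dyadicCubes n ∧
  ∃ E : Set (EuclideanSpace ℝ (Fin n)) → Set (EuclideanSpace ℝ (Fin n)),
    S.PairwiseDisjoint E ∧
    ∀ Q ∈ S, MeasurableSet (E Q) ∧ E Q ⊆ Q ∧ ENNReal.ofReal η * volume Q ≤ volume (E Q)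

/-- The sparse operator `x ↦ ∑_{Q ∈ S} (⨍_Q |g|) 1_Q(x)`, with values in `[0, ∞]`, applied to the
norm of a vector field `g`. -/
def sparseOp {n : ℕ} (S : Set (Set (EuclideanSpace ℝ (Fin n))))
    (g : EuclideanSpace ℝ (Fin n) → EuclideanSpace ℝ (Fin n))
    (x : EuclideanSpace ℝ (Fin n)) : ℝ≥0∞ :=
  ∑' Q : S, (Q : Set (EuclideanSpace ℝ (Fin n))).indicator
    (fun _ => ⨍⁻ y, ‖g y‖ₑ ∂(volume.restrict (Q : Set (EuclideanSpace ℝ (Fin n))))) x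

/-- The quasi-norm of the Lorentz space `L^{1,∞}`, `sup_{t > 0} t |{|h| > t}|`. -/
def weakL1Norm {n : ℕ} (h : EuclideanSpace ℝ (Fin n) → EuclideanSpace ℝ (Fin n)) : ℝ≥0∞ :=
  ⨆ t : ℝ≥0, (t : ℝ≥0∞) * volume {x | (t : ℝ≥0∞) < ‖h x‖ₑ}

/-! ### Weak gradients -/

/-- The locally integrable vector field `g` is the weak (distributional) gradient of the locally
integrable function `f` on `ℝⁿ`. -/
def HasWeakGradient {n : ℕ} (f : EuclideanSpace ℝ (Fin n) → ℝ)
    (g : EuclideanSpace ℝ (Fin n) → EuclideanSpace ℝ (Fin n)) : Prop :=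
  LocallyIntegrable f ∧ LocallyIntegrable g ∧
  ∀ φ : EuclideanSpace ℝ (Fin n) → ℝ, ContDiff ℝ ∞ φ → HasCompactSupport φ →
    ∀ v : EuclideanSpace ℝ (Fin n),
      ∫ x, f x * fderiv ℝ φ x v = - ∫ x, inner ℝ (g x) v * φ x

/-- `f` belongs to the Sobolev space `W^{1,2}(ℝⁿ)` and `g` is its gradient. -/
def IsW12 {n : ℕ} (f : L2 n)
    (g : EuclideanSpace ℝ (Fin n) → EuclideanSpace ℝ (Fin n)) : Prop :=
  MemLp g 2 ∧ HasWeakGradient f g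

/-! ### Calderón–Zygmund operators -/

/-- Calderón–Zygmund kernels: size and Hölder regularity of some order `ε > 0`. -/
def IsCZKernel {n : ℕ}
    (K : EuclideanSpace ℝ (Fin n) → EuclideanSpace ℝ (Fin n) → ℝ) : Prop :=
  ∃ ε > (0 : ℝ), ∃ C : ℝ,
    (∀ x y, x ≠ y → |K x y| ≤ C / ‖x - y‖ ^ n) ∧
    ∀ x y z, x ≠ y → 2 * ‖z‖ < ‖x - y‖ →
      |K (x + z) y - K x y| + |K x (y + z) - K x y| ≤ C * ‖z‖ ^ ε / ‖x - y‖ ^ (n + ε)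

/-- The bounded operator `T` on `L²` is a Calderón–Zygmund operator with kernel `K`: for compactly
supported `f ∈ L²`, `Tf(x) = ∫ K(x,y) f(y) dy` for almost every `x` outside the support of `f`. -/
def IsCZOperator {n : ℕ} (T : L2 n →L[ℝ] L2 n)
    (K : EuclideanSpace ℝ (Fin n) → EuclideanSpace ℝ (Fin n) → ℝ) : Prop :=
  IsCZKernel K ∧
  ∀ (f : EuclideanSpace ℝ (Fin n) → ℝ) (hf : MemLp f 2), HasCompactSupport f →
    ∀ᵐ x, x ∉ tsupport f → T (hf.toLp f) x = ∫ y, K x y * f y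

/-- The kernel is twice differentiable off the diagonal, its first derivatives (in both variables
jointly) are `O(|x-y|^{-n-1})` and its second derivatives are `O(|x-y|^{-n-2})`. -/
def HasKernelDerivBounds {n : ℕ}
    (K : EuclideanSpace ℝ (Fin n) → EuclideanSpace ℝ (Fin n) → ℝ) : Prop :=
  ∃ C : ℝ, ∀ x y, x ≠ y →
    DifferentiableAt ℝ (Function.uncurry K) (x, y) ∧
    DifferentiableAt ℝ (fderiv ℝ (Function.uncurry K)) (x, y) ∧
    ‖fderiv ℝ (Function.uncurry K) (x, y)‖ ≤ C / ‖x - y‖ ^ (n + 1) ∧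
    ‖fderiv ℝ (fderiv ℝ (Function.uncurry K)) (x, y)‖ ≤ C / ‖x - y‖ ^ (n + 2)

/-- The representative of `T(1)` on the ball `B(0,R)`, defined modulo an additive constant:
`T(1_{B(0,2R)})(x) + ∫_{|y| ≥ 2R} (K(x,y) - K(0,y)) dy`. For `|x| < R` the integral converges
absolutely, and for different `R` the representatives differ by constants on the smaller ball. -/
def localTOne {n : ℕ} (T : L2 n →L[ℝ] L2 n)
    (K : EuclideanSpace ℝ (Fin n) → EuclideanSpace ℝ (Fin n) → ℝ) (R : ℝ)
    (x : EuclideanSpace ℝ (Fin n)) : ℝ :=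
  T (indicatorConstLp 2 (measurableSet_ball (x := (0 : EuclideanSpace ℝ (Fin n))) (ε := 2 * R))
      measure_ball_lt_top.ne (1 : ℝ)) x
    + ∫ y in (ball (0 : EuclideanSpace ℝ (Fin n)) (2 * R))ᶜ, (K x y - K 0 y)

/-- `T(1) = 0` in `BMO`, that is, `T(1)` is constant almost everywhere. -/
def TOneEqZero {n : ℕ} (T : L2 n →L[ℝ] L2 n)
    (K : EuclideanSpace ℝ (Fin n) → EuclideanSpace ℝ (Fin n) → ℝ) : Prop :=
  ∀ R > (0 : ℝ), ∃ c : ℝ, ∀ᵐ x, x ∈ ball (0 : EuclideanSpace ℝ (Fin n)) R →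
    localTOne T K R x = c

/-- `T` maps `W^{1,2}` to functions with square-integrable gradient, and
`‖∇Tf‖₂ ≲ ‖∇f‖₂` for all `f ∈ W^{1,2}`. -/
def GradientL2Bound {n : ℕ} (T : L2 n →L[ℝ] L2 n) : Prop :=
  ∃ A : ℝ≥0, ∀ (f : L2 n) (g : EuclideanSpace ℝ (Fin n) → EuclideanSpace ℝ (Fin n)),
    IsW12 f g → ∃ h : EuclideanSpace ℝ (Fin n) → EuclideanSpace ℝ (Fin n),
      IsW12 (T f) h ∧ eLpNorm h 2 volume ≤ A * eLpNorm g 2 volume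

end

/-!
The estimates rest on the action of `T` on functions modulo constants. Since `T(1) = 0`, on an open
set where `F` is equal to a constant `c` the gradient of `T F` is the absolutely convergent integral
`∫ ∇ₓK(x,y) (F(y) - c) dy` (`IsTGradient.inner_eq_integral`). The kernel `∇ₓK` is of size
`|x - y|⁻ⁿ⁻¹`, one power more singular than a Calderón–Zygmund kernel, and the Poincaré inequality
for `F - c` makes up for that power.

*Weak type.* The map `∇f ↦ ∇Tf` is bounded on `L²` by hypothesis, and of weak type `(1,1)` by a
Calderón–Zygmund decomposition of `f` itself (`GradientBound.weak_type`). Let `F` be the closed set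
where the maximal function of `|∇f|` is at most `t`, and let `d` be the distance to `F`. The good
part of `f` at `x` is the mean value of `f` over the ball of radius `d(x)/2` around `x`
(`goodPart`); its gradient is `O(t)`, with `L¹` norm `O(‖∇f‖₁)`, so that the `L²` bound applies. The
bad part vanishes on `F` and is bounded by `d β` with `‖β‖₁ = O(‖∇f‖₁)`. Up to a part that is
concentrated near `F` and small in `W^{1,2}` (`nearPart`), it vanishes in a neighbourhood of `F`, so
the kernel representation gives `∫_F |∇T(bad part)| = O(‖β‖₁)` (`IsTGradient.setLIntegral_le`).

*Local estimates.* To a cube `q` belongs the localization of `f`: the mean value over a comparable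
ball is subtracted, and the result is cut off (`localize`). By the Poincaré inequality the `L¹` norm
of its gradient is controlled by the integral of `|∇f|` near `q`. The difference between a function
and its localization to a subcube `p` is constant near `p`, and by the bound on the second
derivatives of `K` its contribution to the gradient oscillates on `p` by no more than the maximal
function of the gradient (`IsTGradient.exists_osc_le`). The weak-type estimate provides a point of
`p` where both gradients are small, so the contribution is itself small on `p`
(`GradientBound.exists_enorm_le_add`). Hence, outside a small open exceptional set, the gradient for
`q` is at most a multiple of the average of `|∇f|` near `q`; on a subcube of which the exceptional
set occupies at most half, it is at most that multiple plus the gradient for the subcube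
(`GradientBound.exists_exceptional`).

*Stopping cubes.* In the dyadic grid with all shifts equal to `1/3` the cubes that contain the
origin exhaust the space. The children of a cube are the maximal subcubes of which the exceptional
set occupies a substantial part, or which contain the origin. The second alternative makes the
families of stopping cubes that start from the cubes around the origin increasing, so that their
union is one family, in which every cube keeps a quarter of its volume outside its children.
Iteration of the local estimates bounds the gradients for all the cubes around the origin by one sum
over this family (`ae_le_tsum_stoppingFamily`). These gradients converge in `L²` to the gradient of
`T f` (`GradientBound.tendsto_eLpNorm_sub`), and the balls around the stopping cubes are contained
in cubes of comparable size of the full collection, by the one-third trick (`exists_isSparse`). The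
same convergence extends the weak-type estimate to functions without compact support, since a bound
on level sets passes to limits in `L²` (`mul_volume_le_of_forall_exists`).
-/

noncomputable section

open Filter Topology

/-- Euclidean space `ℝⁿ`. -/
abbrev Euc (n : ℕ) : Type := EuclideanSpace ℝ (Fin n)

/-! ### Weak gradients and Sobolev functions -/

section WeakGradient

variable {n : ℕ}

theorem norm_gradient (u : Euc n → ℝ) (x : Euc n) : ‖gradient u x‖ = ‖fderiv ℝ u x‖ := by
  simp [gradient]

theorem inner_gradient (u : Euc n → ℝ) (x v : Euc n) :
    inner ℝ (gradient u x) v = fderiv ℝ u x v := by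
  simp [gradient]

theorem measurable_gradient (u : Euc n → ℝ) : Measurable (gradient u) :=
  (InnerProductSpace.toDual ℝ (Euc n)).symm.continuous.measurable.comp (measurable_fderiv ℝ u)

theorem MeasureTheory.LocallyIntegrable.inner_right {g : Euc n → Euc n}
    (hg : LocallyIntegrable g) (v : Euc n) : LocallyIntegrable fun x => inner ℝ (g x) v := by
  have hv : LocallyIntegrable fun x => ‖v‖ • g x := hg.smul ‖v‖
  refine hv.mono (hg.aestronglyMeasurable.inner aestronglyMeasurable_const)
    (Eventually.of_forall fun x => ?_)
  have := norm_inner_le_norm (𝕜 := ℝ) (g x) v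
  rwa [norm_smul, norm_norm, mul_comm]

theorem MeasureTheory.LocallyIntegrable.integrable_mul_of_hasCompactSupport {f φ : Euc n → ℝ}
    (hf : LocallyIntegrable f) (hφ : Continuous φ) (hc : HasCompactSupport φ) :
    Integrable fun x => f x * φ x :=
  hf.integrable_smul_right_of_hasCompactSupport hφ hc

theorem ContDiff.continuous_fderiv_apply_const {φ : Euc n → ℝ} (hφ : ContDiff ℝ ∞ φ) (v : Euc n) :
    Continuous fun x => fderiv ℝ φ x v :=
  (hφ.continuous_fderiv (by simp)).clm_apply continuous_const

namespace HasWeakGradient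

variable {f f' : Euc n → ℝ} {g g' : Euc n → Euc n}

theorem congr (h : HasWeakGradient f g) (hf : f =ᵐ[volume] f') (hg : g =ᵐ[volume] g') :
    HasWeakGradient f' g' := by
  refine ⟨h.1.congr hf, h.2.1.congr hg, fun φ hφ hc v => ?_⟩
  rw [← integral_congr_ae (hf.mono fun x hx => by simp only [hx] : (fun x => f x * fderiv ℝ φ x v)
    =ᵐ[volume] fun x => f' x * fderiv ℝ φ x v), h.2.2 φ hφ hc v]
  exact congrArg _ (integral_congr_ae (hg.mono fun x hx => by simp only [hx]))

theorem add (h : HasWeakGradient f g) (h' : HasWeakGradient f' g') :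
    HasWeakGradient (f + f') (g + g') := by
  refine ⟨h.1.add h'.1, h.2.1.add h'.2.1, fun φ hφ hc v => ?_⟩
  have hφ' := hφ.continuous_fderiv_apply_const v
  have hc' := hc.fderiv_apply ℝ v
  simp only [Pi.add_apply, add_mul, inner_add_left]
  rw [integral_add (h.1.integrable_mul_of_hasCompactSupport hφ' hc')
    (h'.1.integrable_mul_of_hasCompactSupport hφ' hc'),
    integral_add ((h.2.1.inner_right v).integrable_mul_of_hasCompactSupport hφ.continuous hc)
    ((h'.2.1.inner_right v).integrable_mul_of_hasCompactSupport hφ.continuous hc),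
    h.2.2 φ hφ hc v, h'.2.2 φ hφ hc v, neg_add]

theorem neg (h : HasWeakGradient f g) : HasWeakGradient (-f) (-g) := by
  refine ⟨h.1.neg, h.2.1.neg, fun φ hφ hc v => ?_⟩
  simp only [Pi.neg_apply, neg_mul, inner_neg_left, integral_neg, h.2.2 φ hφ hc v]

theorem sub (h : HasWeakGradient f g) (h' : HasWeakGradient f' g') :
    HasWeakGradient (f - f') (g - g') := by
  simpa only [sub_eq_add_neg] using h.add h'.neg

/-- Functions that define the same distribution on an open set agree there almost everywhere. -/
theorem ae_eq_of_forall_integral_mul {U : Set (Euc n)} (hU : IsOpen U) {p q : Euc n → ℝ}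
    (hp : LocallyIntegrableOn p U) (hq : LocallyIntegrableOn q U)
    (h : ∀ φ : Euc n → ℝ, ContDiff ℝ ∞ φ → HasCompactSupport φ → tsupport φ ⊆ U →
      ∫ x, p x * φ x = ∫ x, q x * φ x) : ∀ᵐ x, x ∈ U → p x = q x := by
  have key := hU.ae_eq_zero_of_integral_contDiff_smul_eq_zero (μ := volume) (hp.sub hq) ?_
  · filter_upwards [key] with x hx hxU
    exact sub_eq_zero.1 (hx hxU)
  · intro φ hφ hc hs
    have i1 : ∀ r : Euc n → ℝ, LocallyIntegrableOn r U → Integrable fun x => r x * φ x := by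
      intro r hr
      have h1 : IntegrableOn (fun x => r x * φ x) (tsupport φ) :=
        ((locallyIntegrableOn_iff hU.isLocallyClosed).1 hr _ hs hc).mul_continuousOn
          hφ.continuous.continuousOn hc
      refine (integrableOn_iff_integrable_of_support_subset ?_).1 h1
      intro x hx
      exact subset_tsupport φ (right_ne_zero_of_mul hx)
    have : ∀ x, φ x • (p - q) x = p x * φ x - q x * φ x := fun x => by
      simp only [Pi.sub_apply, smul_eq_mul]; ring
    simp_rw [this]
    rw [integral_sub (i1 p hp) (i1 q hq), h φ hφ hc hs, sub_self]

theorem ae_unique (h : HasWeakGradient f g) (h' : HasWeakGradient f g') : g =ᵐ[volume] g' := by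
  have : ∀ i : Fin n, ∀ᵐ x, g x i = g' x i := by
    intro i
    have := ae_eq_of_forall_integral_mul isOpen_univ
      (p := fun x => inner ℝ (g x) (EuclideanSpace.single i (1 : ℝ)))
      (q := fun x => inner ℝ (g' x) (EuclideanSpace.single i (1 : ℝ)))
      ((h.2.1.inner_right _).locallyIntegrableOn _) ((h'.2.1.inner_right _).locallyIntegrableOn _)
      (fun φ hφ hc _ => by
        rw [← neg_inj, ← h.2.2 φ hφ hc, ← h'.2.2 φ hφ hc])
    filter_upwards [this] with x hx
    simpa [EuclideanSpace.inner_single_right] using hx (mem_univ x)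
  filter_upwards [ae_all_iff.2 this] with x hx
  ext i
  exact hx i

/-- The product rule with a smooth compactly supported cutoff `η`. -/
theorem smooth_mul (h : HasWeakGradient f g) {η : Euc n → ℝ} (hη : ContDiff ℝ ∞ η)
    (hηc : HasCompactSupport η) :
    HasWeakGradient (fun x => η x * f x) (fun x => η x • g x + f x • gradient η x) := by
  have hgc : Continuous (gradient η) :=
    (InnerProductSpace.toDual ℝ (Euc n)).symm.continuous.comp (hη.continuous_fderiv (by simp))
  have hgs : HasCompactSupport (gradient η) :=
    (hηc.fderiv (𝕜 := ℝ)).comp_left (g := (InnerProductSpace.toDual ℝ (Euc n)).symm) (map_zero _)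
  have i2 : Integrable fun x => f x • gradient η x :=
    h.1.integrable_smul_right_of_hasCompactSupport hgc hgs
  have i1 : Integrable fun x => η x • g x :=
    h.2.1.integrable_smul_left_of_hasCompactSupport hη.continuous hηc
  refine ⟨?_, (i1.add i2).locallyIntegrable, fun φ hφ hc v => ?_⟩
  · exact (h.1.integrable_smul_left_of_hasCompactSupport hη.continuous hηc).locallyIntegrable
  have e := h.2.2 (fun x => η x * φ x) (hη.mul hφ) (hc.mul_left) v
  have hd : ∀ x, fderiv ℝ (fun x => η x * φ x) x v
      = η x * fderiv ℝ φ x v + φ x * fderiv ℝ η x v := by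
    intro x
    rw [fderiv_fun_mul (hη.differentiable (by simp) x) (hφ.differentiable (by simp) x)]
    simp
  simp_rw [hd, mul_add] at e
  have j1 : Integrable fun x => f x * (η x * fderiv ℝ φ x v) :=
    h.1.integrable_mul_of_hasCompactSupport
      (hη.continuous.mul (hφ.continuous_fderiv_apply_const v)) ((hc.fderiv_apply ℝ v).mul_left)
  have j2 : Integrable fun x => f x * (φ x * fderiv ℝ η x v) :=
    h.1.integrable_mul_of_hasCompactSupport
      (hφ.continuous.mul (hη.continuous_fderiv_apply_const v)) hc.mul_right
  rw [integral_add j1 j2] at e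
  have j3 : Integrable fun x => inner ℝ (g x) v * (η x * φ x) :=
    (h.2.1.inner_right v).integrable_mul_of_hasCompactSupport
      (hη.continuous.mul hφ.continuous) hc.mul_left
  have : ∀ x, inner ℝ (η x • g x + f x • gradient η x) v * φ x
      = inner ℝ (g x) v * (η x * φ x) + f x * (φ x * fderiv ℝ η x v) := by
    intro x
    rw [inner_add_left, inner_smul_left, inner_smul_left, inner_gradient]
    simp only [conj_trivial]
    ring
  simp_rw [this]
  rw [integral_add j3 j2]
  have : ∀ x, η x * f x * fderiv ℝ φ x v = f x * (η x * fderiv ℝ φ x v) := fun x => by ring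
  simp_rw [this]
  linarith

theorem const (c : ℝ) : HasWeakGradient (fun _ : Euc n => c) (fun _ => 0) := by
  refine ⟨locallyIntegrable_const c, locallyIntegrable_const 0, fun φ hφ hc v => ?_⟩
  have hφ' := hφ.continuous_fderiv_apply_const v
  have i1 : Integrable fun x => fderiv ℝ φ x v :=
    hφ'.integrable_of_hasCompactSupport (hc.fderiv_apply ℝ v)
  have := integral_mul_fderiv_eq_neg_fderiv_mul_of_integrable (μ := volume) (𝕜 := ℝ)
    (f := fun _ : Euc n => c) (g := φ) (v := v) (by simp) (i1.const_mul c)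
    ((hφ.continuous.integrable_of_hasCompactSupport hc).const_mul c)
    (fun x _ => differentiableAt_const c) (fun x _ => hφ.differentiable (by simp) x)
  simpa using this

end HasWeakGradient

/-- A Lipschitz function is weakly differentiable, and its weak gradient is its pointwise gradient,
which exists almost everywhere by Rademacher's theorem. -/
theorem LipschitzWith.hasWeakGradient {u : Euc n → ℝ} {L : ℝ≥0} (hu : LipschitzWith L u) :
    HasWeakGradient u (gradient u) := by
  have hli : LocallyIntegrable (gradient u) := by
    refine (locallyIntegrable_const (L : ℝ)).mono (measurable_gradient u).aestronglyMeasurable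
      (Eventually.of_forall fun x => ?_)
    rw [norm_gradient]
    simpa using norm_fderiv_le_of_lipschitz ℝ hu
  refine ⟨hu.continuous.locallyIntegrable, hli, fun φ hφ hc v => ?_⟩
  obtain ⟨D, hD⟩ := hφ.lipschitzWith_of_hasCompactSupport hc (by simp)
  have e := hu.integral_lineDeriv_mul_eq (μ := volume) hD hc v
  have e1 : ∫ x, lineDeriv ℝ u x v * φ x = ∫ x, inner ℝ (gradient u x) v * φ x := by
    refine integral_congr_ae ?_
    filter_upwards [hu.ae_differentiableAt (μ := volume)] with x hx
    rw [hx.lineDeriv_eq_fderiv, inner_gradient]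
  have e2 : ∀ x, lineDeriv ℝ φ x (-v) * u x = - (u x * fderiv ℝ φ x v) := by
    intro x
    rw [(hφ.differentiable (by simp) x).lineDeriv_eq_fderiv, map_neg]
    ring
  simp_rw [e2, integral_neg] at e
  rw [← e1, e, neg_neg]

/-- The function `u` belongs to `W^{1,2}(ℝⁿ)`, with weak gradient `g`. -/
structure SobolevPair (u : Euc n → ℝ) (g : Euc n → Euc n) : Prop where
  memLp : MemLp u 2
  memLp_grad : MemLp g 2
  weak : HasWeakGradient u g

namespace SobolevPair

variable {u u' : Euc n → ℝ} {g g' : Euc n → Euc n}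

theorem sub (h : SobolevPair u g) (h' : SobolevPair u' g') : SobolevPair (u - u') (g - g') :=
  ⟨h.memLp.sub h'.memLp, h.memLp_grad.sub h'.memLp_grad, h.weak.sub h'.weak⟩

theorem of_lipschitz {L : ℝ≥0} (hu : LipschitzWith L u) (hc : HasCompactSupport u) :
    SobolevPair u (gradient u) := by
  refine ⟨hu.continuous.memLp_of_hasCompactSupport hc, ?_, hu.hasWeakGradient⟩
  have hs : HasCompactSupport (gradient u) :=
    (hc.fderiv (𝕜 := ℝ)).comp_left (g := (InnerProductSpace.toDual ℝ (Euc n)).symm) (map_zero _)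
  refine hs.memLp_of_bound (measurable_gradient u).aestronglyMeasurable L
    (Eventually.of_forall fun x => ?_)
  rw [norm_gradient]
  exact norm_fderiv_le_of_lipschitz ℝ hu

end SobolevPair

/-- The function `u` is square integrable and `h` is the weak gradient of `T u`. -/
def IsTGradient (T : L2 n →L[ℝ] L2 n) (u : Euc n → ℝ) (h : Euc n → Euc n) : Prop :=
  ∃ hu : MemLp u 2, HasWeakGradient (T (hu.toLp u)) h

namespace IsTGradient

variable {T : L2 n →L[ℝ] L2 n} {u u' : Euc n → ℝ} {h h' : Euc n → Euc n}

theorem sub (H : IsTGradient T u h) (H' : IsTGradient T u' h') :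
    IsTGradient T (u - u') (h - h') := by
  obtain ⟨hu, H⟩ := H
  obtain ⟨hu', H'⟩ := H'
  refine ⟨hu.sub hu', (H.sub H').congr ?_ EventuallyEq.rfl⟩
  rw [MemLp.toLp_sub, map_sub]
  exact (Lp.coeFn_sub _ _).symm

end IsTGradient

/-- The boundedness of `T` on `W^{1,2}`, in terms of functions: for a Sobolev function `u` a weak
gradient of `T u` exists, and each one has `L²` norm at most `A ‖∇u‖₂`. -/
def GradientBound (T : L2 n →L[ℝ] L2 n) (A : ℝ≥0) : Prop :=
  ∀ u g, SobolevPair u g → (∃ h, IsTGradient T u h) ∧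
    ∀ h, IsTGradient T u h → MemLp h 2 ∧ eLpNorm h 2 volume ≤ A * eLpNorm g 2 volume

theorem GradientL2Bound.exists_gradientBound {T : L2 n →L[ℝ] L2 n} (hT : GradientL2Bound T) :
    ∃ A : ℝ≥0, GradientBound T A := by
  obtain ⟨A, hA⟩ := hT
  refine ⟨A, fun u g hug => ?_⟩
  obtain ⟨h, hh, hle⟩ := hA (hug.memLp.toLp u) g
    ⟨hug.memLp_grad, hug.weak.congr hug.memLp.coeFn_toLp.symm EventuallyEq.rfl⟩
  refine ⟨⟨h, hug.memLp, hh.2⟩, fun h' hh' => ?_⟩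
  have e := hh'.2.ae_unique hh.2
  exact ⟨hh.1.ae_eq e.symm, by rwa [eLpNorm_congr_ae e]⟩

end WeakGradient

/-! ### Approximation by smooth functions -/

section Mollification

variable {n : ℕ} {F : Type*} [NormedAddCommGroup F]

theorem eLpNorm_two_sq {α : Type*} [MeasurableSpace α] {μ : Measure α} (f : α → F) :
    eLpNorm f 2 μ ^ 2 = ∫⁻ x, ‖f x‖ₑ ^ 2 ∂μ := by
  rw [eLpNorm_eq_lintegral_rpow_enorm_toReal (by simp) (by simp), ← ENNReal.rpow_natCast,
    ← ENNReal.rpow_mul]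
  simp

/-- Translations act continuously on `L²`. -/
theorem exists_eLpNorm_sub_translate_le {g : Euc n → F} (hg : MemLp g 2) {ε : ℝ≥0∞} (hε : 0 < ε) :
    ∃ δ > 0, ∀ t : Euc n, ‖t‖ < δ → eLpNorm (fun x => g (x - t) - g x) 2 volume ≤ ε := by
  let G : Euc n → C(Euc n, Euc n) := fun t => ⟨fun x => x - t, by fun_prop⟩
  have hG : Continuous G := by
    have : Continuous fun p : Euc n × Euc n => p.2 - p.1 := by fun_prop
    exact (ContinuousMap.mk _ this).curry.continuous
  have hm : ∀ t, MeasurePreserving (G t) volume volume := fun t =>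
    measurePreserving_sub_right volume t
  have hc : Continuous fun t => Lp.compMeasurePreserving (G t) (hm t) (hg.toLp g) :=
    continuous_const.compMeasurePreservingLp hG hm (by simp)
  have h0 := hc.tendsto 0
  rw [tendsto_iff_edist_tendsto_0] at h0
  obtain ⟨δ, hδ, h⟩ := Metric.eventually_nhds_iff.1 (h0.eventually (ge_mem_nhds hε))
  refine ⟨δ, hδ, fun t ht => ?_⟩
  have := h (y := t) (by simpa using ht)
  rw [Lp.edist_def] at this
  refine le_trans (le_of_eq ?_) this
  refine eLpNorm_congr_ae ?_
  have e1 := Lp.coeFn_compMeasurePreserving (hg.toLp g) (hm t)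
  have e2 := Lp.coeFn_compMeasurePreserving (hg.toLp g) (hm 0)
  have e3 := (hm t).quasiMeasurePreserving.ae_eq_comp hg.coeFn_toLp
  filter_upwards [e1, e2, e3, hg.coeFn_toLp] with x h1 h2 h3 h4
  have e5 : (G 0) x = x := sub_zero x
  simp only [Function.comp_apply] at h3
  rw [Pi.sub_apply, h1, h2, Function.comp_apply, Function.comp_apply, h3, e5, h4]
  rfl

theorem aestronglyMeasurable_translate {g : Euc n → F} (hg : AEStronglyMeasurable g volume) :
    AEStronglyMeasurable (fun p : Euc n × Euc n => g (p.1 - p.2)) (volume.prod volume) :=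
  hg.comp_quasiMeasurePreserving (quasiMeasurePreserving_sub volume volume)

variable [NormedSpace ℝ F]

/-- The average of `g` around a point, with weight `φ`. -/
def mollify (φ : Euc n → ℝ) (g : Euc n → F) (x : Euc n) : F := ∫ t, φ (x - t) • g t

theorem mollify_eq (φ : Euc n → ℝ) (g : Euc n → F) (x : Euc n) :
    mollify φ g x = ∫ s, φ s • g (x - s) := by
  rw [mollify, ← integral_sub_left_eq_self _ volume x]
  simp

variable {φ : Euc n → ℝ} {g : Euc n → F}

theorem enorm_mollify_le (hφ0 : ∀ x, 0 ≤ φ x) (x : Euc n) :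
    ‖mollify φ g x‖ₑ ≤ ∫⁻ s, ENNReal.ofReal (φ s) * ‖g (x - s)‖ₑ := by
  rw [mollify_eq]
  refine (enorm_integral_le_lintegral_enorm _).trans (le_of_eq (lintegral_congr fun s => ?_))
  rw [enorm_smul, Real.enorm_eq_ofReal (hφ0 s)]

theorem lintegral_ofReal_eq_one (hφ : Integrable φ) (hφ0 : ∀ x, 0 ≤ φ x) (hφ1 : ∫ x, φ x = 1) :
    ∫⁻ x, ENNReal.ofReal (φ x) = 1 := by
  rw [← ofReal_integral_eq_lintegral_ofReal hφ (Eventually.of_forall hφ0), hφ1, ENNReal.ofReal_one]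

theorem lintegral_enorm_mollify_le (hφ : Integrable φ) (hφ0 : ∀ x, 0 ≤ φ x) (hφ1 : ∫ x, φ x = 1)
    (hg : AEStronglyMeasurable g volume) : ∫⁻ x, ‖mollify φ g x‖ₑ ≤ ∫⁻ x, ‖g x‖ₑ := by
  refine (lintegral_mono (enorm_mollify_le hφ0)).trans ?_
  rw [lintegral_lintegral_swap]
  · have : ∀ s : Euc n, ∫⁻ x, ENNReal.ofReal (φ s) * ‖g (x - s)‖ₑ
        = ENNReal.ofReal (φ s) * ∫⁻ x, ‖g x‖ₑ := by
      intro s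
      rw [lintegral_const_mul' _ _ ENNReal.ofReal_ne_top,
        lintegral_sub_right_eq_self (fun x => ‖g x‖ₑ)]
    simp_rw [this]
    rw [lintegral_mul_const'' _ hφ.aemeasurable.ennreal_ofReal,
      lintegral_ofReal_eq_one hφ hφ0 hφ1, one_mul]
  · exact (hφ.aemeasurable.ennreal_ofReal.comp_snd).mul
      (aestronglyMeasurable_translate hg).enorm

/-- Jensen's inequality for the square, in the form of the Cauchy--Schwarz inequality. -/
theorem sq_lintegral_ofReal_mul_le (hφ : Integrable φ) (hφ0 : ∀ x, 0 ≤ φ x) (hφ1 : ∫ x, φ x = 1)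
    {a : Euc n → ℝ≥0∞} (ha : AEMeasurable a volume) :
    (∫⁻ s, ENNReal.ofReal (φ s) * a s) ^ 2 ≤ ∫⁻ s, ENNReal.ofReal (φ s) * a s ^ 2 := by
  have hm := hφ.aemeasurable.ennreal_ofReal
  have key := ENNReal.lintegral_mul_le_Lp_mul_Lq volume Real.HolderConjugate.two_two
    (f := fun s => ENNReal.ofReal (φ s) ^ (1 / 2 : ℝ))
    (g := fun s => ENNReal.ofReal (φ s) ^ (1 / 2 : ℝ) * a s)
    (hm.pow_const _) ((hm.pow_const _).mul ha)
  have e0 : ∀ s, ENNReal.ofReal (φ s) ^ (1 / 2 : ℝ) * ENNReal.ofReal (φ s) ^ (1 / 2 : ℝ)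
      = ENNReal.ofReal (φ s) := fun s => by
    rw [← ENNReal.rpow_add_of_nonneg _ _ (by norm_num) (by norm_num)]; norm_num
  have e1 : ∀ s, ((fun s => ENNReal.ofReal (φ s) ^ (1 / 2 : ℝ)) *
      fun s => ENNReal.ofReal (φ s) ^ (1 / 2 : ℝ) * a s) s = ENNReal.ofReal (φ s) * a s := by
    intro s
    simp only [Pi.mul_apply]
    rw [← mul_assoc, e0]
  have e2 : ∀ s, (ENNReal.ofReal (φ s) ^ (1 / 2 : ℝ)) ^ (2 : ℝ) = ENNReal.ofReal (φ s) := by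
    intro s
    rw [← ENNReal.rpow_mul]; norm_num
  have e3 : ∀ s, (ENNReal.ofReal (φ s) ^ (1 / 2 : ℝ) * a s) ^ (2 : ℝ)
      = ENNReal.ofReal (φ s) * a s ^ 2 := by
    intro s
    rw [ENNReal.mul_rpow_of_nonneg _ _ (by norm_num), e2]; norm_num
  simp_rw [e1, e2, e3] at key
  rw [lintegral_ofReal_eq_one hφ hφ0 hφ1, ENNReal.one_rpow, one_mul] at key
  calc _ ≤ ((∫⁻ s, ENNReal.ofReal (φ s) * a s ^ 2) ^ (1 / 2 : ℝ)) ^ 2 := by gcongr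
    _ = _ := by rw [← ENNReal.rpow_natCast, ← ENNReal.rpow_mul]; norm_num

theorem aestronglyMeasurable_mollify (hφ : AEStronglyMeasurable φ volume)
    (hg : AEStronglyMeasurable g volume) : AEStronglyMeasurable (mollify φ g) volume := by
  have : AEStronglyMeasurable (fun p : Euc n × Euc n => φ p.2 • g (p.1 - p.2))
      (volume.prod volume) := hφ.comp_snd.smul (aestronglyMeasurable_translate hg)
  have := this.integral_prod_right'
  exact this.congr (Eventually.of_forall fun x => (mollify_eq φ g x).symm)

/-- Convolution with an approximate identity converges in `L²`. Vector-valued functions are allowed,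
so that the statement applies to functions and to their gradients. -/
theorem exists_eLpNorm_mollify_sub_le (hg : MemLp g 2) {ε : ℝ≥0∞} (hε : 0 < ε) [CompleteSpace F] :
    ∃ δ > 0, ∀ φ : Euc n → ℝ, Continuous φ → HasCompactSupport φ → (∀ x, 0 ≤ φ x) →
      ∫ x, φ x = 1 → (∀ x, δ ≤ ‖x‖ → φ x = 0) →
        eLpNorm (g - mollify φ g) 2 volume ≤ ε := by
  obtain ⟨δ, hδ, h⟩ := exists_eLpNorm_sub_translate_le hg hε
  refine ⟨δ, hδ, fun φ hφc hφs hφ0 hφ1 hφδ => ?_⟩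
  have hφ : Integrable φ := hφc.integrable_of_hasCompactSupport hφs
  have hgl : LocallyIntegrable g := hg.locallyIntegrable (by norm_num)
  have hpt : ∀ x, ‖(g - mollify φ g) x‖ₑ ≤ ∫⁻ s, ENNReal.ofReal (φ s) * ‖g (x - s) - g x‖ₑ := by
    intro x
    have i1 : Integrable fun s => φ s • g x := hφ.smul_const _
    have i2 : Integrable fun s => φ s • g (x - s) := by
      have : Integrable fun t => φ (x - t) • g t := by
        refine hgl.integrable_smul_left_of_hasCompactSupport (hφc.comp (by fun_prop)) ?_
        exact hφs.comp_homeomorph (Homeomorph.subLeft x)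
      have := this.comp_sub_left x
      simpa using this
    have : (g - mollify φ g) x = ∫ s, -(φ s • (g (x - s) - g x)) := by
      simp only [smul_sub, neg_sub]
      rw [integral_sub i1 i2, integral_smul_const, hφ1, one_smul, ← mollify_eq]
      rfl
    rw [this]
    refine (enorm_integral_le_lintegral_enorm _).trans (le_of_eq (lintegral_congr fun s => ?_))
    rw [enorm_neg, enorm_smul, Real.enorm_eq_ofReal (hφ0 s)]
  have hmeas : AEStronglyMeasurable (fun p : Euc n × Euc n => g (p.1 - p.2) - g p.1)
      (volume.prod volume) :=
    (aestronglyMeasurable_translate hg.aestronglyMeasurable).sub hg.aestronglyMeasurable.comp_fst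
  have hx : ∀ x : Euc n, AEMeasurable (fun s => ‖g (x - s) - g x‖ₑ) volume := by
    intro x
    have h1 : AEStronglyMeasurable (fun s => g (x - s)) volume :=
      hg.aestronglyMeasurable.comp_quasiMeasurePreserving
        (Measure.measurePreserving_sub_left volume x).quasiMeasurePreserving
    exact (h1.sub aestronglyMeasurable_const).enorm
  have key : eLpNorm (g - mollify φ g) 2 volume ^ 2 ≤ ε ^ 2 := by
    rw [eLpNorm_two_sq]
    calc ∫⁻ x, ‖(g - mollify φ g) x‖ₑ ^ 2
        ≤ ∫⁻ x, ∫⁻ s, ENNReal.ofReal (φ s) * ‖g (x - s) - g x‖ₑ ^ 2 := by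
          refine lintegral_mono fun x => ?_
          calc _ ≤ _ := pow_le_pow_left' (hpt x) 2
            _ ≤ _ := sq_lintegral_ofReal_mul_le hφ hφ0 hφ1 (hx x)
      _ = ∫⁻ s, ∫⁻ x, ENNReal.ofReal (φ s) * ‖g (x - s) - g x‖ₑ ^ 2 := by
          rw [lintegral_lintegral_swap]
          exact (hφ.aemeasurable.ennreal_ofReal.comp_snd).mul (hmeas.enorm.pow_const 2)
      _ ≤ ∫⁻ s, ENNReal.ofReal (φ s) * ε ^ 2 := by
          refine lintegral_mono fun s => ?_
          simp only
          rw [lintegral_const_mul' _ _ ENNReal.ofReal_ne_top]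
          by_cases hs : ‖s‖ < δ
          · rw [← eLpNorm_two_sq (fun x => g (x - s) - g x)]
            gcongr
            exact h s hs
          · simp [hφδ s (not_lt.1 hs)]
      _ = ε ^ 2 := by
          rw [lintegral_mul_const'' _ hφ.aemeasurable.ennreal_ofReal,
            lintegral_ofReal_eq_one hφ hφ0 hφ1, one_mul]
  exact (ENNReal.pow_le_pow_left_iff two_ne_zero).1 key

end Mollification

section Density

variable {n : ℕ} {u : Euc n → ℝ} {g : Euc n → Euc n} {φ : Euc n → ℝ}

theorem mollify_eq_convolution (φ u : Euc n → ℝ) :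
    mollify φ u = convolution u φ (ContinuousLinearMap.lsmul ℝ ℝ) volume := by
  ext x
  simp only [mollify, convolution, ContinuousLinearMap.lsmul_apply, smul_eq_mul, mul_comm]

theorem contDiff_mollify (hφ : ContDiff ℝ ∞ φ) (hc : HasCompactSupport φ)
    (hu : LocallyIntegrable u) : ContDiff ℝ ∞ (mollify φ u) := by
  rw [mollify_eq_convolution]
  exact hc.contDiff_convolution_right (ContinuousLinearMap.lsmul ℝ ℝ) hu hφ (μ := volume)

theorem HasWeakGradient.gradient_mollify (h : HasWeakGradient u g) (hφ : ContDiff ℝ ∞ φ)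
    (hc : HasCompactSupport φ) (x : Euc n) : gradient (mollify φ u) x = mollify φ g x := by
  refine ext_inner_right ℝ fun v => ?_
  have hd := hc.hasFDerivAt_convolution_right (ContinuousLinearMap.lsmul ℝ ℝ) h.1
    (hφ.of_le (by simp)) x (μ := volume)
  rw [← mollify_eq_convolution] at hd
  rw [inner_gradient, hd.fderiv, convolution_precompR_apply _ h.1 (hc.fderiv ℝ)
    (hφ.continuous_fderiv (by simp))]
  simp only [convolution, ContinuousLinearMap.lsmul_apply, smul_eq_mul]
  have hψ : ContDiff ℝ ∞ fun t => φ (x - t) := hφ.comp (contDiff_const.sub contDiff_id)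
  have hψc : HasCompactSupport fun t => φ (x - t) := hc.comp_homeomorph (Homeomorph.subLeft x)
  have e := h.2.2 _ hψ hψc v
  have hf : ∀ t, fderiv ℝ (fun t => φ (x - t)) t v = - fderiv ℝ φ (x - t) v := by
    intro t
    have h1 := (hφ.differentiable (by simp) (x - t)).hasFDerivAt.comp t
      ((hasFDerivAt_const x t).sub (hasFDerivAt_id t))
    rw [show (fun t => φ (x - t)) = φ ∘ (fun t => x - t) from rfl]
    erw [h1.fderiv]
    simp
  simp_rw [hf, mul_neg, integral_neg, neg_inj] at e
  rw [e, mollify]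
  have i1 : Integrable fun t => φ (x - t) • g t :=
    h.2.1.integrable_smul_left_of_hasCompactSupport hψ.continuous hψc
  rw [real_inner_comm, ← integral_inner i1]
  refine integral_congr_ae (Eventually.of_forall fun t => ?_)
  simp only [inner_smul_right, real_inner_comm]
  ring

/-- Smooth functions are dense in `W^{1,2}`. The approximation by mollification does not increase
the `L¹` norm of the gradient, which is what allows weak-type estimates to be extended from smooth
functions. -/
theorem SobolevPair.exists_smooth_approx (h : SobolevPair u g) {ε : ℝ≥0∞} (hε : 0 < ε)
    (hε' : ε ≠ ⊤) :
    ∃ w : Euc n → ℝ, ContDiff ℝ ∞ w ∧ SobolevPair w (gradient w) ∧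
      eLpNorm (u - w) 2 volume ≤ ε ∧ eLpNorm (g - gradient w) 2 volume ≤ ε ∧
      ∫⁻ x, ‖gradient w x‖ₑ ≤ ∫⁻ x, ‖g x‖ₑ ∧
      (HasCompactSupport u → HasCompactSupport w) := by
  obtain ⟨δ₁, hδ₁, h₁⟩ := exists_eLpNorm_mollify_sub_le h.memLp hε
  obtain ⟨δ₂, hδ₂, h₂⟩ := exists_eLpNorm_mollify_sub_le h.memLp_grad hε
  let b : ContDiffBump (0 : Euc n) :=
    ⟨min δ₁ δ₂ / 2, min δ₁ δ₂, half_pos (lt_min hδ₁ hδ₂), half_lt_self (lt_min hδ₁ hδ₂)⟩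
  set φ := b.normed volume with hφdef
  have hφ : ContDiff ℝ ∞ φ := b.contDiff_normed
  have hc : HasCompactSupport φ := b.hasCompactSupport_normed
  have h0 : ∀ x, min δ₁ δ₂ ≤ ‖x‖ → φ x = 0 := by
    intro x hx
    by_contra hne
    have : x ∈ Function.support φ := hne
    rw [hφdef, b.support_normed_eq] at this
    simp only [mem_ball_zero_iff] at this
    exact absurd this (not_lt.2 hx)
  have k1 := h₁ φ hφ.continuous hc b.nonneg_normed b.integral_normed
    (fun x hx => h0 x ((min_le_left _ _).trans hx))
  have k2 := h₂ φ hφ.continuous hc b.nonneg_normed b.integral_normed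
    (fun x hx => h0 x ((min_le_right _ _).trans hx))
  have hgrad : gradient (mollify φ u) = mollify φ g :=
    funext fun x => h.weak.gradient_mollify hφ hc x
  have hint : Integrable φ := hφ.continuous.integrable_of_hasCompactSupport hc
  have hmem : ∀ {F : Type} [NormedAddCommGroup F] [NormedSpace ℝ F] {f : Euc n → F}, MemLp f 2 →
      eLpNorm (f - mollify φ f) 2 volume ≤ ε → MemLp (mollify φ f) 2 := by
    intro F _ _ f hf hle
    have : MemLp (f - mollify φ f) 2 :=
      ⟨hf.1.sub (aestronglyMeasurable_mollify hint.1 hf.1), hle.trans_lt hε'.lt_top⟩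
    simpa using hf.sub this
  have hw : ContDiff ℝ ∞ (mollify φ u) := contDiff_mollify hφ hc h.weak.1
  refine ⟨mollify φ u, hw, ⟨hmem h.memLp k1, hgrad ▸ hmem h.memLp_grad k2, ?_⟩, k1,
    hgrad ▸ k2, ?_, ?_⟩
  · refine ⟨hw.continuous.locallyIntegrable, hgrad ▸ (hmem h.memLp_grad k2).locallyIntegrable
      (by norm_num), fun ψ hψ hψc v => ?_⟩
    have hw' := hw.continuous_fderiv_apply_const v
    have hψ' := hψ.continuous_fderiv_apply_const v
    have := integral_mul_fderiv_eq_neg_fderiv_mul_of_integrable (μ := volume) (𝕜 := ℝ)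
      (f := mollify φ u) (g := ψ) (v := v)
      ((hw'.mul hψ.continuous).integrable_of_hasCompactSupport hψc.mul_left)
      ((hw.continuous.mul hψ').integrable_of_hasCompactSupport (hψc.fderiv_apply ℝ v).mul_left)
      ((hw.continuous.mul hψ.continuous).integrable_of_hasCompactSupport hψc.mul_left)
      (fun x _ => hw.differentiable (by simp) x) (fun x _ => hψ.differentiable (by simp) x)
    simpa only [inner_gradient] using this
  · rw [hgrad]
    exact lintegral_enorm_mollify_le hint b.nonneg_normed b.integral_normed
      h.memLp_grad.aestronglyMeasurable
  · intro hu
    rw [mollify_eq_convolution]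
    exact hu.convolution _ hc

end Density

/-! ### Volumes of balls and integrals over dyadic annuli -/

section Balls

variable {n : ℕ}

/-- The volume of the unit ball of `ℝⁿ`. -/
def unitVol (n : ℕ) : ℝ := (volume : Measure (Euc n)).real (ball 0 1)

theorem unitVol_pos : 0 < unitVol n :=
  ENNReal.toReal_pos (measure_ball_pos _ _ one_pos).ne' measure_ball_lt_top.ne

theorem volume_ball_eq (x : Euc n) {r : ℝ} (hr : 0 < r) :
    volume (ball x r) = ENNReal.ofReal (r ^ n * unitVol n) := by
  rw [Measure.addHaar_ball_of_pos _ _ hr, finrank_euclideanSpace_fin,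
    ENNReal.ofReal_mul (by positivity), unitVol, ofReal_measureReal]

theorem volume_closedBall_eq (x : Euc n) {r : ℝ} (hr : 0 < r) :
    volume (closedBall x r) = ENNReal.ofReal (r ^ n * unitVol n) := by
  rw [Measure.addHaar_closedBall _ _ hr.le, finrank_euclideanSpace_fin,
    ENNReal.ofReal_mul (by positivity), unitVol, ofReal_measureReal]

/-- An integral away from `x` against `|y - x|⁻ᵖ` is controlled by integrals over dyadic balls. -/
theorem lintegral_compl_ball_mul_le (x : Euc n) {r : ℝ} (hr : 0 < r) (p : ℕ)
    {w : Euc n → ℝ≥0∞} (hw : AEMeasurable w volume) :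
    ∫⁻ y in (ball x r)ᶜ, w y * ENNReal.ofReal (1 / ‖y - x‖ ^ p) ≤
      ∑' j : ℕ, ENNReal.ofReal (1 / (2 ^ j * r) ^ p) * ∫⁻ y in ball x (2 ^ (j + 1) * r), w y := by
  have hpt : ∀ y ∈ (ball x r)ᶜ, w y * ENNReal.ofReal (1 / ‖y - x‖ ^ p) ≤
      ∑' j : ℕ, ENNReal.ofReal (1 / (2 ^ j * r) ^ p) *
        (ball x (2 ^ (j + 1) * r)).indicator w y := by
    intro y hy
    have hy' : r ≤ ‖y - x‖ := by simpa [dist_eq_norm] using hy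
    obtain ⟨j, hj1, hj2⟩ := exists_nat_pow_near ((one_le_div hr).2 hy') (one_lt_two)
    rw [le_div_iff₀ hr] at hj1
    rw [div_lt_iff₀ hr] at hj2
    refine le_trans ?_ (ENNReal.le_tsum j)
    rw [indicator_of_mem (by simpa [dist_eq_norm] using hj2), mul_comm]
    gcongr
  calc _ ≤ ∫⁻ y in (ball x r)ᶜ, ∑' j : ℕ, ENNReal.ofReal (1 / (2 ^ j * r) ^ p) *
        (ball x (2 ^ (j + 1) * r)).indicator w y := setLIntegral_mono' measurableSet_ball.compl hpt
    _ ≤ ∫⁻ y, ∑' j : ℕ, ENNReal.ofReal (1 / (2 ^ j * r) ^ p) *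
        (ball x (2 ^ (j + 1) * r)).indicator w y := setLIntegral_le_lintegral _ _
    _ = _ := by
      rw [lintegral_tsum fun j => ((hw.indicator measurableSet_ball).const_mul _)]
      refine tsum_congr fun j => ?_
      rw [lintegral_const_mul' _ _ ENNReal.ofReal_ne_top, lintegral_indicator measurableSet_ball]

theorem tsum_ofReal_mul_half_pow {c : ℝ} (hc : 0 ≤ c) :
    ∑' j : ℕ, ENNReal.ofReal (c * (1 / 2) ^ j) = ENNReal.ofReal (2 * c) := by
  rw [← ENNReal.ofReal_tsum_of_nonneg (fun j => by positivity)
    (summable_geometric_two.mul_left c), tsum_mul_left, tsum_geometric_two, mul_comm]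

/-- The first derivatives of the kernel, of size `|y - x|⁻ⁿ⁻¹`, have integral `O(1/r)` away from the
diagonal. -/
theorem lintegral_compl_ball_le (x : Euc n) {r : ℝ} (hr : 0 < r) :
    ∫⁻ y in (ball x r)ᶜ, ENNReal.ofReal (1 / ‖y - x‖ ^ (n + 1)) ≤
      ENNReal.ofReal (2 ^ (n + 1) * unitVol n / r) := by
  have h := lintegral_compl_ball_mul_le x hr (n + 1) (w := fun _ => 1) aemeasurable_const
  simp only [one_mul, lintegral_const, MeasurableSet.univ, Measure.restrict_apply,
    univ_inter] at h
  refine h.trans (le_of_eq ?_)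
  have hV := unitVol_pos (n := n)
  have : ∀ j : ℕ, ENNReal.ofReal (1 / (2 ^ j * r) ^ (n + 1)) * volume (ball x (2 ^ (j + 1) * r))
      = ENNReal.ofReal (2 ^ n * unitVol n / r * (1 / 2) ^ j) := by
    intro j
    rw [volume_ball_eq _ (by positivity), ← ENNReal.ofReal_mul (by positivity)]
    congr 1
    have : (2 : ℝ) ^ (j + 1) * r = 2 * (2 ^ j * r) := by ring
    have h2 : (0 : ℝ) < 2 ^ j * r := by positivity
    have h3 : (1 / 2 : ℝ) ^ j = r / (2 ^ j * r) := by rw [one_div_pow]; field_simp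
    rw [this, mul_pow 2 (2 ^ j * r), h3]
    generalize (2 : ℝ) ^ j * r = a at h2
    field_simp
    ring
  simp_rw [this]
  rw [tsum_ofReal_mul_half_pow (by positivity)]
  congr 1
  ring

/-- Hölder's inequality on a set of finite measure. -/
theorem setLIntegral_enorm_le_eLpNorm_two {F : Type*} [NormedAddCommGroup F] {f : Euc n → F}
    (hf : AEStronglyMeasurable f volume) (s : Set (Euc n)) :
    ∫⁻ x in s, ‖f x‖ₑ ≤ eLpNorm f 2 volume * volume s ^ (1 / 2 : ℝ) := by
  have h := eLpNorm_le_eLpNorm_mul_rpow_measure_univ (μ := volume.restrict s)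
    (show (1 : ℝ≥0∞) ≤ 2 by norm_num) hf.restrict
  rw [eLpNorm_one_eq_lintegral_enorm] at h
  refine h.trans ?_
  simp only [Measure.restrict_apply, MeasurableSet.univ, univ_inter, ENNReal.toReal_one,
    ENNReal.toReal_ofNat]
  norm_num
  exact mul_le_mul_left (eLpNorm_mono_measure f Measure.restrict_le_self) _

end Balls

/-! ### The Poincaré inequality -/

section Poincare

variable {n : ℕ}

theorem ContDiff.enorm_sub_le_lintegral {w : Euc n → ℝ} (hw : ContDiff ℝ ∞ w) (x v : Euc n) :
    ‖w (x + v) - w x‖ₑ ≤ ‖v‖ₑ * ∫⁻ t in Ioc (0 : ℝ) 1, ‖gradient w (x + t • v)‖ₑ := by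
  have hd : ∀ t ∈ uIcc (0 : ℝ) 1,
      HasDerivAt (fun t : ℝ => w (x + t • v)) (fderiv ℝ w (x + t • v) v) t := by
    intro t _
    have h1 : HasDerivAt (fun t : ℝ => x + t • v) v t := by
      simpa using ((hasDerivAt_id t).smul_const v).const_add x
    exact (hw.differentiable (by simp) _).hasFDerivAt.comp_hasDerivAt t h1
  have hc : Continuous fun t : ℝ => fderiv ℝ w (x + t • v) v :=
    ((hw.continuous_fderiv (by simp)).comp (by fun_prop)).clm_apply continuous_const
  have e := intervalIntegral.integral_eq_sub_of_hasDerivAt hd (hc.intervalIntegrable 0 1)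
  simp only [one_smul, zero_smul, add_zero] at e
  rw [← e, intervalIntegral.integral_of_le zero_le_one,
    ← lintegral_const_mul' _ _ enorm_ne_top]
  refine (enorm_integral_le_lintegral_enorm _).trans (lintegral_mono fun t => ?_)
  have := (fderiv ℝ w (x + t • v)).le_opENorm v
  rw [mul_comm]
  refine this.trans (le_of_eq ?_)
  congr 1
  rw [← ofReal_norm, ← ofReal_norm, norm_gradient]

theorem ContDiff.continuous_gradient {w : Euc n → ℝ} (hw : ContDiff ℝ ∞ w) :
    Continuous (gradient w) :=
  (InnerProductSpace.toDual ℝ (Euc n)).symm.continuous.comp (hw.continuous_fderiv (by simp))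

/-- The Poincaré inequality in `L¹` on a ball, as a double integral: the increment `w y - w x` is
the integral of the gradient over the segment from `x` to `y`, which lies in the ball, and `y - x`
ranges over a ball of radius `2R`. -/
theorem ContDiff.poincare_double {w : Euc n → ℝ} (hw : ContDiff ℝ ∞ w) (x₀ : Euc n) {R : ℝ} :
    ∫⁻ x in ball x₀ R, ∫⁻ y in ball x₀ R, ‖w y - w x‖ₑ ≤
      ENNReal.ofReal (2 * R) * volume (ball (0 : Euc n) (2 * R)) *
        ∫⁻ y in ball x₀ R, ‖gradient w y‖ₑ := by
  set B := ball x₀ R with hB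
  have hBm : MeasurableSet B := measurableSet_ball
  set Φ : Euc n → ℝ≥0∞ := B.indicator fun y => ‖gradient w y‖ₑ with hΦ
  have hΦm : Measurable Φ := hw.continuous_gradient.enorm.measurable.indicator hBm
  have h1 : ∀ x ∈ B, ∫⁻ y in B, ‖w y - w x‖ₑ ≤
      ∫⁻ v in ball (0 : Euc n) (2 * R), ENNReal.ofReal (2 * R) *
        ∫⁻ t in Ioc (0 : ℝ) 1, Φ (x + t • v) := by
    intro x hx
    rw [← lintegral_indicator hBm, ← lintegral_indicator measurableSet_ball,
      ← lintegral_add_left_eq_self _ x]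
    refine lintegral_mono fun v => ?_
    by_cases hv : x + v ∈ B
    · have hvn : ‖v‖ < 2 * R := by
        have h1 := mem_ball.1 hx
        have h2 := mem_ball.1 hv
        have h3 := dist_triangle_right (x + v) x x₀
        rw [dist_eq_norm, add_sub_cancel_left] at h3
        linarith
      rw [indicator_of_mem hv, indicator_of_mem (by simpa using hvn)]
      refine (hw.enorm_sub_le_lintegral x v).trans ?_
      gcongr ?_ * ?_
      · rw [← ofReal_norm]
        exact ENNReal.ofReal_le_ofReal hvn.le
      · refine setLIntegral_mono' measurableSet_Ioc fun t ht => ?_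
        rw [hΦ, indicator_of_mem]
        have := (convex_ball x₀ R).add_smul_sub_mem hx hv ⟨ht.1.le, ht.2⟩
        rwa [add_sub_cancel_left] at this
    · rw [indicator_of_notMem hv]
      exact zero_le
  have hjm : Measurable fun p : Euc n × Euc n × ℝ => Φ (p.1 + p.2.2 • p.2.1) :=
    hΦm.comp (by fun_prop)
  calc _ ≤ ∫⁻ x in B, ∫⁻ v in ball (0 : Euc n) (2 * R), ENNReal.ofReal (2 * R) *
        ∫⁻ t in Ioc (0 : ℝ) 1, Φ (x + t • v) := setLIntegral_mono' hBm h1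
    _ ≤ ∫⁻ x, ∫⁻ v in ball (0 : Euc n) (2 * R), ENNReal.ofReal (2 * R) *
        ∫⁻ t in Ioc (0 : ℝ) 1, Φ (x + t • v) := setLIntegral_le_lintegral _ _
    _ = ∫⁻ v in ball (0 : Euc n) (2 * R), ENNReal.ofReal (2 * R) *
        ∫⁻ t in Ioc (0 : ℝ) 1, ∫⁻ x, Φ (x + t • v) := by
      rw [lintegral_lintegral_swap]
      · refine lintegral_congr fun v => ?_
        rw [lintegral_const_mul' _ _ ENNReal.ofReal_ne_top, lintegral_lintegral_swap]
        exact (hΦm.comp (by fun_prop : Measurable fun p : Euc n × ℝ => p.1 + p.2 • v)).aemeasurable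
      · have : Measurable fun p : Euc n × Euc n => ∫⁻ t in Ioc (0 : ℝ) 1, Φ (p.1 + t • p.2) :=
          Measurable.lintegral_prod_right (hΦm.comp
            (by fun_prop : Measurable fun p : (Euc n × Euc n) × ℝ => p.1.1 + p.2 • p.1.2))
        exact (this.const_mul _).aemeasurable
    _ = _ := by
      have : ∀ (v : Euc n) (t : ℝ), ∫⁻ x, Φ (x + t • v) = ∫⁻ y in B, ‖gradient w y‖ₑ := by
        intro v t
        rw [lintegral_add_right_eq_self, hΦ, lintegral_indicator hBm]
      simp_rw [this]
      simp only [lintegral_const, MeasurableSet.univ, Measure.restrict_apply, univ_inter,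
        Real.volume_Ioc, sub_zero, ENNReal.ofReal_one, mul_one]
      ring

/-- The Poincaré inequality passes from smooth functions to Sobolev functions by density in
`W^{1,2}`. -/
theorem SobolevPair.poincare_double {u : Euc n → ℝ} {g : Euc n → Euc n} (h : SobolevPair u g)
    (x₀ : Euc n) {R : ℝ} :
    ∫⁻ x in ball x₀ R, ∫⁻ y in ball x₀ R, ‖u y - u x‖ₑ ≤
      ENNReal.ofReal (2 * R) * volume (ball (0 : Euc n) (2 * R)) *
        ∫⁻ y in ball x₀ R, ‖g y‖ₑ := by
  set B := ball x₀ R with hB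
  set c := ENNReal.ofReal (2 * R) * volume (ball (0 : Euc n) (2 * R))
  have hc : c ≠ ⊤ := ENNReal.mul_ne_top ENNReal.ofReal_ne_top measure_ball_lt_top.ne
  set b := volume B
  have hb : b ≠ ⊤ := measure_ball_lt_top.ne
  set s := b ^ (1 / 2 : ℝ)
  have hs : s ≠ ⊤ := ENNReal.rpow_ne_top_of_nonneg (by norm_num) hb
  -- the inequality for a smooth approximation, with the errors of the approximation
  have key : ∀ ε : ℝ≥0∞, 0 < ε → ε ≠ ⊤ →
      ∫⁻ x in B, ∫⁻ y in B, ‖u y - u x‖ₑ ≤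
        c * ((∫⁻ y in B, ‖g y‖ₑ) + ε * s) + (b * (ε * s) + b * (ε * s)) := by
    intro ε hε hε'
    obtain ⟨w, hw, hwS, h1, h2, -, -⟩ := h.exists_smooth_approx hε hε'
    have hum := h.memLp.aestronglyMeasurable
    have hwm := hw.continuous.aestronglyMeasurable (μ := (volume : Measure (Euc n)))
    have e1 : ∫⁻ x in B, ‖(u - w) x‖ₑ ≤ ε * s :=
      (setLIntegral_enorm_le_eLpNorm_two (hum.sub hwm) B).trans (by gcongr)
    have e2 : ∫⁻ x in B, ‖gradient w x‖ₑ ≤ (∫⁻ y in B, ‖g y‖ₑ) + ε * s := by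
      have hm := h.memLp_grad.aestronglyMeasurable
      calc _ ≤ ∫⁻ x in B, (‖g x‖ₑ + ‖(g - gradient w) x‖ₑ) := by
            refine lintegral_mono fun x => ?_
            have : gradient w x = g x - (g - gradient w) x := by simp
            calc ‖gradient w x‖ₑ = ‖g x - (g - gradient w) x‖ₑ := by rw [← this]
              _ ≤ _ := enorm_sub_le
        _ = (∫⁻ y in B, ‖g y‖ₑ) + ∫⁻ y in B, ‖(g - gradient w) y‖ₑ :=
            lintegral_add_left' hm.enorm.restrict _
        _ ≤ _ := by
            gcongr
            refine (setLIntegral_enorm_le_eLpNorm_two (hm.sub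
              hw.continuous_gradient.aestronglyMeasurable) B).trans (by gcongr)
    have hm1 : AEMeasurable (fun y => ‖(u - w) y‖ₑ) (volume.restrict B) :=
      (hum.sub hwm).enorm.restrict
    calc _ ≤ ∫⁻ x in B, ∫⁻ y in B, (‖w y - w x‖ₑ + (‖(u - w) y‖ₑ + ‖(u - w) x‖ₑ)) := by
          refine lintegral_mono fun x => lintegral_mono fun y => ?_
          have : u y - u x = (w y - w x) + ((u - w) y - (u - w) x) := by simp; ring
          rw [this]
          exact (enorm_add_le _ _).trans (by gcongr; exact enorm_sub_le)
      _ = ∫⁻ x in B, ((∫⁻ y in B, ‖w y - w x‖ₑ) +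
            ((∫⁻ y in B, ‖(u - w) y‖ₑ) + b * ‖(u - w) x‖ₑ)) := by
          refine lintegral_congr fun x => ?_
          have hm2 : Continuous fun y => ‖w y - w x‖ₑ :=
            (hw.continuous.sub continuous_const).enorm
          rw [lintegral_add_left' hm2.aemeasurable, lintegral_add_left' hm1]
          simp [mul_comm, b]
      _ = (∫⁻ x in B, ∫⁻ y in B, ‖w y - w x‖ₑ) +
            (b * (∫⁻ y in B, ‖(u - w) y‖ₑ) + b * ∫⁻ x in B, ‖(u - w) x‖ₑ) := by
          rw [lintegral_add_left', lintegral_add_left' aemeasurable_const,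
            lintegral_const_mul' _ _ hb]
          · simp [mul_comm, b]
          · have : Continuous fun p : Euc n × Euc n => ‖w p.2 - w p.1‖ₑ :=
              ((hw.continuous.comp continuous_snd).sub (hw.continuous.comp continuous_fst)).enorm
            exact this.measurable.lintegral_prod_right'.aemeasurable
      _ ≤ _ := by
          gcongr
          exact (hw.poincare_double x₀).trans (by gcongr)
  have ht : Tendsto (fun ε : ℝ≥0∞ => c * ((∫⁻ y in B, ‖g y‖ₑ) + ε * s) +
      (b * (ε * s) + b * (ε * s))) (𝓝[>] 0) (𝓝 (c * ((∫⁻ y in B, ‖g y‖ₑ) + 0 * s) +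
      (b * (0 * s) + b * (0 * s)))) := by
    have h0 : Tendsto (fun ε : ℝ≥0∞ => ε * s) (𝓝[>] 0) (𝓝 (0 * s)) :=
      (ENNReal.Tendsto.mul_const tendsto_id (Or.inr hs)).mono_left nhdsWithin_le_nhds
    have h1 := ENNReal.Tendsto.const_mul (a := b) h0 (Or.inr hb)
    exact (ENNReal.Tendsto.const_mul (h0.const_add _) (Or.inr hc)).add (h1.add h1)
  simp only [zero_mul, mul_zero, add_zero] at ht
  refine ge_of_tendsto ht ?_
  filter_upwards [self_mem_nhdsWithin, nhdsWithin_le_nhds (gt_mem_nhds ENNReal.zero_lt_top)]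
    with ε hε hε'
  exact key ε hε hε'.ne

/-- The mean value of `u` over a ball. -/
def ballAvg (u : Euc n → ℝ) (x : Euc n) (r : ℝ) : ℝ := ⨍ y in ball x r, u y

theorem enorm_sub_ballAvg_le {u : Euc n → ℝ} (hu : LocallyIntegrable u) (x : Euc n) {r : ℝ}
    (hr : 0 < r) (c : ℝ) :
    ‖c - ballAvg u x r‖ₑ ≤ (volume (ball x r))⁻¹ * ∫⁻ y in ball x r, ‖c - u y‖ₑ := by
  have hi : IntegrableOn u (ball x r) :=
    (hu.integrableOn_isCompact (isCompact_closedBall x r)).mono_set ball_subset_closedBall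
  have h0 : volume (ball x r) ≠ 0 := (measure_ball_pos _ _ hr).ne'
  have h1 : volume (ball x r) ≠ ⊤ := measure_ball_lt_top.ne
  have hpos : 0 < (volume : Measure (Euc n)).real (ball x r) := ENNReal.toReal_pos h0 h1
  have : c - ballAvg u x r = (volume.real (ball x r))⁻¹ • ∫ y in ball x r, (c - u y) := by
    have hic : IntegrableOn (fun _ => c) (ball x r) := integrableOn_const h1
    rw [integral_sub hic hi, ballAvg, setAverage_eq]
    simp only [integral_const, MeasurableSet.univ, measureReal_restrict_apply, univ_inter,
      smul_eq_mul, mul_sub]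
    rw [← mul_assoc, inv_mul_cancel₀ hpos.ne', one_mul]
  rw [this, enorm_smul]
  gcongr
  · rw [Real.enorm_eq_ofReal (by positivity), ENNReal.ofReal_inv_of_pos hpos,
      ofReal_measureReal]
  · exact enorm_integral_le_lintegral_enorm _

/-- The Poincaré inequality on a ball, with the mean value over a smaller concentric ball. -/
theorem SobolevPair.poincare {u : Euc n → ℝ} {g : Euc n → Euc n} (h : SobolevPair u g)
    (x₀ : Euc n) {r R : ℝ} (hr : 0 < r) (hrR : r ≤ R) :
    ∫⁻ y in ball x₀ R, ‖u y - ballAvg u x₀ r‖ₑ ≤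
      ENNReal.ofReal (2 * R * (2 * R / r) ^ n) * ∫⁻ y in ball x₀ R, ‖g y‖ₑ := by
  have hloc : LocallyIntegrable u := h.weak.1
  have h0 : volume (ball x₀ r) ≠ 0 := (measure_ball_pos _ _ hr).ne'
  have h1 : volume (ball x₀ r) ≠ ⊤ := measure_ball_lt_top.ne
  have hV := unitVol_pos (n := n)
  have hR : 0 < R := hr.trans_le hrR
  calc _ ≤ ∫⁻ y in ball x₀ R, (volume (ball x₀ r))⁻¹ * ∫⁻ z in ball x₀ R, ‖u z - u y‖ₑ := by
        refine lintegral_mono fun y => (enorm_sub_ballAvg_le hloc x₀ hr (u y)).trans ?_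
        refine mul_le_mul_right ?_ _
        refine (lintegral_mono_set (ball_subset_ball (x := x₀) hrR)).trans (le_of_eq ?_)
        exact lintegral_congr fun z => enorm_sub_rev _ _
    _ = (volume (ball x₀ r))⁻¹ * ∫⁻ y in ball x₀ R, ∫⁻ z in ball x₀ R, ‖u z - u y‖ₑ :=
        lintegral_const_mul' _ _ (ENNReal.inv_ne_top.2 h0)
    _ ≤ (volume (ball x₀ r))⁻¹ * (ENNReal.ofReal (2 * R) * volume (ball (0 : Euc n) (2 * R)) *
        ∫⁻ y in ball x₀ R, ‖g y‖ₑ) := by gcongr; exact h.poincare_double x₀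
    _ = _ := by
        rw [← mul_assoc]
        congr 1
        rw [volume_ball_eq _ hr, volume_ball_eq _ (by positivity : (0 : ℝ) < 2 * R),
          ← ENNReal.ofReal_mul (by positivity), ← ENNReal.ofReal_inv_of_pos (by positivity),
          ← ENNReal.ofReal_mul (by positivity)]
        congr 1
        rw [div_pow]
        field_simp

end Poincare

/-! ### The maximal function -/

section Maximal

variable {n : ℕ}

/-- The set where the (centred, unnormalized) maximal function of `G` exceeds `c`. -/
def maximalSet (G : Euc n → ℝ≥0∞) (c : ℝ) : Set (Euc n) :=
  {x | ∃ r > 0, ENNReal.ofReal (c * r ^ n) < ∫⁻ y in ball x r, G y}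

theorem isOpen_maximalSet (G : Euc n → ℝ≥0∞) (c : ℝ) : IsOpen (maximalSet G c) := by
  rw [Metric.isOpen_iff]
  rintro x ⟨r, hr, hx⟩
  have hU : ball x r = ⋃ k : ℕ, ball x (r - 1 / (k + 1)) := by
    ext y
    simp only [mem_ball, mem_iUnion]
    constructor
    · intro hy
      obtain ⟨k, hk⟩ := exists_nat_one_div_lt (sub_pos.2 hy)
      exact ⟨k, by linarith⟩
    · rintro ⟨k, hk⟩
      have : (0 : ℝ) < 1 / (k + 1) := Nat.one_div_pos_of_nat
      linarith
  have hmono : Monotone fun k : ℕ => ball x (r - 1 / ((k : ℝ) + 1)) := fun k l hkl =>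
    ball_subset_ball (sub_le_sub_left (Nat.one_div_le_one_div hkl) r)
  rw [hU, setLIntegral_iUnion_of_directed _ hmono.directed_le] at hx
  obtain ⟨k, hk⟩ := lt_iSup_iff.1 hx
  refine ⟨1 / (k + 1), Nat.one_div_pos_of_nat, fun z hz => ⟨r, hr, hk.trans_le ?_⟩⟩
  refine lintegral_mono_set (ball_subset_ball' ?_)
  have := mem_ball'.1 hz
  linarith

/-- The maximal inequality: by the Vitali covering lemma, the balls on which the average of `G` is
large may be replaced by disjoint ones, at the cost of the factor `5ⁿ`. -/
theorem volume_maximalSet_le {G : Euc n → ℝ≥0∞} (hn : 1 ≤ n) (hG : ∫⁻ y, G y ≠ ⊤)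
    {c : ℝ} (hc : 0 < c) :
    ENNReal.ofReal c * volume (maximalSet G c) ≤
      ENNReal.ofReal (5 ^ n * unitVol n) * ∫⁻ y, G y := by
  have hV := unitVol_pos (n := n)
  choose! r hr hlt using fun x (hx : x ∈ maximalSet G c) => hx
  set I := (∫⁻ y, G y).toReal with hI
  have hI0 : 0 ≤ I := ENNReal.toReal_nonneg
  have hbd : ∀ x ∈ maximalSet G c, r x ≤ I / c + 1 := by
    intro x hx
    have h1 : ENNReal.ofReal (c * r x ^ n) < ENNReal.ofReal I := by
      rw [hI, ENNReal.ofReal_toReal hG]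
      exact (hlt x hx).trans_le (setLIntegral_le_lintegral _ _)
    have h2 : c * r x ^ n < I := (ENNReal.ofReal_lt_ofReal_iff_of_nonneg
      (mul_nonneg hc.le (pow_nonneg (hr x hx).le _))).1 h1
    by_contra! h3
    have h4 : 1 ≤ r x := by
      have : 0 ≤ I / c := by positivity
      linarith
    have h5 : r x ≤ r x ^ n := le_self_pow₀ h4 (by omega)
    have h6 : c * (I / c + 1) < I := by nlinarith
    have h7 : c * (I / c + 1) = I + c := by field_simp
    linarith
  obtain ⟨t, ht, hdisj, hcov⟩ := Vitali.exists_disjoint_subfamily_covering_enlargement_closedBall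
    (maximalSet G c) (fun x => x) r (I / c + 1) hbd 5 (by norm_num)
  have htc : t.Countable := hdisj.countable_of_nonempty_interior fun x hx =>
    ⟨x, ball_subset_interior_closedBall (mem_ball_self (hr x (ht hx)))⟩
  have hsub : maximalSet G c ⊆ ⋃ x ∈ t, closedBall x (5 * r x) := by
    intro x hx
    obtain ⟨y, hy, hxy⟩ := hcov x hx
    exact mem_biUnion hy (hxy (mem_closedBall_self (hr x hx).le))
  calc ENNReal.ofReal c * volume (maximalSet G c)
      ≤ ENNReal.ofReal c * ∑' x : t, volume (closedBall (x : Euc n) (5 * r x)) := by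
        gcongr
        exact (measure_mono hsub).trans (measure_biUnion_le _ htc _)
    _ = ∑' x : t, ENNReal.ofReal c * volume (closedBall (x : Euc n) (5 * r x)) :=
        ENNReal.tsum_mul_left.symm
    _ ≤ ∑' x : t, ENNReal.ofReal (5 ^ n * unitVol n) *
          ∫⁻ y in closedBall (x : Euc n) (r x), G y := by
        refine ENNReal.tsum_le_tsum fun x => ?_
        have hx := ht x.2
        have hrx := hr _ hx
        rw [volume_closedBall_eq _ (by positivity), ← ENNReal.ofReal_mul hc.le]
        have : c * ((5 * r x) ^ n * unitVol n) = 5 ^ n * unitVol n * (c * r x ^ n) := by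
          rw [mul_pow]; ring
        rw [this, ENNReal.ofReal_mul (by positivity)]
        gcongr
        exact (hlt _ hx).le.trans (lintegral_mono_set ball_subset_closedBall)
    _ = ENNReal.ofReal (5 ^ n * unitVol n) * ∫⁻ y in ⋃ x ∈ t, closedBall x (r x), G y := by
        rw [ENNReal.tsum_mul_left, lintegral_biUnion htc (fun x _ => measurableSet_closedBall)
          hdisj]
    _ ≤ _ := mul_le_mul_right (setLIntegral_le_lintegral _ _) _

end Maximal

/-! ### The kernel and its derivative -/

section Kernel

variable {n : ℕ} {K : Euc n → Euc n → ℝ}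

/-- The derivative of the kernel `K(x,y)` in the variable `x`, in the direction `v`. -/
def kernelDeriv (K : Euc n → Euc n → ℝ) (v x y : Euc n) : ℝ :=
  fderiv ℝ (Function.uncurry K) (x, y) (v, 0)

/-- The bounds on the derivatives of the kernel with a positive constant `C`. -/
def KernelBound (K : Euc n → Euc n → ℝ) (C : ℝ) : Prop :=
  0 < C ∧ ∀ x y, x ≠ y →
    DifferentiableAt ℝ (Function.uncurry K) (x, y) ∧
    DifferentiableAt ℝ (fderiv ℝ (Function.uncurry K)) (x, y) ∧
    ‖fderiv ℝ (Function.uncurry K) (x, y)‖ ≤ C / ‖x - y‖ ^ (n + 1) ∧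
    ‖fderiv ℝ (fderiv ℝ (Function.uncurry K)) (x, y)‖ ≤ C / ‖x - y‖ ^ (n + 2)

theorem HasKernelDerivBounds.exists_kernelBound (hK : HasKernelDerivBounds K) :
    ∃ C, KernelBound K C := by
  obtain ⟨C, hC⟩ := hK
  refine ⟨max C 1, by positivity, fun x y hxy => ?_⟩
  obtain ⟨h1, h2, h3, h4⟩ := hC x y hxy
  refine ⟨h1, h2, h3.trans ?_, h4.trans ?_⟩ <;> gcongr <;> exact le_max_left _ _

namespace KernelBound

variable {C : ℝ}

theorem continuousOn (hK : KernelBound K C) :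
    ContinuousOn (Function.uncurry K) {p | p.1 ≠ p.2} := fun p hp =>
  (hK.2 p.1 p.2 hp).1.continuousAt.continuousWithinAt

theorem continuousOn_kernelDeriv (hK : KernelBound K C) (v : Euc n) :
    ContinuousOn (fun p : Euc n × Euc n => kernelDeriv K v p.1 p.2) {p | p.1 ≠ p.2} :=
  fun p hp => ((hK.2 p.1 p.2 hp).2.1.continuousAt.clm_apply
    continuousAt_const).continuousWithinAt

theorem hasFDerivAt_left (hK : KernelBound K C) {x y : Euc n} (hxy : x ≠ y) :
    HasFDerivAt (fun x => K x y)
      ((fderiv ℝ (Function.uncurry K) (x, y)).comp (ContinuousLinearMap.inl ℝ (Euc n) (Euc n)))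
      x :=
  (hK.2 x y hxy).1.hasFDerivAt.comp (f := fun x => (x, y)) x (hasFDerivAt_prodMk_left x y)

theorem fderiv_left (hK : KernelBound K C) {x y : Euc n} (hxy : x ≠ y) (v : Euc n) :
    fderiv ℝ (fun x => K x y) x v = kernelDeriv K v x y := by
  rw [(hK.hasFDerivAt_left hxy).fderiv]
  rfl

theorem abs_kernelDeriv_le (hK : KernelBound K C) {x y : Euc n} (hxy : x ≠ y) (v : Euc n) :
    |kernelDeriv K v x y| ≤ C * ‖v‖ / ‖x - y‖ ^ (n + 1) := by
  have h := (fderiv ℝ (Function.uncurry K) (x, y)).le_of_opNorm_le (hK.2 x y hxy).2.2.1 (v, 0)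
  rw [Prod.norm_mk, norm_zero, max_eq_left (norm_nonneg v)] at h
  rw [mul_div_right_comm]
  exact h

/-- The first derivatives of the kernel are Lipschitz in `x`, with a constant that decays one order
faster in the distance to the diagonal. -/
theorem abs_kernelDeriv_sub_le (hK : KernelBound K C) {x₀ x y : Euc n} {ρ : ℝ} (hρ : 0 < ρ)
    (hx : x ∈ ball x₀ (ρ / 2)) (hy : ρ ≤ ‖y - x₀‖) (v : Euc n) :
    |kernelDeriv K v x y - kernelDeriv K v x₀ y| ≤
      C * 2 ^ (n + 2) * ‖v‖ * ρ / ‖y - x₀‖ ^ (n + 2) := by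
  have hd0 : 0 < ‖y - x₀‖ := hρ.trans_le hy
  have hfar : ∀ z ∈ ball x₀ (ρ / 2), ‖y - x₀‖ / 2 ≤ ‖z - y‖ := by
    intro z hz
    have h1 : ‖z - x₀‖ < ρ / 2 := by simpa [dist_eq_norm] using hz
    have h2 : ‖y - x₀‖ ≤ ‖z - y‖ + ‖z - x₀‖ := by
      have : y - x₀ = (z - x₀) - (z - y) := by abel
      rw [this]
      exact (norm_sub_le _ _).trans (by linarith)
    linarith
  have hne : ∀ z ∈ ball x₀ (ρ / 2), z ≠ y := by
    rintro z hz rfl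
    have := hfar z hz
    rw [sub_self, norm_zero] at this
    linarith
  have hder : ∀ z ∈ ball x₀ (ρ / 2),
      HasFDerivWithinAt (fun z => fderiv ℝ (Function.uncurry K) (z, y))
        ((fderiv ℝ (fderiv ℝ (Function.uncurry K)) (z, y)).comp
          (ContinuousLinearMap.inl ℝ (Euc n) (Euc n))) (ball x₀ (ρ / 2)) z := fun z hz =>
    ((hK.2 z y (hne z hz)).2.1.hasFDerivAt.comp (f := fun x => (x, y)) z
      (hasFDerivAt_prodMk_left z y)).hasFDerivWithinAt
  have hb : ∀ z ∈ ball x₀ (ρ / 2),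
      ‖(fderiv ℝ (fderiv ℝ (Function.uncurry K)) (z, y)).comp
        (ContinuousLinearMap.inl ℝ (Euc n) (Euc n))‖ ≤ C / (‖y - x₀‖ / 2) ^ (n + 2) := by
    intro z hz
    have hC := hK.1
    calc _ ≤ ‖fderiv ℝ (fderiv ℝ (Function.uncurry K)) (z, y)‖ *
          ‖ContinuousLinearMap.inl ℝ (Euc n) (Euc n)‖ := ContinuousLinearMap.opNorm_comp_le _ _
      _ ≤ ‖fderiv ℝ (fderiv ℝ (Function.uncurry K)) (z, y)‖ * 1 := by
          gcongr
          exact ContinuousLinearMap.norm_inl_le_one ℝ (Euc n) (Euc n)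
      _ ≤ C / ‖z - y‖ ^ (n + 2) := by rw [mul_one]; exact (hK.2 z y (hne z hz)).2.2.2
      _ ≤ _ := by gcongr; exact hfar z hz
  have key := (convex_ball x₀ (ρ / 2)).norm_image_sub_le_of_norm_hasFDerivWithin_le hder hb
    (mem_ball_self (half_pos hρ)) hx
  have h := ContinuousLinearMap.le_of_opNorm_le _ key (v, 0)
  rw [Prod.norm_mk, norm_zero, max_eq_left (norm_nonneg v)] at h
  have hxn : ‖x - x₀‖ ≤ ρ := by
    have : ‖x - x₀‖ < ρ / 2 := by simpa [dist_eq_norm] using hx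
    linarith
  have hC := hK.1
  calc |kernelDeriv K v x y - kernelDeriv K v x₀ y|
      ≤ C / (‖y - x₀‖ / 2) ^ (n + 2) * ‖x - x₀‖ * ‖v‖ := h
    _ ≤ C / (‖y - x₀‖ / 2) ^ (n + 2) * ρ * ‖v‖ := by gcongr
    _ = _ := by rw [div_pow]; field_simp

theorem ae_ne (hn : 1 ≤ n) : ∀ᵐ p : Euc n × Euc n ∂(volume.prod volume), p.1 ≠ p.2 := by
  have : Nonempty (Fin n) := ⟨⟨0, hn⟩⟩
  have hm : MeasurableSet {p : Euc n × Euc n | p.1 ≠ p.2} :=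
    (isOpen_ne_fun continuous_fst continuous_snd).measurableSet
  refine (Measure.ae_prod_mem_iff_ae_ae_mem hm).2 (Eventually.of_forall fun x => ?_)
  have : (volume : Measure (Euc n)) {x} = 0 := measure_singleton x
  rw [← compl_mem_ae_iff] at this
  filter_upwards [this] with y hy h
  exact hy h.symm

theorem aestronglyMeasurable_of_offDiag (hn : 1 ≤ n) {k : Euc n × Euc n → ℝ}
    (hk : ContinuousOn k {p | p.1 ≠ p.2}) : AEStronglyMeasurable k (volume.prod volume) := by
  have h := hk.aestronglyMeasurable (μ := (volume : Measure (Euc n)).prod volume)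
    (isOpen_ne_fun continuous_fst continuous_snd).measurableSet
  have e : ((volume : Measure (Euc n)).prod volume).restrict {p | p.1 ≠ p.2}
      = volume.prod volume := Measure.restrict_eq_self_of_ae_mem (ae_ne hn)
  rwa [e] at h

theorem aestronglyMeasurable_right (hn : 1 ≤ n) {k : Euc n × Euc n → ℝ}
    (hk : ContinuousOn k {p | p.1 ≠ p.2}) (x : Euc n) :
    AEStronglyMeasurable (fun y => k (x, y)) volume := by
  have : Nonempty (Fin n) := ⟨⟨0, hn⟩⟩
  have h : ContinuousOn (fun y => k (x, y)) {x}ᶜ :=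
    hk.comp (by fun_prop) fun y hy => fun h => hy h.symm
  have h := h.aestronglyMeasurable (μ := (volume : Measure (Euc n)))
    isOpen_compl_singleton.measurableSet
  rwa [Measure.restrict_eq_self_of_ae_mem] at h
  exact compl_mem_ae_iff.2 (measure_singleton x)

end KernelBound

theorem integrable_mul_of_continuousOn_tsupport {f φ ψ : Euc n → ℝ} (hφ : HasCompactSupport φ)
    (hf : ContinuousOn f (tsupport φ)) (hψ : Continuous ψ)
    (hs : Function.support ψ ⊆ tsupport φ) : Integrable fun x => f x * ψ x := by
  have h := (hf.mul hψ.continuousOn).integrableOn_compact hφ (μ := volume)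
  refine (integrableOn_iff_integrable_of_support_subset fun x hx => ?_).1 h
  exact hs (right_ne_zero_of_mul hx)

end Kernel

/-! ### The kernel representation of the gradient -/

section Representation

variable {n : ℕ} {K : Euc n → Euc n → ℝ}

/-- The decaying weight `(1 + ‖y‖)^(-(n+s))`. -/
def decay (n : ℕ) (s : ℝ) (y : Euc n) : ℝ := (1 + ‖y‖) ^ (-(n + s))

theorem decay_pos (s : ℝ) (y : Euc n) : 0 < decay n s y :=
  Real.rpow_pos_of_pos (by positivity) _

theorem decay_le_one {s : ℝ} (hs : 0 < s) (y : Euc n) : decay n s y ≤ 1 :=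
  Real.rpow_le_one_of_one_le_of_nonpos (by linarith [norm_nonneg y])
    (by have : (0 : ℝ) ≤ n := Nat.cast_nonneg n
        linarith)

theorem integrable_decay {s : ℝ} (hs : 0 < s) : Integrable (decay n s) :=
  integrable_one_add_norm (by rw [finrank_euclideanSpace_fin]; linarith)

theorem continuous_decay (s : ℝ) : Continuous (decay n s) :=
  (continuous_const.add continuous_norm).rpow_const
    fun y => Or.inl (add_pos_of_pos_of_nonneg one_pos (norm_nonneg y)).ne'

theorem one_le_mul_decay {s R : ℝ} (hs : 0 < s) {y : Euc n} (hy : ‖y‖ ≤ R) :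
    1 ≤ (1 + R) ^ (n + s) * decay n s y := by
  have h0 : (0 : ℝ) ≤ n := Nat.cast_nonneg n
  have hy0 := norm_nonneg y
  rw [decay, Real.rpow_neg (by positivity), ← div_eq_mul_inv, one_le_div (by positivity)]
  gcongr

theorem one_div_rpow_le_mul_decay {s R : ℝ} (hs : 0 < s) (hR : 0 < R) {y : Euc n}
    (hy : R ≤ ‖y‖) : 1 / ‖y‖ ^ (n + s) ≤ ((1 + R) / R) ^ (n + s) * decay n s y := by
  have h0 : (0 : ℝ) ≤ n := Nat.cast_nonneg n
  have hy0 : 0 < ‖y‖ := hR.trans_le hy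
  rw [decay, Real.rpow_neg (by positivity), ← div_eq_mul_inv,
    ← Real.div_rpow (by positivity) (by positivity), one_div,
    ← Real.inv_rpow (by positivity)]
  gcongr
  rw [inv_eq_one_div, div_div, div_le_div_iff₀ (by positivity) (by positivity)]
  nlinarith

/-- The data of a kernel acting on `F - c`, where `F` vanishes outside the ball `B(0,2R)` and is
equal to `c` on the open set `U`. -/
structure LocalData (F : Euc n → ℝ) (c : ℝ) (U : Set (Euc n)) (R : ℝ) : Prop where
  memLp : MemLp F 2
  pos : 0 < R
  isOpen : IsOpen U
  eq_const : ∀ x ∈ U, F x = c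
  eq_zero : ∀ x, 2 * R ≤ ‖x‖ → F x = 0

namespace LocalData

variable {F : Euc n → ℝ} {c R C : ℝ} {U : Set (Euc n)}

theorem integrable (H : LocalData F c U R) : Integrable F := by
  have h : IntegrableOn F (ball 0 (2 * R)) := by
    have : IsFiniteMeasure ((volume : Measure (Euc n)).restrict (ball 0 (2 * R))) :=
      ⟨by simpa using measure_ball_lt_top⟩
    exact (H.memLp.restrict _).integrable (by norm_num)
  refine (integrableOn_iff_integrable_of_support_subset fun x hx => ?_).1 h
  by_contra hne
  exact hx (H.eq_zero x (by simpa using hne))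

theorem integrable_mul_decay (H : LocalData F c U R) {s : ℝ} (hs : 0 < s) :
    Integrable fun y => |F y - c| * decay n s y := by
  refine (H.integrable.norm.add ((integrable_decay hs).const_mul |c|)).mono
    ((H.memLp.aestronglyMeasurable.sub aestronglyMeasurable_const).norm.mul
      (continuous_decay s).aestronglyMeasurable) (Eventually.of_forall fun y => ?_)
  have h1 := decay_pos s y
  have h2 := decay_le_one hs y
  rw [Real.norm_of_nonneg (by positivity)]
  refine le_trans ?_ (le_abs_self _)
  simp only [Pi.add_apply, Real.norm_eq_abs]
  calc |F y - c| * decay n s y ≤ (|F y| + |c|) * decay n s y := by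
        gcongr; exact abs_sub _ _
    _ ≤ _ := by
        have := mul_le_of_le_one_right (abs_nonneg (F y)) h2
        linarith

theorem exists_dist (H : LocalData F c U R) {S : Set (Euc n)} (hS : IsCompact S) (hSU : S ⊆ U) :
    ∃ δ > 0, ∀ x ∈ S, ∀ y ∉ U, δ ≤ ‖x - y‖ := by
  obtain ⟨δ, hδ, h⟩ := hS.exists_thickening_subset_open H.isOpen hSU
  refine ⟨δ, hδ, fun x hx y hy => ?_⟩
  by_contra! hlt
  exact hy (h (mem_thickening_iff.2 ⟨x, hx, by rwa [dist_comm, dist_eq_norm]⟩))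

/-- The derivative of the kernel, applied to `F - c`, has an integrable majorant that is uniform on
compact subsets of `U ∩ B(0,R)`. -/
theorem kernelDeriv_bound (H : LocalData F c U R) (hK : KernelBound K C) {S : Set (Euc n)}
    (hS : IsCompact S) (hSU : S ⊆ U ∩ ball 0 R) (v : Euc n) :
    ∃ D, 0 ≤ D ∧ ∀ x ∈ S, ∀ y,
      |kernelDeriv K v x y * (F y - c)| ≤ D * (|F y - c| * decay n 1 y) := by
  obtain ⟨δ, hδ, hd⟩ := H.exists_dist hS (hSU.trans inter_subset_left)
  have hC := hK.1
  have hR := H.pos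
  set D₁ := C * ‖v‖ / δ ^ (n + 1) * (1 + 2 * R) ^ ((n : ℝ) + 1) with hD₁
  set D₂ := C * ‖v‖ * 2 ^ (n + 1) * ((1 + 2 * R) / (2 * R)) ^ ((n : ℝ) + 1) with hD₂
  have h1 : 0 ≤ D₁ := by positivity
  have h2 : 0 ≤ D₂ := by positivity
  refine ⟨D₁ + D₂, by positivity, fun x hx y => ?_⟩
  by_cases hy : y ∈ U
  · simp [H.eq_const y hy]
  have hxy := hd x hx y hy
  have hne : x ≠ y := by
    rintro rfl
    exact hy (hSU hx).1
  have hτ := decay_pos 1 y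
  rw [abs_mul, mul_comm |F y - c| _, ← mul_assoc]
  gcongr
  refine (hK.abs_kernelDeriv_le hne v).trans ?_
  rcases le_total ‖y‖ (2 * R) with hyR | hyR
  · calc C * ‖v‖ / ‖x - y‖ ^ (n + 1) ≤ C * ‖v‖ / δ ^ (n + 1) * 1 := by rw [mul_one]; gcongr
      _ ≤ C * ‖v‖ / δ ^ (n + 1) * ((1 + 2 * R) ^ ((n : ℝ) + 1) * decay n 1 y) := by
          gcongr; exact one_le_mul_decay one_pos hyR
      _ = D₁ * decay n 1 y := by rw [hD₁]; ring
      _ ≤ _ := by gcongr; linarith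
  · have hxR : ‖x‖ < R := by simpa using (hSU hx).2
    have hfar : ‖y‖ / 2 ≤ ‖x - y‖ := by
      have := norm_sub_norm_le y x
      rw [norm_sub_rev] at this
      linarith
    have hy0 : 0 < ‖y‖ := by linarith
    calc C * ‖v‖ / ‖x - y‖ ^ (n + 1) ≤ C * ‖v‖ / (‖y‖ / 2) ^ (n + 1) := by gcongr
      _ = C * ‖v‖ * 2 ^ (n + 1) * (1 / ‖y‖ ^ ((n : ℝ) + 1)) := by
          rw [div_pow, ← Nat.cast_succ, Real.rpow_natCast]; field_simp
      _ ≤ C * ‖v‖ * 2 ^ (n + 1) * (((1 + 2 * R) / (2 * R)) ^ ((n : ℝ) + 1) * decay n 1 y) := by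
          gcongr; exact one_div_rpow_le_mul_decay one_pos (by positivity) hyR
      _ = D₂ * decay n 1 y := by rw [hD₂]; ring
      _ ≤ _ := by gcongr; linarith

/-- The kernel `K(x,y)`, renormalized at `x = 0` for large `y` and applied to `F - c`, has an
integrable majorant that is uniform on compact subsets of `U ∩ B(0,R)`. -/
theorem kernel_bound (H : LocalData F c U R) (hK : IsCZKernel K) {S : Set (Euc n)}
    (hS : IsCompact S) (hSU : S ⊆ U ∩ ball 0 R) :
    ∃ s > 0, ∃ D, 0 ≤ D ∧ ∀ x ∈ S, ∀ y,
      |(K x y - (ball 0 (2 * R))ᶜ.indicator (K 0) y) * (F y - c)| ≤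
        D * (|F y - c| * decay n s y) := by
  obtain ⟨ε, hε, C', hsize', hreg'⟩ := hK
  -- the constant of the kernel bounds may be taken nonnegative
  obtain ⟨C, hC, hsize, hreg⟩ : ∃ C : ℝ, 0 ≤ C ∧ (∀ x y, x ≠ y → |K x y| ≤ C / ‖x - y‖ ^ n) ∧
      ∀ x y z, x ≠ y → 2 * ‖z‖ < ‖x - y‖ →
        |K (x + z) y - K x y| + |K x (y + z) - K x y| ≤ C * ‖z‖ ^ ε / ‖x - y‖ ^ (n + ε) := by
    refine ⟨max C' 0, le_max_right _ _, fun x y h => (hsize' x y h).trans ?_,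
      fun x y z h h' => (hreg' x y z h h').trans ?_⟩ <;> gcongr <;> exact le_max_left _ _
  obtain ⟨δ, hδ, hd⟩ := H.exists_dist hS (hSU.trans inter_subset_left)
  have hR := H.pos
  set D₁ := C / δ ^ n * (1 + 2 * R) ^ ((n : ℝ) + ε) with hD₁
  set D₂ := C * R ^ ε * ((1 + 2 * R) / (2 * R)) ^ ((n : ℝ) + ε) with hD₂
  have h1 : 0 ≤ D₁ := by positivity
  have h2 : 0 ≤ D₂ := by positivity
  refine ⟨ε, hε, D₁ + D₂, by positivity, fun x hx y => ?_⟩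
  by_cases hy : y ∈ U
  · simp [H.eq_const y hy]
  have hxy := hd x hx y hy
  have hne : x ≠ y := by
    rintro rfl
    exact hy (hSU hx).1
  have hτ := decay_pos ε y
  rw [abs_mul, mul_comm |F y - c| _, ← mul_assoc]
  gcongr
  rcases lt_or_ge ‖y‖ (2 * R) with hyR | hyR
  · rw [indicator_of_notMem (by simpa using hyR), sub_zero]
    calc |K x y| ≤ C / ‖x - y‖ ^ n := hsize x y hne
      _ ≤ C / δ ^ n * 1 := by rw [mul_one]; gcongr
      _ ≤ C / δ ^ n * ((1 + 2 * R) ^ ((n : ℝ) + ε) * decay n ε y) := by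
          gcongr; exact one_le_mul_decay hε hyR.le
      _ = D₁ * decay n ε y := by rw [hD₁]; ring
      _ ≤ _ := by gcongr; linarith
  · have hxR : ‖x‖ < R := by simpa using (hSU hx).2
    have hy0 : 0 < ‖y‖ := by linarith
    rw [indicator_of_mem (by simpa using hyR)]
    have h := hreg 0 y x (by rintro rfl; simp at hy0) (by rw [zero_sub, norm_neg]; linarith)
    rw [zero_add, zero_sub, norm_neg] at h
    calc |K x y - K 0 y| ≤ C * ‖x‖ ^ ε / ‖y‖ ^ (n + ε) := by
          linarith [abs_nonneg (K 0 (y + x) - K 0 y)]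
      _ ≤ C * R ^ ε * (1 / ‖y‖ ^ (n + ε)) := by rw [mul_one_div]; gcongr
      _ ≤ C * R ^ ε * (((1 + 2 * R) / (2 * R)) ^ ((n : ℝ) + ε) * decay n ε y) := by
          gcongr; exact one_div_rpow_le_mul_decay hε (by positivity) hyR
      _ = D₂ * decay n ε y := by rw [hD₂]; ring
      _ ≤ _ := by gcongr; linarith

/-- A kernel with an integrable majorant that is uniform on the support of `ψ` is integrable on the
product space against `ψ`, so that the order of integration may be exchanged. -/
theorem integrable_kernel_mul {k : Euc n × Euc n → ℝ}
    (hk : AEStronglyMeasurable k (volume.prod volume)) {S : Set (Euc n)} {m : Euc n → ℝ}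
    (hm : Integrable m) (hle : ∀ x ∈ S, ∀ y, |k (x, y)| ≤ m y) {ψ : Euc n → ℝ}
    (hψ : Integrable ψ) (hs : Function.support ψ ⊆ S) :
    Integrable (fun p : Euc n × Euc n => k p * ψ p.1) (volume.prod volume) := by
  refine (hψ.mul_prod hm).mono (hk.mul hψ.aestronglyMeasurable.comp_fst)
    (Eventually.of_forall fun p => ?_)
  by_cases hp : ψ p.1 = 0
  · simp [hp]
  · rw [norm_mul, norm_mul, mul_comm]
    gcongr
    exact (hle p.1 (hs hp) p.2).trans (le_abs_self _)

theorem aestronglyMeasurable_kernelDeriv_mul (H : LocalData F c U R) (hn : 1 ≤ n)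
    (hK : KernelBound K C) (v : Euc n) :
    AEStronglyMeasurable (fun p : Euc n × Euc n => kernelDeriv K v p.1 p.2 * (F p.2 - c))
      (volume.prod volume) :=
  (KernelBound.aestronglyMeasurable_of_offDiag hn (hK.continuousOn_kernelDeriv v)).mul
    (H.memLp.aestronglyMeasurable.comp_snd.sub aestronglyMeasurable_const)

theorem aestronglyMeasurable_indicator_kernel (hn : 1 ≤ n) (hK : KernelBound K C) (R : ℝ) :
    AEStronglyMeasurable ((ball (0 : Euc n) R)ᶜ.indicator (K 0)) volume :=
  (KernelBound.aestronglyMeasurable_right hn hK.continuousOn 0).indicator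
    measurableSet_ball.compl

theorem aestronglyMeasurable_kernel_mul (H : LocalData F c U R) (hn : 1 ≤ n)
    (hK : KernelBound K C) :
    AEStronglyMeasurable (fun p : Euc n × Euc n =>
      (K p.1 p.2 - (ball 0 (2 * R))ᶜ.indicator (K 0) p.2) * (F p.2 - c)) (volume.prod volume) :=
  ((KernelBound.aestronglyMeasurable_of_offDiag hn hK.continuousOn).sub
    (aestronglyMeasurable_indicator_kernel hn hK (2 * R)).comp_snd).mul
    (H.memLp.aestronglyMeasurable.comp_snd.sub aestronglyMeasurable_const)

/-- The function `x ↦ ∫ ∂ᵥK(x,y) (F(y) - c) dy` is locally integrable on `U ∩ B(0,R)`. -/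
theorem locallyIntegrableOn (H : LocalData F c U R) (hn : 1 ≤ n) (hK : KernelBound K C)
    (v : Euc n) :
    LocallyIntegrableOn (fun x => ∫ y, kernelDeriv K v x y * (F y - c)) (U ∩ ball 0 R) := by
  rw [locallyIntegrableOn_iff (H.isOpen.inter isOpen_ball).isLocallyClosed]
  intro S hSU hS
  obtain ⟨D, -, hD⟩ := H.kernelDeriv_bound hK hS hSU v
  have hi : Integrable (S.indicator fun _ => (1 : ℝ)) :=
    (integrable_indicator_iff hS.measurableSet).2 (integrableOn_const hS.measure_lt_top.ne)
  have h := integrable_kernel_mul (H.aestronglyMeasurable_kernelDeriv_mul hn hK v)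
    ((H.integrable_mul_decay one_pos).const_mul D) hD hi
    (fun x hx => by by_contra h; exact hx (indicator_of_notMem h _))
  have h := h.integral_prod_left.integrableOn (s := S)
  refine h.congr_fun (fun x hx => ?_) hS.measurableSet
  simp [hx]

/-- Integration by parts in the variable `x`, under the integral sign. -/
theorem integral_kernel_mul_fderiv (H : LocalData F c U R) (hn : 1 ≤ n) (hK : KernelBound K C)
    (hK' : IsCZKernel K) {φ : Euc n → ℝ} (hφ : ContDiff ℝ ∞ φ) (hc : HasCompactSupport φ)
    (hs : tsupport φ ⊆ U ∩ ball 0 R) (v : Euc n) :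
    ∫ x, (∫ y, (K x y - (ball 0 (2 * R))ᶜ.indicator (K 0) y) * (F y - c)) * fderiv ℝ φ x v =
      - ∫ x, (∫ y, kernelDeriv K v x y * (F y - c)) * φ x := by
  obtain ⟨D, -, hD⟩ := H.kernelDeriv_bound hK hc hs v
  obtain ⟨s, hs0, D', -, hD'⟩ := H.kernel_bound hK' hc hs
  have hφ' := hφ.continuous_fderiv_apply_const v
  have hc' : HasCompactSupport fun x => fderiv ℝ φ x v := hc.fderiv_apply ℝ v
  have hs' : Function.support (fun x => fderiv ℝ φ x v) ⊆ tsupport φ := by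
    refine (Function.support_subset_iff'.2 fun x hx => ?_).trans (tsupport_fderiv_subset ℝ)
    rw [image_eq_zero_of_notMem_tsupport hx, _root_.zero_apply]
  have i1 := integrable_kernel_mul (H.aestronglyMeasurable_kernel_mul hn hK)
    ((H.integrable_mul_decay hs0).const_mul D') hD'
    (hφ'.integrable_of_hasCompactSupport hc') hs'
  have i2 := integrable_kernel_mul (H.aestronglyMeasurable_kernelDeriv_mul hn hK v)
    ((H.integrable_mul_decay one_pos).const_mul D) hD
    (hφ.continuous.integrable_of_hasCompactSupport hc) (subset_tsupport φ)
  simp_rw [← integral_mul_const]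
  rw [integral_integral_swap (f := fun x y => (K x y - (ball 0 (2 * R))ᶜ.indicator (K 0) y) *
      (F y - c) * fderiv ℝ φ x v) i1,
    integral_integral_swap (f := fun x y => kernelDeriv K v x y * (F y - c) * φ x) i2,
    ← integral_neg]
  refine integral_congr_ae (Eventually.of_forall fun y => ?_)
  by_cases hy : y ∈ U
  · simp [H.eq_const y hy]
  set κ := (ball 0 (2 * R))ᶜ.indicator (K 0) y
  have hne : ∀ x ∈ tsupport φ, x ≠ y := by
    rintro x hx rfl
    exact hy (hs hx).1
  have hd : ∀ x ∈ tsupport φ, DifferentiableAt ℝ (fun x => K x y - κ) x := fun x hx =>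
    (hK.hasFDerivAt_left (hne x hx)).differentiableAt.sub_const κ
  have hfd : ∀ x ∈ tsupport φ, fderiv ℝ (fun x => K x y - κ) x v = kernelDeriv K v x y := by
    intro x hx
    rw [fderiv_sub_const, hK.fderiv_left (hne x hx)]
  have hcont : ContinuousOn (fun x => K x y - κ) (tsupport φ) := fun x hx =>
    (hd x hx).continuousAt.continuousWithinAt
  have hcont' : ContinuousOn (fun x => fderiv ℝ (fun x => K x y - κ) x v) (tsupport φ) := by
    refine ContinuousOn.congr ?_ hfd
    exact (hK.continuousOn_kernelDeriv v).comp (f := fun x => (x, y)) (by fun_prop) hne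
  have key := integral_mul_fderiv_eq_neg_fderiv_mul_of_integrable (μ := volume) (𝕜 := ℝ)
    (f := fun x => K x y - κ) (g := φ) (v := v)
    (integrable_mul_of_continuousOn_tsupport hc hcont' hφ.continuous (subset_tsupport φ))
    (integrable_mul_of_continuousOn_tsupport hc hcont hφ' hs')
    (integrable_mul_of_continuousOn_tsupport hc hcont hφ.continuous (subset_tsupport φ))
    hd (fun x _ => hφ.differentiable (by simp) x)
  have e1 : ∀ x, (K x y - κ) * (F y - c) * fderiv ℝ φ x v
      = (F y - c) * ((K x y - κ) * fderiv ℝ φ x v) := fun x => by ring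
  have e2 : ∀ x, kernelDeriv K v x y * (F y - c) * φ x
      = (F y - c) * (fderiv ℝ (fun x => K x y - κ) x v * φ x) := by
    intro x
    by_cases hx : x ∈ tsupport φ
    · rw [hfd x hx]; ring
    · rw [image_eq_zero_of_notMem_tsupport hx]; ring
  simp_rw [e2]
  rw [integral_congr_ae (Eventually.of_forall e1), integral_const_mul, integral_const_mul, key,
    mul_neg]

/-- The representation of `T F` on `U ∩ B(0,R)`, up to an additive constant. This is where the
condition `T(1) = 0` is used: it allows the constant `c` to be subtracted from `F`. -/
theorem exists_eq_add_integral (H : LocalData F c U R) (hn : 1 ≤ n) (hK : KernelBound K C)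
    {T : L2 n →L[ℝ] L2 n} (hT : IsCZOperator T K) (hT1 : TOneEqZero T K) :
    ∃ C₀ : ℝ, ∀ᵐ x, x ∈ U ∩ ball 0 R → T (H.memLp.toLp F) x =
      C₀ + ∫ y, (K x y - (ball 0 (2 * R))ᶜ.indicator (K 0) y) * (F y - c) := by
  obtain ⟨c', hc'⟩ := hT1 R H.pos
  set B := ball (0 : Euc n) (2 * R) with hB
  have hBm : MeasurableSet B := measurableSet_ball
  have hmem1 : MemLp (B.indicator fun _ => (1 : ℝ)) 2 :=
    memLp_indicator_const 2 hBm 1 (Or.inr measure_ball_lt_top.ne)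
  set F₁ : Euc n → ℝ := F - c • B.indicator fun _ => (1 : ℝ) with hF₁
  have hF₁m : MemLp F₁ 2 := H.memLp.sub (hmem1.const_smul c)
  have hF₁B : ∀ y ∈ B, F₁ y = F y - c := by
    intro y hy
    simp [hF₁, hy]
  have hF₁B' : ∀ y ∉ B, F₁ y = 0 := by
    intro y hy
    simp [hF₁, hy, H.eq_zero y (by simpa [hB] using hy)]
  have hcs : HasCompactSupport F₁ :=
    HasCompactSupport.of_support_subset_isCompact (isCompact_closedBall 0 (2 * R))
      (fun y hy => ball_subset_closedBall (by
        by_contra h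
        exact hy (hF₁B' y h)))
  have hsupp : ∀ x ∈ U ∩ ball 0 R, x ∉ tsupport F₁ := by
    intro x hx
    rw [notMem_tsupport_iff_eventuallyEq]
    have hR := H.pos
    filter_upwards [H.isOpen.mem_nhds hx.1, isOpen_ball.mem_nhds
      (ball_subset_ball (by linarith : R ≤ 2 * R) hx.2)] with y hy1 hy2
    rw [hF₁B y hy2, H.eq_const y hy1, sub_self]
    rfl
  have hdecomp : T (H.memLp.toLp F) = T (hF₁m.toLp F₁) + c • T (hmem1.toLp _) := by
    rw [← map_smul, ← map_add, ← MemLp.toLp_const_smul, ← MemLp.toLp_add]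
    congr 2
    ext x
    simp [hF₁]
  have hcoe : T (H.memLp.toLp F) =ᵐ[volume] fun x =>
      T (hF₁m.toLp F₁) x + c * T (hmem1.toLp _) x := by
    rw [hdecomp]
    filter_upwards [Lp.coeFn_add (T (hF₁m.toLp F₁)) (c • T (hmem1.toLp _)),
      Lp.coeFn_smul c (T (hmem1.toLp _))] with x h1 h2
    rw [h1, Pi.add_apply, h2]
    rfl
  refine ⟨c * c', ?_⟩
  filter_upwards [hcoe, hT.2 F₁ hF₁m hcs, hc'] with x h1 h2 h3 hx
  rw [h1, h2 (hsupp x hx)]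
  have h3 := h3 hx.2
  have h4 : T (hmem1.toLp _) x = c' - ∫ y in Bᶜ, (K x y - K 0 y) := by
    rw [← h3, localTOne, add_sub_cancel_right]
    rfl
  rw [h4]
  obtain ⟨s, hs0, D, -, hD⟩ :=
    H.kernel_bound hT.1 (isCompact_singleton (x := x)) (by simpa using hx)
  have hint : Integrable fun y => (K x y - Bᶜ.indicator (K 0) y) * (F y - c) := by
    refine ((H.integrable_mul_decay hs0).const_mul D).mono ?_
      (Eventually.of_forall fun y => (hD x rfl y).trans (le_abs_self _))
    exact ((KernelBound.aestronglyMeasurable_right hn hK.continuousOn x).sub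
      (aestronglyMeasurable_indicator_kernel hn hK (2 * R))).mul
      (H.memLp.aestronglyMeasurable.sub aestronglyMeasurable_const)
  rw [← integral_add_compl hBm hint]
  have e1 : ∫ y in B, (K x y - Bᶜ.indicator (K 0) y) * (F y - c) = ∫ y, K x y * F₁ y := by
    rw [← setIntegral_eq_integral_of_forall_compl_eq_zero (s := B) (μ := volume)
      (f := fun y => K x y * F₁ y) (fun y hy => by rw [hF₁B' y hy, mul_zero])]
    refine setIntegral_congr_fun hBm fun y hy => ?_
    simp only [hF₁B y hy]
    rw [indicator_of_notMem (by simpa using hy), sub_zero]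
  have e2 : ∫ y in Bᶜ, (K x y - Bᶜ.indicator (K 0) y) * (F y - c)
      = - (c * ∫ y in Bᶜ, (K x y - K 0 y)) := by
    rw [← integral_const_mul, ← integral_neg]
    refine setIntegral_congr_fun hBm.compl fun y hy => ?_
    simp only [indicator_of_mem hy]
    rw [H.eq_zero y (by simpa [hB] using hy)]
    ring
  rw [e1, e2]
  ring

end LocalData

/-- If `F` is equal to the constant `c` on an open set `U`, then on `U` the gradient of `T F` is
given by an absolutely convergent integral of the derivative of the kernel against `F - c`. -/
theorem IsTGradient.inner_eq_integral (hn : 1 ≤ n) {C : ℝ} (hK : KernelBound K C)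
    {T : L2 n →L[ℝ] L2 n} (hT : IsCZOperator T K) (hT1 : TOneEqZero T K) {F : Euc n → ℝ}
    {h : Euc n → Euc n} (hF : IsTGradient T F h) (hFc : HasCompactSupport F) {U : Set (Euc n)}
    (hU : IsOpen U) {c : ℝ} (hFU : ∀ x ∈ U, F x = c) (v : Euc n) :
    ∀ᵐ x, x ∈ U → inner ℝ (h x) v = ∫ y, kernelDeriv K v x y * (F y - c) := by
  obtain ⟨hmem, hh⟩ := hF
  have hball : ∀ k : ℕ, ∀ᵐ x, x ∈ U ∩ ball 0 (k : ℝ) →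
      inner ℝ (h x) v = ∫ y, kernelDeriv K v x y * (F y - c) := by
    obtain ⟨R₀, hR₀⟩ := hFc.isCompact.isBounded.subset_ball (0 : Euc n)
    intro k
    set R := max (max R₀ k) 1 with hR
    have hR1 : 1 ≤ R := le_max_right _ _
    have hR2 : R₀ ≤ R := (le_max_left _ _).trans (le_max_left _ _)
    have hR3 : (k : ℝ) ≤ R := (le_max_right _ _).trans (le_max_left _ _)
    have H : LocalData F c U R := by
      refine ⟨hmem, by linarith, hU, hFU, fun x hx => image_eq_zero_of_notMem_tsupport fun h => ?_⟩
      have := mem_ball_zero_iff.1 (hR₀ h)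
      linarith
    obtain ⟨C₀, hC₀⟩ := H.exists_eq_add_integral hn hK hT hT1
    have hV : IsOpen (U ∩ ball 0 R) := hU.inter isOpen_ball
    have key := HasWeakGradient.ae_eq_of_forall_integral_mul hV
      ((hh.2.1.inner_right v).locallyIntegrableOn _) (H.locallyIntegrableOn hn hK v) ?_
    · filter_upwards [key] with x hx hxk
      exact hx ⟨hxk.1, ball_subset_ball hR3 hxk.2⟩
    · intro φ hφ hc hs
      rw [← neg_inj, ← hh.2.2 φ hφ hc v, ← H.integral_kernel_mul_fderiv hn hK hT.1 hφ hc hs v]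
      have hzero : ∀ x ∉ tsupport φ, fderiv ℝ φ x v = 0 := by
        intro x hx
        rw [image_eq_zero_of_notMem_tsupport fun h => hx (tsupport_fderiv_subset ℝ h),
          _root_.zero_apply]
      have hφ' := hφ.continuous_fderiv_apply_const v
      have hc' : HasCompactSupport fun x => fderiv ℝ φ x v := hc.fderiv_apply ℝ v
      have e1 := (HasWeakGradient.const (n := n) C₀).2.2 φ hφ hc v
      simp only [inner_zero_left, zero_mul, integral_zero, neg_zero] at e1
      have i1 : Integrable fun x => C₀ * fderiv ℝ φ x v :=
        (hφ'.integrable_of_hasCompactSupport hc').const_mul C₀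
      have i2 : Integrable fun x => T (hmem.toLp F) x * fderiv ℝ φ x v :=
        hh.1.integrable_mul_of_hasCompactSupport hφ' hc'
      rw [← sub_zero (∫ x, _), ← e1, ← integral_sub i2 i1]
      refine integral_congr_ae ?_
      filter_upwards [hC₀] with x hx
      by_cases hxs : x ∈ tsupport φ
      · rw [hx (hs hxs)]; ring
      · simp [hzero x hxs]
  filter_upwards [ae_all_iff.2 hball] with x hx hxU
  obtain ⟨k, hk⟩ := exists_nat_gt ‖x‖
  exact hx k ⟨hxU, by simpa using hk⟩

end Representation

/-! ### Averages over balls of variable radius -/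

section VariableAverage

variable {n : ℕ}

theorem lintegral_ball_comp_smul {G : Euc n → ℝ≥0∞} (hG : Measurable G) (x : Euc n) {r : ℝ}
    (hr : 0 < r) :
    ∫⁻ u in ball (0 : Euc n) 1, G (x + r • u) =
      ENNReal.ofReal (r ^ n)⁻¹ * ∫⁻ z in ball x r, G z := by
  set Φ : Euc n → ℝ≥0∞ := fun z => (ball x r).indicator G (x + z) with hΦ
  have hΦm : Measurable Φ := (hG.indicator measurableSet_ball).comp (measurable_const_add x)
  have h1 : ∫⁻ u in ball (0 : Euc n) 1, G (x + r • u) = ∫⁻ u, Φ (r • u) := by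
    rw [← lintegral_indicator measurableSet_ball]
    refine lintegral_congr fun u => ?_
    have : x + r • u ∈ ball x r ↔ u ∈ ball (0 : Euc n) 1 := by
      simp only [mem_ball, dist_eq_norm, add_sub_cancel_left, sub_zero, norm_smul,
        Real.norm_of_nonneg hr.le]
      exact ⟨fun h => by nlinarith, fun h => by nlinarith⟩
    by_cases hu : u ∈ ball (0 : Euc n) 1
    · simp only [hΦ, indicator_of_mem hu, indicator_of_mem (this.2 hu)]
    · simp only [hΦ, indicator_of_notMem hu, indicator_of_notMem (fun h => hu (this.1 h))]
  rw [h1, ← lintegral_map hΦm (measurable_const_smul r), Measure.map_addHaar_smul _ hr.ne',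
    lintegral_smul_measure, finrank_euclideanSpace_fin, abs_of_pos (by positivity), hΦ,
    lintegral_add_left_eq_self, lintegral_indicator measurableSet_ball, smul_eq_mul]

/-- The integral of `G` over the unit ball, transported to the ball of centre `x` and radius
`s d(x)`. -/
def varAvg (d : Euc n → ℝ) (s : ℝ) (G : Euc n → ℝ≥0∞) (x : Euc n) : ℝ≥0∞ :=
  ∫⁻ u in ball (0 : Euc n) 1, G (x + (s * d x) • u)

/-- Averaging over balls of radius `s d(x)`, where `d` is `1`-Lipschitz and `s ≤ 1/2`, is bounded
on `L¹`: in the double integral, `d` is comparable at the two points. -/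
theorem lintegral_varAvg_le {d : Euc n → ℝ} (hd : LipschitzWith 1 d) (hd0 : ∀ x, 0 ≤ d x)
    {G : Euc n → ℝ≥0∞} (hG : Measurable G) {s : ℝ} (hs : 0 < s) (hs' : s ≤ 1 / 2) :
    ∫⁻ x, varAvg d s G x ≤ ENNReal.ofReal ((1 + 3 ^ n) * unitVol n) * ∫⁻ x, G x := by
  have hV := unitVol_pos (n := n)
  have hdm : Measurable d := hd.continuous.measurable
  set P : Set (Euc n) := {x | 0 < d x} with hP
  have hPm : MeasurableSet P := measurableSet_lt measurable_const hdm
  have hdist : ∀ x z, |d x - d z| ≤ dist z x := by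
    intro x z
    have := hd.dist_le_mul x z
    rwa [NNReal.coe_one, one_mul, Real.dist_eq, dist_comm] at this
  have h1 : ∫⁻ x in Pᶜ, varAvg d s G x ≤ ENNReal.ofReal (unitVol n) * ∫⁻ x, G x := by
    calc _ = ∫⁻ x in Pᶜ, ENNReal.ofReal (unitVol n) * G x := by
          refine setLIntegral_congr_fun hPm.compl fun x hx => ?_
          have : d x = 0 := le_antisymm (not_lt.1 hx) (hd0 x)
          simp [varAvg, this, volume_ball_eq _ one_pos, mul_comm]
      _ ≤ ∫⁻ x, ENNReal.ofReal (unitVol n) * G x := setLIntegral_le_lintegral _ _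
      _ = _ := lintegral_const_mul' _ _ ENNReal.ofReal_ne_top
  have h2 : ∫⁻ x in P, varAvg d s G x ≤ ENNReal.ofReal (3 ^ n * unitVol n) * ∫⁻ x, G x := by
    have hset : MeasurableSet {p : Euc n × Euc n | dist p.2 p.1 < s * d p.1} :=
      measurableSet_lt (by fun_prop) (by fun_prop)
    have hm : Measurable fun p : Euc n × Euc n =>
        {p : Euc n × Euc n | dist p.2 p.1 < s * d p.1}.indicator
          (fun p => ENNReal.ofReal ((s * d p.1) ^ n)⁻¹ * G p.2) p :=
      Measurable.indicator (by fun_prop) hset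
    calc ∫⁻ x in P, varAvg d s G x = ∫⁻ x in P, ∫⁻ z,
          {p : Euc n × Euc n | dist p.2 p.1 < s * d p.1}.indicator
            (fun p => ENNReal.ofReal ((s * d p.1) ^ n)⁻¹ * G p.2) (x, z) := by
          refine setLIntegral_congr_fun hPm fun x hx => ?_
          simp only [varAvg]
          rw [lintegral_ball_comp_smul hG x (mul_pos hs hx),
            ← lintegral_const_mul' _ _ ENNReal.ofReal_ne_top,
            ← lintegral_indicator measurableSet_ball]
          rfl
      _ = ∫⁻ z, ∫⁻ x in P, {p : Euc n × Euc n | dist p.2 p.1 < s * d p.1}.indicator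
            (fun p => ENNReal.ofReal ((s * d p.1) ^ n)⁻¹ * G p.2) (x, z) :=
          lintegral_lintegral_swap hm.aemeasurable
      _ ≤ ∫⁻ z, ENNReal.ofReal (3 ^ n * unitVol n) * G z := by
          refine lintegral_mono fun z => ?_
          rcases (hd0 z).eq_or_lt with hz | hz
          · refine (setLIntegral_mono' hPm (g := fun _ => 0) fun x hx => ?_).trans (by simp)
            rw [indicator_of_notMem]
            rw [mem_ofPred_eq, not_lt]
            have := abs_le.1 (hdist x z)
            have hx' : 0 < d x := hx
            nlinarith [this.2]
          · calc _ ≤ ∫⁻ x, (ball z (2 * (s * d z))).indicator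
                  (fun _ => ENNReal.ofReal ((2 / 3 * (s * d z)) ^ n)⁻¹ * G z) x := by
                  refine (setLIntegral_le_lintegral _ _).trans (lintegral_mono fun x => ?_)
                  by_cases hx : dist z x < s * d x
                  · have hx0 : 0 < d x := by
                      by_contra h
                      have := dist_nonneg (x := z) (y := x)
                      nlinarith
                    have h3 := abs_le.1 (hdist x z)
                    have h4 : d x ≤ 2 * d z := by nlinarith [h3.2]
                    have h5 : 2 / 3 * d z ≤ d x := by nlinarith [h3.1]
                    rw [indicator_of_mem (by exact hx), indicator_of_mem]
                    · simp only
                      gcongr ENNReal.ofReal (?_ ^ n)⁻¹ * _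
                      nlinarith
                    · rw [mem_ball, dist_comm]
                      nlinarith
                  · rw [indicator_of_notMem (by exact hx)]
                    exact zero_le
              _ = _ := by
                  rw [lintegral_indicator measurableSet_ball, lintegral_const,
                    Measure.restrict_apply MeasurableSet.univ, univ_inter,
                    volume_ball_eq _ (by positivity), mul_right_comm,
                    ← ENNReal.ofReal_mul (by positivity)]
                  congr 2
                  have h6 : 0 < s * d z := mul_pos hs hz
                  generalize s * d z = a at h6
                  rw [mul_pow, mul_pow, div_pow]
                  field_simp
      _ = _ := lintegral_const_mul' _ _ ENNReal.ofReal_ne_top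
  rw [← lintegral_add_compl _ hPm]
  refine (add_le_add h2 h1).trans (le_of_eq ?_)
  rw [← add_mul, ← ENNReal.ofReal_add (by positivity) hV.le]
  congr 2
  ring

theorem measurable_varAvg {d : Euc n → ℝ} (hd : Continuous d) {G : Euc n → ℝ≥0∞}
    (hG : Measurable G) : Measurable fun p : Euc n × ℝ => varAvg d p.2 G p.1 := by
  have hdm := hd.measurable
  exact Measurable.lintegral_prod_right (hG.comp
    (by fun_prop : Measurable fun p : (Euc n × ℝ) × Euc n => p.1.1 + (p.1.2 * d p.1.1) • p.2))

end VariableAverage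

/-! ### The good function -/

section GoodFunction

variable {n : ℕ}

/-- The average of `f` over the ball of centre `x` and radius `d(x)/2`. -/
def goodPart (d f : Euc n → ℝ) (x : Euc n) : ℝ :=
  (unitVol n)⁻¹ * ∫ u in ball (0 : Euc n) 1, f (x + (1 / 2 * d x) • u)

variable {d f : Euc n → ℝ}

theorem integrableOn_unitBall_of_continuous {φ : Euc n → ℝ} (hφ : Continuous φ) :
    IntegrableOn φ (ball 0 1) :=
  (hφ.continuousOn.integrableOn_compact (isCompact_closedBall 0 1)).mono_set ball_subset_closedBall

theorem unitVol_inv_mul_integral_const (c : ℝ) :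
    (unitVol n)⁻¹ * ∫ _ in ball (0 : Euc n) 1, c = c := by
  rw [setIntegral_const, smul_eq_mul, ← mul_assoc]
  change (unitVol n)⁻¹ * unitVol n * c = c
  rw [inv_mul_cancel₀ unitVol_pos.ne', one_mul]

theorem goodPart_eq_of_eq_zero {x : Euc n} (hx : d x = 0) : goodPart d f x = f x := by
  simp only [goodPart, hx, mul_zero, zero_smul, add_zero]
  exact unitVol_inv_mul_integral_const _

/-- The difference of a value of the good part and an average of `f` over another ball, as one
average over the unit ball. For `s = 0` the second average is the value `f y`. -/
theorem goodPart_sub (hf : Continuous f) (x : Euc n) (y : Euc n) (s : ℝ) :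
    goodPart d f x - (unitVol n)⁻¹ * ∫ u in ball (0 : Euc n) 1, f (y + s • u) =
      (unitVol n)⁻¹ * ∫ u in ball (0 : Euc n) 1, (f (x + (1 / 2 * d x) • u) - f (y + s • u)) := by
  rw [goodPart, ← mul_sub, integral_sub]
  · exact integrableOn_unitBall_of_continuous (hf.comp (by fun_prop))
  · exact integrableOn_unitBall_of_continuous (hf.comp (by fun_prop))

/-- An average over the unit ball is bounded by the average of a majorant. -/
theorem abs_unitVol_inv_mul_integral_le {φ ψ : Euc n → ℝ} (hψ : Continuous ψ)
    (h : ∀ u ∈ ball (0 : Euc n) 1, |φ u| ≤ ψ u) :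
    |(unitVol n)⁻¹ * ∫ u in ball (0 : Euc n) 1, φ u| ≤
      (unitVol n)⁻¹ * ∫ u in ball (0 : Euc n) 1, ψ u := by
  have hV := unitVol_pos (n := n)
  rw [abs_mul, abs_of_pos (inv_pos.2 hV)]
  gcongr
  have h' : ∀ᵐ u ∂(volume.restrict (ball (0 : Euc n) 1)), ‖φ u‖ ≤ ψ u :=
    (ae_restrict_iff' measurableSet_ball).2 (Eventually.of_forall h)
  exact norm_integral_le_of_norm_le (integrableOn_unitBall_of_continuous hψ) h'

/-- The substitution `x ↦ x + (d(x)/2) u` in the definition of the good part is Lipschitz, uniformly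
in `u`. -/
theorem norm_increment_le (hd : LipschitzWith 1 d) (x y : Euc n) {u : Euc n}
    (hu : u ∈ ball (0 : Euc n) 1) :
    ‖(x + (1 / 2 * d x) • u) - (y + (1 / 2 * d y) • u)‖ ≤ 3 / 2 * ‖x - y‖ := by
  have e : (x + (1 / 2 * d x) • u) - (y + (1 / 2 * d y) • u)
      = (x - y) + (1 / 2 * (d x - d y)) • u := by
    rw [mul_sub, sub_smul]; abel
  have hu1 : ‖u‖ ≤ 1 := (mem_ball_zero_iff.1 hu).le
  have hd1 : |d x - d y| ≤ ‖x - y‖ := by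
    have := hd.dist_le_mul x y
    rwa [NNReal.coe_one, one_mul, Real.dist_eq, dist_eq_norm] at this
  rw [e]
  refine (norm_add_le _ _).trans ?_
  rw [norm_smul, norm_mul, Real.norm_of_nonneg (by norm_num : (0 : ℝ) ≤ 1 / 2), Real.norm_eq_abs]
  have : 1 / 2 * |d x - d y| * ‖u‖ ≤ 1 / 2 * ‖x - y‖ * 1 := by gcongr
  linarith

theorem lipschitzWith_goodPart (hd : LipschitzWith 1 d) {L : ℝ≥0} (hf : LipschitzWith L f) :
    LipschitzWith (L * (3 / 2)) (goodPart d f) := by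
  refine LipschitzWith.of_dist_le_mul fun x y => ?_
  have e := goodPart_sub (d := d) hf.continuous x y (1 / 2 * d y)
  have h := abs_unitVol_inv_mul_integral_le
    (φ := fun u => f (x + (1 / 2 * d x) • u) - f (y + (1 / 2 * d y) • u))
    (ψ := fun _ => L * (3 / 2 * ‖x - y‖)) continuous_const (fun u hu => ?_)
  · rw [← e, unitVol_inv_mul_integral_const] at h
    rw [Real.dist_eq, dist_eq_norm]
    refine h.trans (le_of_eq ?_)
    push_cast
    ring
  · have h1 := hf.dist_le_mul (x + (1 / 2 * d x) • u) (y + (1 / 2 * d y) • u)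
    rw [Real.dist_eq, dist_eq_norm] at h1
    refine h1.trans ?_
    gcongr
    exact norm_increment_le hd x y hu

/-- The bad part `f - goodPart d f` vanishes on the zero set of `d`, at a rate controlled by `d`. -/
theorem abs_sub_goodPart_le (hd0 : ∀ x, 0 ≤ d x) {L : ℝ≥0} (hf : LipschitzWith L f) (x : Euc n) :
    |f x - goodPart d f x| ≤ L * d x := by
  have e := goodPart_sub (d := d) hf.continuous x x 0
  simp only [zero_smul, add_zero, unitVol_inv_mul_integral_const] at e
  rw [abs_sub_comm, e]
  have h := abs_unitVol_inv_mul_integral_le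
    (φ := fun u => f (x + (1 / 2 * d x) • u) - f x)
    (ψ := fun _ => L * d x) continuous_const (fun u hu => ?_)
  · rwa [unitVol_inv_mul_integral_const] at h
  · have h1 := hf.dist_le_mul (x + (1 / 2 * d x) • u) x
    rw [Real.dist_eq, dist_eq_norm, add_sub_cancel_left, norm_smul] at h1
    refine h1.trans ?_
    have hu1 : ‖u‖ ≤ 1 := (mem_ball_zero_iff.1 hu).le
    have := hd0 x
    gcongr
    rw [Real.norm_of_nonneg (by positivity)]
    calc 1 / 2 * d x * ‖u‖ ≤ 1 / 2 * d x * 1 := by gcongr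
      _ ≤ d x := by linarith

/-- The bad part `f - goodPart d f`, divided by `d`, is controlled by averages of the gradient. -/
theorem enorm_sub_goodPart_le (hd0 : ∀ x, 0 ≤ d x) (hf : ContDiff ℝ ∞ f) (x : Euc n) :
    ‖f x - goodPart d f x‖ₑ ≤ ENNReal.ofReal (d x) * (ENNReal.ofReal (unitVol n)⁻¹ *
      ∫⁻ t in Ioc (0 : ℝ) 1, varAvg d (1 / 2 * t) (fun y => ‖gradient f y‖ₑ) x) := by
  have hV := unitVol_pos (n := n)
  have e := goodPart_sub (d := d) hf.continuous x x 0
  simp only [zero_smul, add_zero, unitVol_inv_mul_integral_const] at e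
  rw [← enorm_neg, neg_sub, e, enorm_mul, Real.enorm_eq_ofReal (inv_pos.2 hV).le, mul_left_comm]
  gcongr
  have hG : Measurable fun y => ‖gradient f y‖ₑ := (measurable_gradient f).enorm
  calc ‖∫ u in ball (0 : Euc n) 1, (f (x + (1 / 2 * d x) • u) - f x)‖ₑ
      ≤ ∫⁻ u in ball (0 : Euc n) 1, ‖f (x + (1 / 2 * d x) • u) - f x‖ₑ :=
        enorm_integral_le_lintegral_enorm _
    _ ≤ ∫⁻ u in ball (0 : Euc n) 1, ENNReal.ofReal (d x) *
          ∫⁻ t in Ioc (0 : ℝ) 1, ‖gradient f (x + (1 / 2 * t * d x) • u)‖ₑ := by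
        refine setLIntegral_mono' measurableSet_ball fun u hu => ?_
        refine (hf.enorm_sub_le_lintegral x _).trans ?_
        gcongr ?_ * ?_
        · rw [← ofReal_norm, norm_smul]
          refine ENNReal.ofReal_le_ofReal ?_
          have hu1 : ‖u‖ ≤ 1 := (mem_ball_zero_iff.1 hu).le
          have := hd0 x
          rw [Real.norm_of_nonneg (by positivity)]
          calc 1 / 2 * d x * ‖u‖ ≤ 1 / 2 * d x * 1 := by gcongr
            _ ≤ d x := by linarith
        · refine le_of_eq (lintegral_congr fun t => ?_)
          rw [smul_smul, ← mul_assoc, mul_comm t]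
    _ = _ := by
        rw [lintegral_const_mul' _ _ ENNReal.ofReal_ne_top, lintegral_lintegral_swap]
        · rfl
        · exact (hG.comp (by fun_prop : Measurable fun p : Euc n × ℝ =>
            x + (1 / 2 * p.2 * d x) • p.1)).aemeasurable

/-- The gradient of the good part is bounded by averages of the gradient of `f`. -/
theorem enorm_gradient_goodPart_le (hd : LipschitzWith 1 d) (hf : ContDiff ℝ ∞ f)
    (hc : HasCompactSupport f) (x : Euc n) :
    ‖gradient (goodPart d f) x‖ₑ ≤ ENNReal.ofReal (3 / 2 * (unitVol n)⁻¹) *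
      varAvg d (1 / 2) (fun y => ‖gradient f y‖ₑ) x := by
  have hV := unitVol_pos (n := n)
  have hcf : Continuous (fderiv ℝ f) := hf.continuous_fderiv (by simp)
  set A : ℝ := (unitVol n)⁻¹ * ∫ u in ball (0 : Euc n) 1, ‖fderiv ℝ f (x + (1 / 2 * d x) • u)‖
    with hA
  have hA0 : 0 ≤ A := mul_nonneg (inv_pos.2 hV).le (integral_nonneg fun _ => norm_nonneg _)
  have hcA : Continuous fun u => ‖fderiv ℝ f (x + (1 / 2 * d x) • u)‖ :=
    (hcf.comp (by fun_prop)).norm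
  have hAe : ENNReal.ofReal A = ENNReal.ofReal (unitVol n)⁻¹ *
      varAvg d (1 / 2) (fun y => ‖gradient f y‖ₑ) x := by
    rw [hA, ENNReal.ofReal_mul (inv_pos.2 hV).le, ofReal_integral_eq_lintegral_ofReal
      (integrableOn_unitBall_of_continuous hcA) (Eventually.of_forall fun _ => norm_nonneg _)]
    congr 1
    refine lintegral_congr fun u => ?_
    rw [← norm_gradient, ofReal_norm]
  have hmain : ‖fderiv ℝ (goodPart d f) x‖ ≤ 3 / 2 * A := by
    by_cases hdiff : DifferentiableAt ℝ (goodPart d f) x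
    swap
    · rw [fderiv_zero_of_not_differentiableAt hdiff, norm_zero]
      positivity
    refine le_of_forall_pos_le_add fun ε hε => ?_
    have huc : UniformContinuous (fderiv ℝ f) :=
      (hc.fderiv ℝ).uniformContinuous_of_continuous hcf
    obtain ⟨δ, hδ, hδ'⟩ := Metric.uniformContinuous_iff.1 huc (2 / 3 * ε) (by positivity)
    -- differentiability of `f`, uniformly in the base point
    have hunif : ∀ y z : Euc n, ‖z - y‖ < δ →
        |f z - f y| ≤ (‖fderiv ℝ f y‖ + 2 / 3 * ε) * ‖z - y‖ := by
      intro y z hz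
      refine (convex_ball y δ).norm_image_sub_le_of_norm_fderiv_le (𝕜 := ℝ) (f := f)
        (fun w _ => hf.differentiable (by simp) w) (fun w hw => ?_) (mem_ball_self hδ)
        (by simpa [dist_eq_norm] using hz)
      have := hδ' hw
      rw [dist_eq_norm] at this
      have h2 := norm_le_norm_add_norm_sub' (fderiv ℝ f w) (fderiv ℝ f y)
      linarith
    refine hdiff.hasFDerivAt.le_of_lip' (by positivity) ?_
    have hball : ball x (2 / 3 * δ) ∈ 𝓝 x := ball_mem_nhds x (by positivity)
    filter_upwards [hball] with y hy
    have hyn : ‖y - x‖ < 2 / 3 * δ := by simpa [dist_eq_norm] using hy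
    have e := goodPart_sub (d := d) hf.continuous y x (1 / 2 * d x)
    have h := abs_unitVol_inv_mul_integral_le
      (φ := fun u => f (y + (1 / 2 * d y) • u) - f (x + (1 / 2 * d x) • u))
      (ψ := fun u => (‖fderiv ℝ f (x + (1 / 2 * d x) • u)‖ + 2 / 3 * ε) * (3 / 2 * ‖y - x‖))
      ((hcA.add continuous_const).mul continuous_const) (fun u hu => ?_)
    · rw [← e] at h
      refine h.trans (le_of_eq ?_)
      rw [integral_mul_const, integral_add (integrableOn_unitBall_of_continuous hcA)
        (integrableOn_unitBall_of_continuous continuous_const), ← mul_assoc, mul_add,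
        unitVol_inv_mul_integral_const, ← hA]
      ring
    · have h3 := norm_increment_le hd y x hu
      refine (hunif _ _ (by linarith)).trans ?_
      gcongr
  calc ‖gradient (goodPart d f) x‖ₑ = ENNReal.ofReal ‖fderiv ℝ (goodPart d f) x‖ := by
        rw [← ofReal_norm, norm_gradient]
    _ ≤ ENNReal.ofReal (3 / 2 * A) := ENNReal.ofReal_le_ofReal hmain
    _ = _ := by
        rw [ENNReal.ofReal_mul (by norm_num), hAe, ← mul_assoc,
          ← ENNReal.ofReal_mul (by norm_num)]

/-- The averages that define the good part are bounded by the level of the maximal function: a ball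
of radius `d(x)/2` around `x` is contained in a ball around a point where that function is small. -/
theorem varAvg_infDist_le {G : Euc n → ℝ} (hG : Continuous G) (hG0 : ∀ x, 0 ≤ G x) {c : ℝ}
    (hc : 0 ≤ c) {F : Set (Euc n)} (hF : F = (maximalSet (fun y => ENNReal.ofReal (G y)) c)ᶜ)
    (hne : F.Nonempty) (x : Euc n) :
    varAvg (infDist · F) (1 / 2) (fun y => ENNReal.ofReal (G y)) x ≤
      ENNReal.ofReal (4 ^ n * c) := by
  have hV := unitVol_pos (n := n)
  have hGm : Measurable fun y => ENNReal.ofReal (G y) := hG.measurable.ennreal_ofReal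
  have hFc : IsClosed F := by rw [hF]; exact (isOpen_maximalSet _ _).isClosed_compl
  have hball : ∀ x ∈ F, ∀ r > 0, ∫⁻ y in ball x r, ENNReal.ofReal (G y) ≤
      ENNReal.ofReal (c * r ^ n) := by
    intro x hx r hr
    rw [hF] at hx
    by_contra! h
    exact hx ⟨r, hr, h⟩
  rcases (infDist_nonneg (x := x) (s := F)).eq_or_lt with h0 | h0
  · have hx : x ∈ F := (hFc.mem_iff_infDist_zero hne).2 h0.symm
    have h1 : unitVol n * G x ≤ c := by
      by_contra! hlt
      have hlt' : c / unitVol n < G x := by rw [div_lt_iff₀ hV]; linarith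
      obtain ⟨q, hq1, hq2⟩ := exists_between hlt'
      rw [div_lt_iff₀ hV] at hq1
      obtain ⟨r, hr, hsub⟩ := Metric.mem_nhds_iff.1
        (hG.continuousAt.eventually (lt_mem_nhds hq2))
      have h2 : ENNReal.ofReal q * volume (ball x r) ≤ ENNReal.ofReal (c * r ^ n) := by
        refine le_trans ?_ (hball x hx r hr)
        rw [← setLIntegral_const]
        exact setLIntegral_mono' measurableSet_ball fun y hy =>
          ENNReal.ofReal_le_ofReal (le_of_lt (hsub hy))
      have hq0 : 0 < q := by
        by_contra! h
        nlinarith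
      rw [volume_ball_eq _ hr, ← ENNReal.ofReal_mul hq0.le,
        ENNReal.ofReal_le_ofReal_iff (by positivity)] at h2
      have : 0 < r ^ n := by positivity
      nlinarith
    simp only [varAvg, ← h0, mul_zero, zero_smul, add_zero, setLIntegral_const,
      volume_ball_eq _ one_pos, one_pow, one_mul]
    rw [← ENNReal.ofReal_mul (hG0 x)]
    refine ENNReal.ofReal_le_ofReal ?_
    have : (1 : ℝ) ≤ 4 ^ n := one_le_pow₀ (by norm_num)
    nlinarith
  · obtain ⟨z, hz, hzd⟩ := hFc.exists_infDist_eq_dist hne x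
    set δ := infDist x F with hδ
    have h1 : ball x (1 / 2 * δ) ⊆ ball z (2 * δ) :=
      ball_subset_ball' (by rw [← hzd]; linarith)
    rw [varAvg, lintegral_ball_comp_smul hGm x (by positivity)]
    calc _ ≤ ENNReal.ofReal ((1 / 2 * δ) ^ n)⁻¹ * ENNReal.ofReal (c * (2 * δ) ^ n) := by
          gcongr
          exact (lintegral_mono_set h1).trans (hball z hz _ (by positivity))
      _ = _ := by
          rw [← ENNReal.ofReal_mul (by positivity)]
          congr 1
          have h4 : (4 : ℝ) ^ n = 2 ^ n * 2 ^ n := by rw [← mul_pow]; norm_num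
          rw [mul_pow, mul_pow, div_pow, one_pow, h4]
          field_simp

end GoodFunction

/-! ### Size of the gradient away from the support -/

section Size

variable {n : ℕ}

theorem norm_le_sum_abs_inner (z : Euc n) :
    ‖z‖ ≤ ∑ i, |inner ℝ z (EuclideanSpace.single i (1 : ℝ))| := by
  have h := (EuclideanSpace.basisFun (Fin n) ℝ).sum_repr z
  calc ‖z‖ = ‖∑ i, (EuclideanSpace.basisFun (Fin n) ℝ).repr z i •
        EuclideanSpace.basisFun (Fin n) ℝ i‖ := by rw [h]
    _ ≤ ∑ i, ‖(EuclideanSpace.basisFun (Fin n) ℝ).repr z i •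
        EuclideanSpace.basisFun (Fin n) ℝ i‖ := norm_sum_le _ _
    _ = _ := by
        refine Finset.sum_congr rfl fun i _ => ?_
        simp [norm_smul, EuclideanSpace.inner_single_right]

theorem enorm_le_of_inner_single {z : Euc n} {B : ℝ≥0∞}
    (h : ∀ i, ‖inner ℝ z (EuclideanSpace.single i (1 : ℝ))‖ₑ ≤ B) : ‖z‖ₑ ≤ n * B := by
  calc ‖z‖ₑ = ENNReal.ofReal ‖z‖ := (ofReal_norm z).symm
    _ ≤ ENNReal.ofReal (∑ i, |inner ℝ z (EuclideanSpace.single i (1 : ℝ))|) :=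
        ENNReal.ofReal_le_ofReal (norm_le_sum_abs_inner z)
    _ = ∑ i, ‖inner ℝ z (EuclideanSpace.single i (1 : ℝ))‖ₑ := by
        rw [ENNReal.ofReal_sum_of_nonneg fun _ _ => abs_nonneg _]
        exact Finset.sum_congr rfl fun i _ => (Real.enorm_eq_ofReal_abs _).symm
    _ ≤ ∑ _i : Fin n, B := Finset.sum_le_sum fun i _ => h i
    _ = n * B := by simp

variable {K : Euc n → Euc n → ℝ} {T : L2 n →L[ℝ] L2 n} {C : ℝ}

/-- The size estimate for the gradient of `T F` where `F` is constant. -/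
theorem IsTGradient.enorm_le_lintegral (hn : 1 ≤ n) (hK : KernelBound K C)
    (hT : IsCZOperator T K) (hT1 : TOneEqZero T K) {F : Euc n → ℝ} {h : Euc n → Euc n}
    (hF : IsTGradient T F h) (hFc : HasCompactSupport F) {U : Set (Euc n)} (hU : IsOpen U)
    {c : ℝ} (hFU : ∀ x ∈ U, F x = c) :
    ∀ᵐ x, x ∈ U → ‖h x‖ₑ ≤
      ENNReal.ofReal (n * C) * ∫⁻ y, ‖F y - c‖ₑ * ENNReal.ofReal (1 / ‖y - x‖ ^ (n + 1)) := by
  have hrep := ae_all_iff.2 fun i : Fin n =>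
    hF.inner_eq_integral hn hK hT hT1 hFc hU hFU (EuclideanSpace.single i 1)
  have hC := hK.1
  filter_upwards [hrep] with x hx hxU
  rw [ENNReal.ofReal_mul (Nat.cast_nonneg n), ENNReal.ofReal_natCast, mul_assoc]
  refine enorm_le_of_inner_single fun i => ?_
  rw [hx i hxU, ← lintegral_const_mul' _ _ ENNReal.ofReal_ne_top]
  refine (enorm_integral_le_lintegral_enorm _).trans (lintegral_mono fun y => ?_)
  by_cases hy : y ∈ U
  · simp [hFU y hy]
  have hne : x ≠ y := by
    rintro rfl
    exact hy hxU
  have h1 := hK.abs_kernelDeriv_le hne (EuclideanSpace.single i 1)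
  rw [PiLp.norm_single, norm_one, mul_one, ← mul_one_div, norm_sub_rev] at h1
  rw [enorm_mul, Real.enorm_eq_ofReal_abs (kernelDeriv _ _ _ _), mul_comm ‖F y - c‖ₑ, ← mul_assoc,
    ← ENNReal.ofReal_mul hC.le]
  gcongr

end Size

/-! ### Truncation of the bad part near a closed set -/

section Truncation

variable {n : ℕ} {d b : Euc n → ℝ} {L : ℝ≥0}

/-- The restriction of `b` to a neighbourhood of the zero set of `d`: it is `b` where `d ≤ 1/k` and
`0` where `d ≥ 2/k`. -/
def nearPart (d b : Euc n → ℝ) (k : ℝ) (x : Euc n) : ℝ := b x * max 0 (min 1 (2 - k * d x))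

theorem nearPart_eq_self {k : ℝ} {x : Euc n} (h : k * d x ≤ 1) : nearPart d b k x = b x := by
  rw [nearPart, min_eq_left (by linarith), max_eq_right zero_le_one, mul_one]

theorem nearPart_eq_zero {k : ℝ} {x : Euc n} (h : 2 ≤ k * d x) : nearPart d b k x = 0 := by
  rw [nearPart, max_eq_left ((min_le_right _ _).trans (by linarith)), mul_zero]

theorem abs_nearPart_le (hb : ∀ x, |b x| ≤ L * d x) (k : ℝ) (x : Euc n) :
    |nearPart d b k x| ≤ L * d x := by
  rw [nearPart, abs_mul]
  refine (mul_le_of_le_one_right (abs_nonneg _) ?_).trans (hb x)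
  rw [abs_of_nonneg (le_max_left _ _)]
  exact max_le zero_le_one (min_le_left _ _)

/-- The truncation stays Lipschitz with a constant independent of `k`: the cutoff has slope `k`, but
`|b| ≤ L d ≤ 2L/k` where it is not constant. -/
theorem lipschitzWith_nearPart (hd : LipschitzWith 1 d) (hb : ∀ x, |b x| ≤ L * d x)
    (hbL : LipschitzWith L b) {k : ℝ} (hk : 0 < k) : LipschitzWith (3 * L) (nearPart d b k) := by
  -- it suffices to treat a pair of points the first of which lies in the region `k d ≤ 2`
  have hd' : ∀ x y, |d x - d y| ≤ ‖x - y‖ := by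
    intro x y
    have := hd.dist_le_mul x y
    rwa [NNReal.coe_one, one_mul, Real.dist_eq, dist_eq_norm] at this
  have hθ : ∀ x y, |max 0 (min 1 (2 - k * d x)) - max 0 (min 1 (2 - k * d y))| ≤ k * ‖x - y‖ := by
    intro x y
    have h1 : |max 0 (min 1 (2 - k * d x)) - max 0 (min 1 (2 - k * d y))|
        ≤ |min 1 (2 - k * d x) - min 1 (2 - k * d y)| := by
      simpa using abs_max_sub_max_le_max 0 (min 1 (2 - k * d x)) 0 (min 1 (2 - k * d y))
    have h2 : |min 1 (2 - k * d x) - min 1 (2 - k * d y)| ≤ |(2 - k * d x) - (2 - k * d y)| := by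
      simpa using abs_min_sub_min_le_max 1 (2 - k * d x) 1 (2 - k * d y)
    have h3 : (2 - k * d x) - (2 - k * d y) = - (k * (d x - d y)) := by ring
    rw [h3, abs_neg, abs_mul, abs_of_pos hk] at h2
    exact h1.trans (h2.trans (by gcongr; exact hd' x y))
  have key : ∀ x y, k * d x ≤ 2 → |nearPart d b k x - nearPart d b k y| ≤ 3 * L * ‖x - y‖ := by
    intro x y hx
    have e : nearPart d b k x - nearPart d b k y =
        b x * (max 0 (min 1 (2 - k * d x)) - max 0 (min 1 (2 - k * d y))) +
        (b x - b y) * max 0 (min 1 (2 - k * d y)) := by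
      simp only [nearPart]; ring
    have h1 : |b x * (max 0 (min 1 (2 - k * d x)) - max 0 (min 1 (2 - k * d y)))| ≤
        2 * L * ‖x - y‖ := by
      rw [abs_mul]
      calc _ ≤ (L * d x) * (k * ‖x - y‖) :=
            mul_le_mul (hb x) (hθ x y) (abs_nonneg _) ((abs_nonneg _).trans (hb x))
        _ = L * (k * d x) * ‖x - y‖ := by ring
        _ ≤ L * 2 * ‖x - y‖ := by gcongr
        _ = _ := by ring
    have h2 : |(b x - b y) * max 0 (min 1 (2 - k * d y))| ≤ L * ‖x - y‖ := by
      rw [abs_mul]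
      have h3 := hbL.dist_le_mul x y
      rw [Real.dist_eq, dist_eq_norm] at h3
      refine (mul_le_of_le_one_right (abs_nonneg _) ?_).trans h3
      rw [abs_of_nonneg (le_max_left _ _)]
      exact max_le zero_le_one (min_le_left _ _)
    rw [e]
    exact (abs_add_le _ _).trans (by linarith)
  refine LipschitzWith.of_dist_le_mul fun x y => ?_
  rw [Real.dist_eq, dist_eq_norm]
  push_cast
  rcases le_total (k * d x) 2 with hx | hx
  · exact key x y hx
  rcases le_total (k * d y) 2 with hy | hy
  · rw [abs_sub_comm, norm_sub_rev]
    exact key y x hy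
  · rw [nearPart_eq_zero hx, nearPart_eq_zero hy, sub_self, abs_zero]
    positivity

/-- At a zero of the nonnegative function `d` where `d` is differentiable, a function bounded by
`d` has zero gradient. -/
theorem gradient_eq_zero_of_le {w : Euc n → ℝ} (hd0 : ∀ x, 0 ≤ d x)
    (hw : ∀ x, |w x| ≤ L * d x) {x : Euc n} (hx : d x = 0) (hdiff : DifferentiableAt ℝ d x) :
    gradient w x = 0 := by
  have hmin : IsLocalMin d x := Eventually.of_forall fun y => by rw [hx]; exact hd0 y
  have hfd : HasFDerivAt d (0 : Euc n →L[ℝ] ℝ) x := by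
    have := hdiff.hasFDerivAt
    rwa [hmin.fderiv_eq_zero] at this
  have hwx : w x = 0 := by
    have := hw x
    rw [hx, mul_zero] at this
    exact abs_nonpos_iff.1 this
  have : HasFDerivAt w (0 : Euc n →L[ℝ] ℝ) x := by
    rw [hasFDerivAt_iff_isLittleO] at hfd ⊢
    refine Asymptotics.IsBigO.trans_isLittleO (Asymptotics.IsBigO.of_bound L ?_) hfd
    refine Eventually.of_forall fun y => ?_
    simp only [hwx, hx, sub_zero, _root_.zero_apply, Real.norm_eq_abs]
    rw [abs_of_nonneg (hd0 y)]
    exact hw y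
  rw [gradient, this.fderiv, map_zero]

end Truncation

/-! ### The weak-type estimate -/

section WeakType

variable {n : ℕ}

/-- Chebyshev's inequality in `L²`. -/
theorem sq_mul_volume_le {h : Euc n → Euc n} (hh : AEStronglyMeasurable h volume) (t : ℝ≥0∞) :
    t ^ 2 * volume {x | t < ‖h x‖ₑ} ≤ eLpNorm h 2 volume ^ 2 := by
  rw [eLpNorm_two_sq]
  refine le_trans ?_ (mul_meas_ge_le_lintegral₀ (hh.enorm.pow_const 2) (t ^ 2))
  gcongr
  intro ht
  gcongr

/-- For `G` integrable and of bounded support the level set of the maximal function is bounded,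
because the radius of a ball on which the average exceeds `c` is bounded. -/
theorem isBounded_maximalSet {G : Euc n → ℝ≥0∞} (hn : 1 ≤ n) (hG : ∫⁻ y, G y ≠ ⊤) {c : ℝ}
    (hc : 0 < c) {R₀ : ℝ} (hs : ∀ x, R₀ ≤ ‖x‖ → G x = 0) :
    Bornology.IsBounded (maximalSet G c) := by
  set I := (∫⁻ y, G y).toReal with hI
  refine isBounded_ball.subset (t := ball 0 (R₀ + (I / c + 1))) ?_
  rintro x ⟨r, hr, hlt⟩
  have h1 : ENNReal.ofReal (c * r ^ n) < ENNReal.ofReal I := by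
    rw [hI, ENNReal.ofReal_toReal hG]
    exact hlt.trans_le (setLIntegral_le_lintegral _ _)
  have h2 : c * r ^ n < I := (ENNReal.ofReal_lt_ofReal_iff_of_nonneg
    (mul_nonneg hc.le (pow_nonneg hr.le _))).1 h1
  have hr' : r < I / c + 1 := by
    by_contra! h3
    have hI0 : 0 ≤ I := ENNReal.toReal_nonneg
    have h4 : 1 ≤ r := by
      have : 0 ≤ I / c := by positivity
      linarith
    have h5 : r ≤ r ^ n := le_self_pow₀ h4 (by omega)
    have h6 : c * (I / c + 1) < I := by nlinarith
    have h7 : c * (I / c + 1) = I + c := by field_simp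
    linarith
  have hne : ∃ y ∈ ball x r, G y ≠ 0 := by
    by_contra! h
    rw [setLIntegral_congr_fun measurableSet_ball h] at hlt
    simp at hlt
  obtain ⟨y, hy, hy0⟩ := hne
  have hyR : ‖y‖ < R₀ := by
    by_contra! h
    exact hy0 (hs y h)
  rw [mem_ball_zero_iff]
  have h8 : ‖y - x‖ < r := by simpa [dist_eq_norm] using hy
  have h9 := norm_sub_norm_le x y
  rw [norm_sub_rev] at h9
  linarith

theorem hasCompactSupport_goodPart {d f : Euc n → ℝ} {R : ℝ}
    (hd : ∀ x, R ≤ ‖x‖ → d x = 0) (hf : ∀ x, R ≤ ‖x‖ → f x = 0) :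
    HasCompactSupport (goodPart d f) := by
  refine HasCompactSupport.of_support_subset_isCompact (isCompact_closedBall 0 R) fun x hx => ?_
  rw [mem_closedBall_zero_iff]
  by_contra! h
  exact hx (by rw [goodPart_eq_of_eq_zero (hd x h.le), hf x h.le])

theorem hasCompactSupport_nearPart {d b : Euc n → ℝ} (hb : HasCompactSupport b) (k : ℝ) :
    HasCompactSupport (nearPart d b k) := hb.mul_right

variable {K : Euc n → Euc n → ℝ} {T : L2 n →L[ℝ] L2 n} {C : ℝ} {A : ℝ≥0}

/-- The gradient of `T` applied to a function that vanishes near the closed set `F` is integrable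
over `F`, with a bound by the integral of the function against the inverse distance to `F`. -/
theorem IsTGradient.setLIntegral_le (hn : 1 ≤ n) (hK : KernelBound K C)
    (hT : IsCZOperator T K) (hT1 : TOneEqZero T K) {b : Euc n → ℝ} {h : Euc n → Euc n}
    (hb : IsTGradient T b h) (hbc : HasCompactSupport b) {F : Set (Euc n)} (hF : MeasurableSet F)
    (hbm : Measurable b) (hbF : F ⊆ (tsupport b)ᶜ) {β : Euc n → ℝ≥0∞}
    (hbβ : ∀ y, ‖b y‖ₑ ≤ ENNReal.ofReal (infDist y F) * β y) :
    ∫⁻ x in F, ‖h x‖ₑ ≤ ENNReal.ofReal (n * C * (2 ^ (n + 1) * unitVol n)) * ∫⁻ y, β y := by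
  have hC := hK.1
  have hV := unitVol_pos (n := n)
  have hae := hb.enorm_le_lintegral hn hK hT hT1 hbc (isClosed_tsupport b).isOpen_compl (c := 0)
    fun x hx => image_eq_zero_of_notMem_tsupport hx
  have hm : Measurable fun p : Euc n × Euc n =>
      ‖b p.2 - 0‖ₑ * ENNReal.ofReal (1 / ‖p.2 - p.1‖ ^ (n + 1)) := by
    fun_prop
  calc ∫⁻ x in F, ‖h x‖ₑ ≤ ∫⁻ x in F, ENNReal.ofReal (n * C) *
        ∫⁻ y, ‖b y - 0‖ₑ * ENNReal.ofReal (1 / ‖y - x‖ ^ (n + 1)) := by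
        refine setLIntegral_mono_ae' hF ?_
        filter_upwards [hae] with x hx hxF
        exact hx (hbF hxF)
    _ = ENNReal.ofReal (n * C) * ∫⁻ y, ∫⁻ x in F,
          ‖b y - 0‖ₑ * ENNReal.ofReal (1 / ‖y - x‖ ^ (n + 1)) := by
        rw [lintegral_const_mul' _ _ ENNReal.ofReal_ne_top,
          lintegral_lintegral_swap hm.aemeasurable]
    _ ≤ ENNReal.ofReal (n * C) * ∫⁻ y, ENNReal.ofReal (2 ^ (n + 1) * unitVol n) * β y := by
        gcongr with y
        rw [sub_zero, lintegral_const_mul' _ _ enorm_ne_top]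
        rcases (infDist_nonneg (x := y) (s := F)).eq_or_lt with h0 | h0
        · have : ‖b y‖ₑ = 0 := by simpa [← h0] using hbβ y
          rw [this, zero_mul]
          exact zero_le
        · have hsub : F ⊆ (ball y (infDist y F))ᶜ := by
            intro x hx
            rw [mem_compl_iff, mem_ball, not_lt, dist_comm]
            exact infDist_le_dist_of_mem hx
          calc _ ≤ ‖b y‖ₑ * ENNReal.ofReal (2 ^ (n + 1) * unitVol n / infDist y F) := by
                gcongr
                refine le_trans ?_ (lintegral_compl_ball_le y h0)
                refine (lintegral_mono_set hsub).trans (le_of_eq (lintegral_congr fun x => ?_))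
                rw [norm_sub_rev]
            _ ≤ ENNReal.ofReal (infDist y F) * β y *
                  ENNReal.ofReal (2 ^ (n + 1) * unitVol n / infDist y F) := by
                gcongr
                exact hbβ y
            _ = _ := by
                rw [mul_right_comm, ← ENNReal.ofReal_mul h0.le]
                congr 2
                field_simp
    _ = _ := by
        rw [lintegral_const_mul' _ _ ENNReal.ofReal_ne_top, ← mul_assoc,
          ← ENNReal.ofReal_mul (by positivity)]

/-- The part of the bad function near `F` is small in `W^{1,2}`. -/
theorem eLpNorm_gradient_nearPart_le {F : Set (Euc n)} (hF : IsClosed F) (hne : F.Nonempty)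
    {b : Euc n → ℝ} {L : ℝ≥0} (hb : ∀ x, |b x| ≤ L * infDist x F) (hbL : LipschitzWith L b)
    {k : ℝ} (hk : 0 < k) :
    eLpNorm (gradient (nearPart (infDist · F) b k)) 2 volume ^ 2 ≤
      (3 * L : ℝ≥0) ^ 2 * volume (Fᶜ ∩ {x | k * infDist x F ≤ 2}) := by
  have hd : LipschitzWith 1 (infDist · F) := lipschitz_infDist_pt F
  have hSm : MeasurableSet (Fᶜ ∩ {x | k * infDist x F ≤ 2}) :=
    hF.isOpen_compl.measurableSet.inter
      (measurableSet_le (hd.continuous.measurable.const_mul k) measurable_const)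
  rw [eLpNorm_two_sq, ← setLIntegral_const, ← lintegral_indicator hSm]
  refine lintegral_mono_ae ?_
  filter_upwards [hd.ae_differentiableAt (μ := volume)] with x hx
  by_cases hxS : x ∈ Fᶜ ∩ {x | k * infDist x F ≤ 2}
  · rw [indicator_of_mem hxS]
    gcongr
    have := norm_fderiv_le_of_lipschitz ℝ (lipschitzWith_nearPart hd hb hbL hk) (x₀ := x)
    rw [← norm_gradient] at this
    rw [← ofReal_norm, ← ENNReal.ofReal_coe_nnreal]
    exact ENNReal.ofReal_le_ofReal this
  · have hzero : gradient (nearPart (infDist · F) b k) x = 0 := by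
      by_cases hxF : x ∈ F
      · exact gradient_eq_zero_of_le (fun _ => infDist_nonneg) (abs_nearPart_le hb k)
          ((hF.mem_iff_infDist_zero hne).1 hxF) hx
      · have hx2 : 2 < k * infDist x F := by
          by_contra! h
          exact hxS ⟨hxF, h⟩
        have : nearPart (infDist · F) b k =ᶠ[𝓝 x] fun _ => 0 := by
          have hc : Continuous fun x => k * infDist x F := hd.continuous.const_mul k
          filter_upwards [hc.continuousAt.eventually (lt_mem_nhds hx2)] with y hy
          exact nearPart_eq_zero hy.le
        rw [gradient, this.fderiv_eq]
        simp
    rw [hzero]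
    simp

/-- The average of `G` over the balls `B(x, s d(x) / 2)`, `0 < s ≤ 1`: the mean of `G` along the
segments that join `x` to the points of `B(x, d(x) / 2)`. -/
def segmentAvg (d : Euc n → ℝ) (G : Euc n → ℝ≥0∞) (x : Euc n) : ℝ≥0∞ :=
  ENNReal.ofReal (unitVol n)⁻¹ * ∫⁻ s in Ioc (0 : ℝ) 1, varAvg d (1 / 2 * s) G x

theorem lintegral_segmentAvg_le {d : Euc n → ℝ} (hd : LipschitzWith 1 d) (hd0 : ∀ x, 0 ≤ d x)
    {G : Euc n → ℝ≥0∞} (hG : Measurable G) :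
    ∫⁻ x, segmentAvg d G x ≤
      ENNReal.ofReal ((unitVol n)⁻¹ * ((1 + 3 ^ n) * unitVol n)) * ∫⁻ x, G x := by
  have hV := unitVol_pos (n := n)
  have hvm : Measurable fun p : Euc n × ℝ => varAvg d (1 / 2 * p.2) G p.1 :=
    (measurable_varAvg hd.continuous hG).comp
      (by fun_prop : Measurable fun p : Euc n × ℝ => (p.1, 1 / 2 * p.2))
  calc ∫⁻ x, segmentAvg d G x = ENNReal.ofReal (unitVol n)⁻¹ *
        ∫⁻ s in Ioc (0 : ℝ) 1, ∫⁻ x, varAvg d (1 / 2 * s) G x := by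
        simp only [segmentAvg]
        rw [lintegral_const_mul' _ _ ENNReal.ofReal_ne_top,
          lintegral_lintegral_swap hvm.aemeasurable]
    _ ≤ ENNReal.ofReal (unitVol n)⁻¹ *
        ∫⁻ s in Ioc (0 : ℝ) 1, ENNReal.ofReal ((1 + 3 ^ n) * unitVol n) * ∫⁻ x, G x := by
        refine mul_le_mul_right (setLIntegral_mono' measurableSet_Ioc fun s hs => ?_) _
        exact lintegral_varAvg_le hd hd0 hG (by linarith [hs.1]) (by linarith [hs.2])
    _ = _ := by
        rw [setLIntegral_const, Real.volume_Ioc, sub_zero, ENNReal.ofReal_one, mul_one,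
          ← mul_assoc, ← ENNReal.ofReal_mul (by positivity)]

/-- The layers around the closed set `F` shrink to the empty set. -/
theorem tendsto_volume_near_zero {F : Set (Euc n)} (hF : IsClosed F) (hne : F.Nonempty)
    (hfin : volume Fᶜ ≠ ⊤) :
    Tendsto (fun k : ℕ => volume (Fᶜ ∩ {x | ((k : ℝ) + 1) * infDist x F ≤ 2})) atTop (𝓝 0) := by
  have hc : Continuous fun x : Euc n => infDist x F := continuous_infDist_pt F
  have hempty : ⋂ k : ℕ, (Fᶜ ∩ {x | ((k : ℝ) + 1) * infDist x F ≤ 2}) = ∅ := by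
    rw [eq_empty_iff_forall_notMem]
    intro x hx
    have h0 := (mem_iInter.1 hx 0).1
    have hdx : 0 < infDist x F := infDist_nonneg.lt_of_ne fun h' =>
      h0 ((hF.mem_iff_infDist_zero hne).2 h'.symm)
    obtain ⟨k, hk⟩ := exists_nat_gt (2 / infDist x F)
    have h1 : ((k : ℝ) + 1) * infDist x F ≤ 2 := (mem_iInter.1 hx k).2
    rw [div_lt_iff₀ hdx] at hk
    nlinarith
  rw [← measure_empty (μ := (volume : Measure (Euc n))), ← hempty]
  refine tendsto_measure_iInter_atTop (fun k => ?_) (fun k l hkl x hx => ⟨hx.1, ?_⟩) ⟨0, ?_⟩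
  · exact (hF.isOpen_compl.measurableSet.inter (measurableSet_le
      (hc.measurable.const_mul _) measurable_const)).nullMeasurableSet
  · have h1 : ((l : ℝ) + 1) * infDist x F ≤ 2 := hx.2
    have h2 : (k : ℝ) ≤ l := by exact_mod_cast hkl
    have h3 : 0 ≤ infDist x F := infDist_nonneg
    change ((k : ℝ) + 1) * infDist x F ≤ 2
    nlinarith
  · exact ne_top_of_le_ne_top hfin (measure_mono inter_subset_left)

/-- The contribution of a function that is dominated by the distance to `F`, on `F`. -/
theorem GradientBound.volume_bad_le (hA : GradientBound T A) (hn : 1 ≤ n)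
    (hK : KernelBound K C) (hT : IsCZOperator T K) (hT1 : TOneEqZero T K)
    {F : Set (Euc n)} (hFc : IsClosed F) (hFne : F.Nonempty) (hfin : volume Fᶜ ≠ ⊤)
    {b : Euc n → ℝ} {h : Euc n → Euc n} {M : ℝ≥0} (hbd : ∀ x, |b x| ≤ M * infDist x F)
    (hbL : LipschitzWith M b) (hbc : HasCompactSupport b) (hhb : IsTGradient T b h)
    {β : Euc n → ℝ≥0∞} (hbβ : ∀ y, ‖b y‖ₑ ≤ ENNReal.ofReal (infDist y F) * β y)
    {t : ℝ≥0∞} (ht0 : t ≠ 0) (ht : t ≠ ⊤) :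
    t * volume (F ∩ {x | 2 * t < ‖h x‖ₑ}) ≤
      ENNReal.ofReal (n * C * (2 ^ (n + 1) * unitVol n)) * ∫⁻ y, β y := by
  have hd1 : LipschitzWith 1 (infDist · F) := lipschitz_infDist_pt F
  -- the bound with an error that comes from the truncation near `F`
  have hk : ∀ k : ℕ, t * volume (F ∩ {x | 2 * t < ‖h x‖ₑ}) ≤
      (ENNReal.ofReal (n * C * (2 ^ (n + 1) * unitVol n)) * ∫⁻ y, β y) +
      t⁻¹ * (A ^ 2 * ((3 * M : ℝ≥0) ^ 2 *
        volume (Fᶜ ∩ {x | ((k : ℝ) + 1) * infDist x F ≤ 2}))) := by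
    intro k
    have hk0 : (0 : ℝ) < k + 1 := by positivity
    set r := nearPart (infDist · F) b (k + 1) with hr
    have hrL := lipschitzWith_nearPart hd1 hbd hbL hk0
    have hrc : HasCompactSupport r := hasCompactSupport_nearPart hbc _
    obtain ⟨⟨hr', hhr⟩, hrA⟩ := hA r _ (SobolevPair.of_lipschitz hrL hrc)
    have hhbr := hhb.sub hhr
    have hsub : F ⊆ (tsupport (b - r))ᶜ := by
      intro x hx
      rw [mem_compl_iff, notMem_tsupport_iff_eventuallyEq]
      have hdx : (k + 1 : ℝ) * infDist x F < 1 := by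
        rw [(hFc.mem_iff_infDist_zero hFne).1 hx, mul_zero]; exact one_pos
      have hcd : Continuous fun x => (k + 1 : ℝ) * infDist x F := hd1.continuous.const_mul _
      filter_upwards [hcd.continuousAt.eventually (gt_mem_nhds hdx)] with y hy
      rw [Pi.sub_apply, hr, nearPart_eq_self hy.le, sub_self]
      rfl
    have hbr : ∀ y, ‖(b - r) y‖ₑ ≤ ENNReal.ofReal (infDist y F) * β y := by
      intro y
      refine le_trans ?_ (hbβ y)
      rw [Real.enorm_eq_ofReal_abs, Real.enorm_eq_ofReal_abs]
      refine ENNReal.ofReal_le_ofReal ?_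
      have e : (b - r) y = b y * (1 - max 0 (min 1 (2 - (k + 1) * infDist y F))) := by
        simp only [hr, Pi.sub_apply, nearPart]; ring
      rw [e, abs_mul]
      refine mul_le_of_le_one_right (abs_nonneg _) ?_
      rw [abs_le]
      constructor
      · linarith [max_le zero_le_one (min_le_left (1 : ℝ) (2 - (k + 1) * infDist y F))]
      · linarith [le_max_left (0 : ℝ) (min 1 (2 - (k + 1) * infDist y F))]
    have hbad := hhbr.setLIntegral_le hn hK hT hT1 (hbc.sub hrc) hFc.measurableSet
      (hbL.continuous.measurable.sub hrL.continuous.measurable) hsub hbr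
    obtain ⟨hrm, hrle⟩ := hrA hr' hhr
    have hbadm : AEStronglyMeasurable (h - hr') volume := hhbr.2.2.1.aestronglyMeasurable
    have h3 : t * volume (F ∩ {x | t < ‖(h - hr') x‖ₑ}) ≤
        ENNReal.ofReal (n * C * (2 ^ (n + 1) * unitVol n)) * ∫⁻ y, β y := by
      calc _ ≤ t * (volume.restrict F) {x | t ≤ ‖(h - hr') x‖ₑ} := by
            refine mul_le_mul_right ?_ _
            rw [Measure.restrict_apply₀' hFc.measurableSet.nullMeasurableSet, inter_comm]
            exact measure_mono (inter_subset_inter_left _ fun x (hx : t < _) => hx.le)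
        _ ≤ ∫⁻ x in F, ‖(h - hr') x‖ₑ := mul_meas_ge_le_lintegral₀ hbadm.enorm.restrict _
        _ ≤ _ := hbad
    have h4 : t * volume {x | t < ‖hr' x‖ₑ} ≤ t⁻¹ * (A ^ 2 * ((3 * M : ℝ≥0) ^ 2 *
          volume (Fᶜ ∩ {x | ((k : ℝ) + 1) * infDist x F ≤ 2}))) := by
      have h1 := sq_mul_volume_le hrm.1 t
      have h2 := eLpNorm_gradient_nearPart_le hFc hFne hbd hbL hk0
      calc t * volume {x | t < ‖hr' x‖ₑ}
          = t⁻¹ * (t ^ 2 * volume {x | t < ‖hr' x‖ₑ}) := by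
            rw [sq, mul_assoc, ← mul_assoc t⁻¹, ENNReal.inv_mul_cancel ht0 ht, one_mul]
        _ ≤ t⁻¹ * (A * eLpNorm (gradient r) 2 volume) ^ 2 := by
            gcongr
            exact h1.trans (by gcongr)
        _ ≤ _ := by
            rw [mul_pow]
            gcongr
    have hcover : F ∩ {x | 2 * t < ‖h x‖ₑ} ⊆
        (F ∩ {x | t < ‖(h - hr') x‖ₑ}) ∪ {x | t < ‖hr' x‖ₑ} := by
      intro x hx
      by_contra hcon
      simp only [mem_union, mem_inter_iff, mem_ofPred_eq, not_or, not_lt, not_and] at hcon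
      obtain ⟨c3, c4⟩ := hcon
      have c3 := c3 hx.1
      have : ‖h x‖ₑ ≤ 2 * t := by
        calc ‖h x‖ₑ = ‖(h - hr') x + hr' x‖ₑ := by simp
          _ ≤ ‖(h - hr') x‖ₑ + ‖hr' x‖ₑ := enorm_add_le _ _
          _ ≤ t + t := by gcongr
          _ = _ := by ring
      exact absurd hx.2 (not_lt.2 this)
    calc _ ≤ t * (volume (F ∩ {x | t < ‖(h - hr') x‖ₑ}) + volume {x | t < ‖hr' x‖ₑ}) := by
          gcongr
          exact (measure_mono hcover).trans (measure_union_le _ _)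
      _ ≤ _ := by
          rw [mul_add]
          gcongr
  have hlim := tendsto_volume_near_zero hFc hFne hfin
  have l1 := ENNReal.Tendsto.const_mul (a := ((3 * M : ℝ≥0) ^ 2 : ℝ≥0∞)) hlim
    (Or.inr (by finiteness))
  have l2 := ENNReal.Tendsto.const_mul (a := ((A : ℝ≥0∞) ^ 2)) l1 (Or.inr (by finiteness))
  have l3 := ENNReal.Tendsto.const_mul (a := t⁻¹) l2 (Or.inr (by simpa using ht0))
  have l4 := l3.const_add (ENNReal.ofReal (n * C * (2 ^ (n + 1) * unitVol n)) * ∫⁻ y, β y)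
  rw [mul_zero, mul_zero, mul_zero, add_zero] at l4
  exact ge_of_tendsto' l4 hk

/-- The contribution of the good part, whose gradient is bounded by a multiple of `t`. -/
theorem GradientBound.volume_good_le (hA : GradientBound T A) {f d : Euc n → ℝ}
    (hf : ContDiff ℝ ∞ f) (hfc : HasCompactSupport f) (hd1 : LipschitzWith 1 d)
    (hd0 : ∀ x, 0 ≤ d x) (hgS : SobolevPair (goodPart d f) (gradient (goodPart d f)))
    {h : Euc n → Euc n} (hh : IsTGradient T (goodPart d f) h) {t : ℝ} (ht : 0 < t)
    (hvar : ∀ x, varAvg d (1 / 2) (fun y => ‖gradient f y‖ₑ) x ≤ ENNReal.ofReal (4 ^ n * t)) :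
    ENNReal.ofReal t * volume {x | ENNReal.ofReal t < ‖h x‖ₑ} ≤
      A ^ 2 * ENNReal.ofReal (3 / 2 * (unitVol n)⁻¹ * 4 ^ n *
        (3 / 2 * (unitVol n)⁻¹ * ((1 + 3 ^ n) * unitVol n))) * ∫⁻ x, ‖gradient f x‖ₑ := by
  have hV := unitVol_pos (n := n)
  have hGm : Measurable fun y => ‖gradient f y‖ₑ := (measurable_gradient f).enorm
  have hgrad := enorm_gradient_goodPart_le hd1 hf hfc
  have hgrad1 : ∀ x, ‖gradient (goodPart d f) x‖ₑ ≤
      ENNReal.ofReal (3 / 2 * (unitVol n)⁻¹ * 4 ^ n * t) := by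
    intro x
    refine (hgrad x).trans ?_
    calc _ ≤ ENNReal.ofReal (3 / 2 * (unitVol n)⁻¹) * ENNReal.ofReal (4 ^ n * t) := by
          gcongr
          exact hvar x
      _ = _ := by rw [← ENNReal.ofReal_mul (by positivity)]; congr 1; ring
  have hgrad2 : ∫⁻ x, ‖gradient (goodPart d f) x‖ₑ ≤
      ENNReal.ofReal (3 / 2 * (unitVol n)⁻¹ * ((1 + 3 ^ n) * unitVol n)) *
        ∫⁻ x, ‖gradient f x‖ₑ := by
    calc _ ≤ ∫⁻ x, ENNReal.ofReal (3 / 2 * (unitVol n)⁻¹) *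
          varAvg d (1 / 2) (fun y => ‖gradient f y‖ₑ) x := lintegral_mono hgrad
      _ ≤ ENNReal.ofReal (3 / 2 * (unitVol n)⁻¹) *
          (ENNReal.ofReal ((1 + 3 ^ n) * unitVol n) * ∫⁻ x, ‖gradient f x‖ₑ) := by
          rw [lintegral_const_mul' _ _ ENNReal.ofReal_ne_top]
          gcongr
          exact lintegral_varAvg_le hd1 hd0 hGm (by norm_num) le_rfl
      _ = _ := by rw [← mul_assoc, ← ENNReal.ofReal_mul (by positivity)]
  obtain ⟨-, hle⟩ := hA _ _ hgS
  obtain ⟨hm, hle⟩ := hle h hh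
  have h1 := sq_mul_volume_le hm.1 (ENNReal.ofReal t)
  have h2 : eLpNorm (gradient (goodPart d f)) 2 volume ^ 2 ≤
      ENNReal.ofReal (3 / 2 * (unitVol n)⁻¹ * 4 ^ n * t) *
        (ENNReal.ofReal (3 / 2 * (unitVol n)⁻¹ * ((1 + 3 ^ n) * unitVol n)) *
          ∫⁻ x, ‖gradient f x‖ₑ) := by
    rw [eLpNorm_two_sq]
    refine le_trans ?_ (mul_le_mul_right hgrad2 _)
    rw [← lintegral_const_mul' _ _ ENNReal.ofReal_ne_top]
    refine lintegral_mono fun x => ?_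
    rw [sq]
    exact mul_le_mul_left (hgrad1 x) _
  have ht0 : ENNReal.ofReal t ≠ 0 := by simpa using ht
  refine (ENNReal.mul_le_mul_iff_right ht0 ENNReal.ofReal_ne_top).1 ?_
  calc ENNReal.ofReal t * (ENNReal.ofReal t * volume {x | ENNReal.ofReal t < ‖h x‖ₑ})
      = ENNReal.ofReal t ^ 2 * volume {x | ENNReal.ofReal t < ‖h x‖ₑ} := by ring
    _ ≤ (A * eLpNorm (gradient (goodPart d f)) 2 volume) ^ 2 := h1.trans (by gcongr)
    _ ≤ A ^ 2 * (ENNReal.ofReal (3 / 2 * (unitVol n)⁻¹ * 4 ^ n * t) *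
        (ENNReal.ofReal (3 / 2 * (unitVol n)⁻¹ * ((1 + 3 ^ n) * unitVol n)) *
          ∫⁻ x, ‖gradient f x‖ₑ)) := by
        rw [mul_pow]
        exact mul_le_mul_right h2 _
    _ = _ := by
        rw [ENNReal.ofReal_mul (q := t) (by positivity),
          ENNReal.ofReal_mul (p := 3 / 2 * (unitVol n)⁻¹ * 4 ^ n) (by positivity)]
        ring

/-- The weak-type `(1,1)` estimate for the map `∇f ↦ ∇Tf`, for smooth compactly supported `f`. -/
theorem GradientBound.weak_type_smooth (hA : GradientBound T A) (hn : 1 ≤ n)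
    (hK : KernelBound K C) (hT : IsCZOperator T K) (hT1 : TOneEqZero T K) :
    ∃ D : ℝ≥0∞, D ≠ ⊤ ∧ ∀ (f : Euc n → ℝ) (h : Euc n → Euc n), ContDiff ℝ ∞ f →
      HasCompactSupport f → IsTGradient T f h → ∀ t : ℝ, 0 < t →
        ENNReal.ofReal t * volume {x | 3 * ENNReal.ofReal t < ‖h x‖ₑ} ≤
          D * ∫⁻ x, ‖gradient f x‖ₑ := by
  refine ⟨A ^ 2 * ENNReal.ofReal (3 / 2 * (unitVol n)⁻¹ * 4 ^ n *
        (3 / 2 * (unitVol n)⁻¹ * ((1 + 3 ^ n) * unitVol n))) +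
      ENNReal.ofReal (5 ^ n * unitVol n) +
      ENNReal.ofReal (n * C * (2 ^ (n + 1) * unitVol n)) *
        ENNReal.ofReal ((unitVol n)⁻¹ * ((1 + 3 ^ n) * unitVol n)),
    by finiteness, fun f h hf hfc hh t ht => ?_⟩
  have hGc : Continuous fun y => ‖gradient f y‖ := hf.continuous_gradient.norm
  have hGe : (fun y => ENNReal.ofReal ‖gradient f y‖) = fun y => ‖gradient f y‖ₑ :=
    funext fun y => ofReal_norm _
  have hGm : Measurable fun y => ‖gradient f y‖ₑ := (measurable_gradient f).enorm
  have hgs : HasCompactSupport (gradient f) :=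
    (hfc.fderiv (𝕜 := ℝ)).comp_left (g := (InnerProductSpace.toDual ℝ (Euc n)).symm) (map_zero _)
  have hI : ∫⁻ x, ‖gradient f x‖ₑ ≠ ⊤ :=
    (hf.continuous_gradient.integrable_of_hasCompactSupport hgs).hasFiniteIntegral.ne
  obtain ⟨L, hL⟩ := hf.lipschitzWith_of_hasCompactSupport hfc (by simp)
  -- the exceptional set, its complement and the distance function
  obtain ⟨Ω, hΩ⟩ : ∃ Ω, Ω = maximalSet (fun y => ‖gradient f y‖ₑ) t := ⟨_, rfl⟩
  have hΩI : ENNReal.ofReal t * volume Ω ≤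
      ENNReal.ofReal (5 ^ n * unitVol n) * ∫⁻ x, ‖gradient f x‖ₑ :=
    hΩ ▸ volume_maximalSet_le hn hI ht
  have hΩo : IsOpen Ω := hΩ ▸ isOpen_maximalSet _ _
  obtain ⟨R₁, hR₁⟩ := hfc.isCompact.isBounded.subset_ball (0 : Euc n)
  have hf0 : ∀ x, R₁ ≤ ‖x‖ → x ∉ tsupport f := fun x hx h' => by
    have := mem_ball_zero_iff.1 (hR₁ h')
    linarith
  have hG0 : ∀ x, R₁ ≤ ‖x‖ → ‖gradient f x‖ₑ = 0 := by
    intro x hx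
    have h2 : fderiv ℝ f x = 0 :=
      image_eq_zero_of_notMem_tsupport fun h => hf0 x hx (tsupport_fderiv_subset ℝ h)
    simp [gradient, h2]
  have hΩb : Bornology.IsBounded Ω := hΩ ▸ isBounded_maximalSet hn hI ht hG0
  have hΩfin : volume Ω ≠ ⊤ := hΩb.measure_lt_top.ne
  have hFc : IsClosed Ωᶜ := hΩo.isClosed_compl
  have hFne : Ωᶜ.Nonempty := by
    have : Nonempty (Fin n) := ⟨⟨0, hn⟩⟩
    by_contra hne
    rw [not_nonempty_iff_eq_empty, compl_empty_iff] at hne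
    rw [hne, measure_univ_of_isAddLeftInvariant] at hΩfin
    exact hΩfin rfl
  have hd1 : LipschitzWith 1 (infDist · Ωᶜ) := lipschitz_infDist_pt Ωᶜ
  have hd0 : ∀ x, 0 ≤ infDist x Ωᶜ := fun _ => infDist_nonneg
  obtain ⟨R₂, hR₂⟩ := hΩb.subset_ball (0 : Euc n)
  have hdR : ∀ x, max R₁ R₂ ≤ ‖x‖ → infDist x Ωᶜ = 0 := fun x hx =>
    (hFc.mem_iff_infDist_zero hFne).1 fun h' => by
      have := mem_ball_zero_iff.1 (hR₂ h')
      linarith [le_max_right R₁ R₂]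
  have hfR : ∀ x, max R₁ R₂ ≤ ‖x‖ → f x = 0 := fun x hx =>
    image_eq_zero_of_notMem_tsupport (hf0 x ((le_max_left _ _).trans hx))
  -- the good and the bad part
  have hgL := lipschitzWith_goodPart hd1 hL
  have hgc : HasCompactSupport (goodPart (infDist · Ωᶜ) f) := hasCompactSupport_goodPart hdR hfR
  have hgS := SobolevPair.of_lipschitz hgL hgc
  have hbL : LipschitzWith (L + L * (3 / 2)) (f - goodPart (infDist · Ωᶜ) f) := hL.sub hgL
  have hbd : ∀ x, |(f - goodPart (infDist · Ωᶜ) f) x| ≤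
      ((L + L * (3 / 2) : ℝ≥0) : ℝ) * infDist x Ωᶜ := fun x =>
    (abs_sub_goodPart_le hd0 hL x).trans (by
      have := hd0 x
      gcongr
      exact le_self_add)
  obtain ⟨⟨hg', hhg⟩, -⟩ := hA _ _ hgS
  have hgood := hA.volume_good_le hf hfc hd1 hd0 hgS hhg ht fun x => by
    have := varAvg_infDist_le hGc (fun _ => norm_nonneg _) ht.le (by rw [hGe, hΩ]) hFne x
    rwa [hGe] at this
  have ht0 : ENNReal.ofReal t ≠ 0 := by simpa using ht
  have hbad := hA.volume_bad_le hn hK hT hT1 hFc hFne (by rwa [compl_compl]) hbd hbL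
    (hfc.sub hgc) (hh.sub hhg) (enorm_sub_goodPart_le hd0 hf) ht0 ENNReal.ofReal_ne_top
  have hβ := lintegral_segmentAvg_le hd1 hd0 hGm
  have hcover : {x | 3 * ENNReal.ofReal t < ‖h x‖ₑ} ⊆
      {x | ENNReal.ofReal t < ‖hg' x‖ₑ} ∪ Ω ∪
        (Ωᶜ ∩ {x | 2 * ENNReal.ofReal t < ‖(h - hg') x‖ₑ}) := by
    intro x hx
    by_contra hcon
    simp only [mem_union, mem_inter_iff, mem_ofPred_eq, not_or, not_lt, not_and] at hcon
    obtain ⟨⟨c1, c2⟩, c3⟩ := hcon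
    have c3 := c3 c2
    have : ‖h x‖ₑ ≤ 3 * ENNReal.ofReal t := by
      calc ‖h x‖ₑ = ‖hg' x + (h - hg') x‖ₑ := by simp
        _ ≤ ‖hg' x‖ₑ + ‖(h - hg') x‖ₑ := enorm_add_le _ _
        _ ≤ ENNReal.ofReal t + 2 * ENNReal.ofReal t := by gcongr
        _ = _ := by ring
    exact absurd hx (not_lt.2 this)
  calc _ ≤ ENNReal.ofReal t * (volume {x | ENNReal.ofReal t < ‖hg' x‖ₑ} + volume Ω +
        volume (Ωᶜ ∩ {x | 2 * ENNReal.ofReal t < ‖(h - hg') x‖ₑ})) := by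
        gcongr
        refine (measure_mono hcover).trans ((measure_union_le _ _).trans ?_)
        gcongr
        exact measure_union_le _ _
    _ ≤ _ := by
        rw [mul_add, mul_add, add_mul, add_mul]
        exact add_le_add (add_le_add hgood hΩI)
          (hbad.trans ((mul_le_mul_right hβ _).trans_eq (mul_assoc _ _ _).symm))

/-- A bound for the measure of a level set passes to limits in `L²`. -/
theorem mul_volume_le_of_forall_exists {h : Euc n → Euc n} {s B : ℝ≥0∞} (hs0 : s ≠ 0) (hs : s ≠ ⊤)
    (H : ∀ ε : ℝ≥0∞, 0 < ε → ε ≠ ⊤ → ∃ h' : Euc n → Euc n, AEStronglyMeasurable (h - h') volume ∧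
      eLpNorm (h - h') 2 volume ≤ ε ∧ s * volume {x | s < ‖h' x‖ₑ} ≤ B) :
    s * volume {x | 2 * s < ‖h x‖ₑ} ≤ B := by
  have key : ∀ k : ℕ, s * volume {x | 2 * s < ‖h x‖ₑ} ≤ B + s⁻¹ * ((k : ℝ≥0∞) + 1)⁻¹ ^ 2 := by
    intro k
    obtain ⟨h', hm, hle, hB⟩ := H ((k : ℝ≥0∞) + 1)⁻¹ (by simp) (by simp)
    have h2 : s * volume {x | s < ‖(h - h') x‖ₑ} ≤ s⁻¹ * ((k : ℝ≥0∞) + 1)⁻¹ ^ 2 := by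
      calc _ = s⁻¹ * (s ^ 2 * volume {x | s < ‖(h - h') x‖ₑ}) := by
            rw [sq, mul_assoc, ← mul_assoc s⁻¹, ENNReal.inv_mul_cancel hs0 hs, one_mul]
        _ ≤ _ := by
            gcongr
            exact (sq_mul_volume_le hm _).trans (by gcongr)
    have hcover : {x | 2 * s < ‖h x‖ₑ} ⊆ {x | s < ‖h' x‖ₑ} ∪ {x | s < ‖(h - h') x‖ₑ} := by
      intro x hx
      by_contra hcon
      simp only [mem_union, mem_ofPred_eq, not_or, not_lt] at hcon
      obtain ⟨c1, c2⟩ := hcon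
      have : ‖h x‖ₑ ≤ 2 * s := by
        calc ‖h x‖ₑ = ‖h' x + (h - h') x‖ₑ := by simp
          _ ≤ ‖h' x‖ₑ + ‖(h - h') x‖ₑ := enorm_add_le _ _
          _ ≤ s + s := by gcongr
          _ = _ := by ring
      exact absurd hx (not_lt.2 this)
    calc _ ≤ s * (volume {x | s < ‖h' x‖ₑ} + volume {x | s < ‖(h - h') x‖ₑ}) := by
          gcongr
          exact (measure_mono hcover).trans (measure_union_le _ _)
      _ ≤ _ := by
          rw [mul_add]
          exact add_le_add hB h2
  have hlim : Tendsto (fun k : ℕ => ((k : ℝ≥0∞) + 1)⁻¹) atTop (𝓝 0) := by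
    have := (tendsto_add_atTop_iff_nat 1).2 ENNReal.tendsto_inv_nat_nhds_zero
    simpa using this
  have l2 := (ENNReal.Tendsto.const_mul (a := s⁻¹) (ENNReal.Tendsto.pow (n := 2) hlim)
    (Or.inr (by simpa using hs0))).const_add B
  rw [zero_pow two_ne_zero, mul_zero, add_zero] at l2
  exact ge_of_tendsto' l2 key

/-- The weak-type `(1,1)` estimate for the map `∇u ↦ ∇Tu`, for compactly supported Sobolev
functions. -/
theorem GradientBound.weak_type (hA : GradientBound T A) (hn : 1 ≤ n)
    (hK : KernelBound K C) (hT : IsCZOperator T K) (hT1 : TOneEqZero T K) :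
    ∃ D : ℝ≥0∞, D ≠ ⊤ ∧ ∀ (u : Euc n → ℝ) (g h : Euc n → Euc n), SobolevPair u g →
      HasCompactSupport u → IsTGradient T u h → ∀ t : ℝ, 0 < t →
        ENNReal.ofReal t * volume {x | ENNReal.ofReal t < ‖h x‖ₑ} ≤ D * ∫⁻ x, ‖g x‖ₑ := by
  obtain ⟨D, hD, hw⟩ := hA.weak_type_smooth hn hK hT hT1
  refine ⟨6 * D, by finiteness, fun u g h hu huc hh t ht => ?_⟩
  obtain ⟨s, hs, rfl⟩ : ∃ s : ℝ, 0 < s ∧ t = 6 * s := ⟨t / 6, by positivity, by ring⟩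
  have hs0 : ENNReal.ofReal s ≠ 0 := by simpa using hs
  have h6 : ENNReal.ofReal (6 * s) = 2 * (3 * ENNReal.ofReal s) := by
    rw [ENNReal.ofReal_mul (by norm_num), ← mul_assoc]; norm_num
  have key : 3 * ENNReal.ofReal s * volume {x | 2 * (3 * ENNReal.ofReal s) < ‖h x‖ₑ} ≤
      3 * D * ∫⁻ x, ‖g x‖ₑ := by
    refine mul_volume_le_of_forall_exists (by simpa using hs) (by finiteness) fun ε hε hε' => ?_
    -- approximate by a smooth function whose gradient has no larger integral
    have hε1 : 0 < ε / (A + 1) := ENNReal.div_pos hε.ne' (by finiteness)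
    obtain ⟨w, hwS, hwP, -, hwg, hwI, hwc⟩ := hu.exists_smooth_approx hε1
      (ENNReal.div_ne_top hε' (by simp))
    obtain ⟨⟨hw', hhw⟩, -⟩ := hA w _ hwP
    obtain ⟨hm, hle⟩ := (hA _ _ (hu.sub hwP)).2 _ (hh.sub hhw)
    refine ⟨hw', hm.1, ?_, ?_⟩
    · calc _ ≤ A * (ε / (A + 1)) := hle.trans (by gcongr)
        _ ≤ (A + 1) * (ε / (A + 1)) := by gcongr; exact le_self_add
        _ ≤ ε := ENNReal.mul_div_le
    · rw [mul_assoc, mul_assoc]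
      exact mul_le_mul_right ((hw w hw' hwS (hwc huc) hhw s hs).trans (by gcongr)) _
  rw [h6, mul_assoc]
  calc _ ≤ 2 * (3 * D * ∫⁻ x, ‖g x‖ₑ) := mul_le_mul_right key _
    _ = _ := by rw [← mul_assoc, ← mul_assoc]; norm_num

end WeakType

/-! ### Localization to a ball -/

section Localization

variable {n : ℕ}

/-- A fixed smooth bump function that is `1` on the unit ball and vanishes off the ball of radius
`3/2`. -/
def unitBump (n : ℕ) : ContDiffBump (0 : Euc n) := ⟨1, 3 / 2, by norm_num, by norm_num⟩

/-- The cutoff function of the ball `B(x₀, ρ)`. -/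
def cutoff (x₀ : Euc n) (ρ : ℝ) (y : Euc n) : ℝ := unitBump n (ρ⁻¹ • (y - x₀))

variable {x₀ : Euc n} {ρ : ℝ}

theorem contDiff_cutoff : ContDiff ℝ ∞ (cutoff x₀ ρ) :=
  (unitBump n).contDiff.comp ((contDiff_id.sub contDiff_const).const_smul _)

theorem norm_inv_smul_sub (hρ : 0 < ρ) (y : Euc n) : ‖ρ⁻¹ • (y - x₀)‖ = ‖y - x₀‖ / ρ := by
  rw [norm_smul, Real.norm_of_nonneg (inv_pos.2 hρ).le, inv_mul_eq_div]

theorem cutoff_eq_one (hρ : 0 < ρ) {y : Euc n} (hy : y ∈ ball x₀ ρ) : cutoff x₀ ρ y = 1 := by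
  refine (unitBump n).one_of_mem_closedBall ?_
  rw [mem_closedBall_zero_iff, norm_inv_smul_sub hρ]
  exact (div_le_one hρ).2 (by rw [mem_ball_iff_norm] at hy; exact hy.le)

theorem cutoff_eq_zero (hρ : 0 < ρ) {y : Euc n} (hy : y ∉ ball x₀ (3 / 2 * ρ)) :
    cutoff x₀ ρ y = 0 := by
  refine (unitBump n).zero_of_le_dist ?_
  rw [dist_zero_right, norm_inv_smul_sub hρ, le_div_iff₀ hρ]
  rw [mem_ball_iff_norm, not_lt] at hy
  exact hy

theorem cutoff_nonneg (y : Euc n) : 0 ≤ cutoff x₀ ρ y := (unitBump n).nonneg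

theorem cutoff_le_one (y : Euc n) : cutoff x₀ ρ y ≤ 1 := (unitBump n).le_one

theorem tsupport_cutoff_subset (hρ : 0 < ρ) :
    tsupport (cutoff x₀ ρ) ⊆ closedBall x₀ (3 / 2 * ρ) := by
  refine closure_minimal (fun y hy => ?_) isClosed_closedBall
  by_contra h
  exact hy (cutoff_eq_zero hρ fun h' => h (ball_subset_closedBall h'))

theorem hasCompactSupport_cutoff (hρ : 0 < ρ) : HasCompactSupport (cutoff x₀ ρ) :=
  (isCompact_closedBall x₀ (3 / 2 * ρ)).of_isClosed_subset (isClosed_tsupport _)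
    (tsupport_cutoff_subset hρ)

theorem gradient_cutoff_eq_zero (hρ : 0 < ρ) {y : Euc n} (hy : y ∉ ball x₀ (2 * ρ)) :
    gradient (cutoff x₀ ρ) y = 0 := by
  have : fderiv ℝ (cutoff x₀ ρ) y = 0 := image_eq_zero_of_notMem_tsupport fun h => hy <|
    closedBall_subset_ball (by linarith) (tsupport_cutoff_subset hρ (tsupport_fderiv_subset ℝ h))
  rw [gradient, this, map_zero]

/-- The gradient of the cutoff function of a ball of radius `ρ` is of size `1/ρ`. -/
theorem exists_norm_gradient_cutoff_le (n : ℕ) : ∃ L : ℝ≥0, ∀ (x₀ : Euc n) {ρ : ℝ}, 0 < ρ →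
    ∀ y, ‖gradient (cutoff x₀ ρ) y‖ ≤ L / ρ := by
  obtain ⟨L, hL⟩ := (unitBump n).contDiff.lipschitzWith_of_hasCompactSupport
    (n := ∞) (unitBump n).hasCompactSupport (by simp)
  refine ⟨L, fun x₀ ρ hρ y => ?_⟩
  have h : LipschitzWith (L * ⟨ρ⁻¹, (inv_pos.2 hρ).le⟩) (cutoff x₀ ρ) := by
    refine hL.comp (LipschitzWith.of_dist_le_mul fun a b => ?_)
    rw [dist_smul₀, dist_sub_right, Real.norm_of_nonneg (inv_pos.2 hρ).le]
    rfl
  rw [norm_gradient, div_eq_mul_inv]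
  exact norm_fderiv_le_of_lipschitz ℝ h

/-- The localization of `u` to the ball `B(x₀, ρ)`: the mean value over the ball is subtracted and
the result is cut off. Its gradient is controlled by the gradient of `u` near the ball. -/
def localize (x₀ : Euc n) (ρ : ℝ) (u : Euc n → ℝ) (y : Euc n) : ℝ :=
  cutoff x₀ ρ y * (u y - ballAvg u x₀ ρ)

/-- The gradient of `localize x₀ ρ u`, where `g` is the gradient of `u`. -/
def localizeGrad (x₀ : Euc n) (ρ : ℝ) (u : Euc n → ℝ) (g : Euc n → Euc n) (y : Euc n) : Euc n :=
  cutoff x₀ ρ y • g y + (u y - ballAvg u x₀ ρ) • gradient (cutoff x₀ ρ) y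

theorem hasCompactSupport_localize (hρ : 0 < ρ) (u : Euc n → ℝ) :
    HasCompactSupport (localize x₀ ρ u) := (hasCompactSupport_cutoff hρ).mul_right

theorem localize_of_mem (hρ : 0 < ρ) (u : Euc n → ℝ) {y : Euc n} (hy : y ∈ ball x₀ ρ) :
    localize x₀ ρ u y = u y - ballAvg u x₀ ρ := by
  rw [localize, cutoff_eq_one hρ hy, one_mul]

theorem localize_eq_zero (hρ : 0 < ρ) (u : Euc n → ℝ) {y : Euc n}
    (hy : y ∉ ball x₀ (3 / 2 * ρ)) : localize x₀ ρ u y = 0 := by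
  rw [localize, cutoff_eq_zero hρ hy, zero_mul]

variable {u : Euc n → ℝ} {g : Euc n → Euc n}

/-- Localization to a ball does not see a previous localization to a larger ball. -/
theorem localize_localize (hu : LocallyIntegrable u) {x₁ : Euc n} {ρ₁ : ℝ} (hρ : 0 < ρ)
    (hρ₁ : 0 < ρ₁) (h : ball x₀ (3 / 2 * ρ) ⊆ ball x₁ ρ₁) :
    localize x₀ ρ (localize x₁ ρ₁ u) = localize x₀ ρ u := by
  have h0 : volume (ball x₀ ρ) ≠ 0 := (measure_ball_pos _ _ hρ).ne'
  have h1 : volume (ball x₀ ρ) ≠ ⊤ := measure_ball_lt_top.ne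
  have hsub : ball x₀ ρ ⊆ ball x₁ ρ₁ := (ball_subset_ball (by linarith)).trans h
  have hi : IntegrableOn u (ball x₀ ρ) :=
    (hu.integrableOn_isCompact (isCompact_closedBall x₀ ρ)).mono_set ball_subset_closedBall
  have havg : ballAvg (localize x₁ ρ₁ u) x₀ ρ = ballAvg u x₀ ρ - ballAvg u x₁ ρ₁ := by
    have e : ∫ y in ball x₀ ρ, localize x₁ ρ₁ u y = ∫ y in ball x₀ ρ, (u y - ballAvg u x₁ ρ₁) :=
      setIntegral_congr_fun measurableSet_ball fun y hy => localize_of_mem hρ₁ u (hsub hy)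
    have hpos : 0 < (volume : Measure (Euc n)).real (ball x₀ ρ) := ENNReal.toReal_pos h0 h1
    have d : ∀ w, ballAvg w x₀ ρ = (volume.real (ball x₀ ρ))⁻¹ * ∫ y in ball x₀ ρ, w y :=
      fun w => by rw [ballAvg, setAverage_eq, smul_eq_mul]
    rw [d, d, e, integral_sub hi (integrableOn_const h1), setIntegral_const, smul_eq_mul, mul_sub,
      ← mul_assoc _ _ (ballAvg u x₁ ρ₁), inv_mul_cancel₀ hpos.ne', one_mul]
  funext y
  by_cases hy : y ∈ ball x₀ (3 / 2 * ρ)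
  · rw [localize, havg, localize_of_mem hρ₁ u (h hy), localize]
    ring
  · rw [localize_eq_zero hρ _ hy, localize_eq_zero hρ _ hy]

/-- Localization preserves Sobolev functions, and the gradient is given by the product rule. -/
theorem SobolevPair.localize (h : SobolevPair u g) (hρ : 0 < ρ) :
    SobolevPair (localize x₀ ρ u) (localizeGrad x₀ ρ u g) := by
  obtain ⟨L, hL⟩ := exists_norm_gradient_cutoff_le n
  set c := ballAvg u x₀ ρ
  have hsm : ContDiff ℝ ∞ (cutoff x₀ ρ) := contDiff_cutoff
  have hcs := hasCompactSupport_cutoff (x₀ := x₀) hρ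
  have hgc : Continuous (gradient (cutoff x₀ ρ)) := hsm.continuous_gradient
  have hgs : HasCompactSupport (gradient (cutoff x₀ ρ)) :=
    (hcs.fderiv (𝕜 := ℝ)).comp_left (g := (InnerProductSpace.toDual ℝ (Euc n)).symm) (map_zero _)
  have m1 : MemLp (fun y => cutoff x₀ ρ y * u y) 2 := by
    refine h.memLp.mono (hsm.continuous.aestronglyMeasurable.mul h.memLp.1)
      (Eventually.of_forall fun y => ?_)
    rw [norm_mul, Real.norm_of_nonneg (cutoff_nonneg y)]
    exact mul_le_of_le_one_left (norm_nonneg _) (cutoff_le_one y)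
  have m2 : MemLp (fun y => c * cutoff x₀ ρ y) 2 :=
    (hsm.continuous.memLp_of_hasCompactSupport hcs).const_mul c
  have m3 : MemLp (fun y => cutoff x₀ ρ y • g y) 2 := by
    refine h.memLp_grad.mono (hsm.continuous.aestronglyMeasurable.smul h.memLp_grad.1)
      (Eventually.of_forall fun y => ?_)
    rw [norm_smul, Real.norm_of_nonneg (cutoff_nonneg y)]
    exact mul_le_of_le_one_left (norm_nonneg _) (cutoff_le_one y)
  have m4 : MemLp (fun y => u y • gradient (cutoff x₀ ρ) y) 2 := by
    refine h.memLp.of_le_mul (c := L / ρ) (h.memLp.1.smul hgc.aestronglyMeasurable)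
      (Eventually.of_forall fun y => ?_)
    rw [norm_smul, mul_comm]
    gcongr
    exact hL x₀ hρ y
  have m5 : MemLp (fun y => c • gradient (cutoff x₀ ρ) y) 2 :=
    (hgc.memLp_of_hasCompactSupport hgs).const_smul c
  have e1 : _root_.localize x₀ ρ u = fun y => cutoff x₀ ρ y * u y - c * cutoff x₀ ρ y := by
    funext y; simp only [_root_.localize]; ring
  have e2 : localizeGrad x₀ ρ u g = fun y =>
      cutoff x₀ ρ y • g y + u y • gradient (cutoff x₀ ρ) y - c • gradient (cutoff x₀ ρ) y := by
    funext y; simp only [localizeGrad]; rw [sub_smul, add_sub_assoc]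
  refine ⟨e1 ▸ m1.sub m2, e2 ▸ (m3.add m4).sub m5, ?_⟩
  have := (h.weak.sub (HasWeakGradient.const c)).smooth_mul hsm hcs
  refine this.congr (Eventually.of_forall fun y => rfl) (Eventually.of_forall fun y => ?_)
  simp [localizeGrad, c]

/-- By the Poincaré inequality the gradient of a localization is controlled by the gradient of the
function alone: in the term with the gradient of the cutoff, of size `1/ρ`, the mean value has been
subtracted. -/
theorem exists_lintegral_localizeGrad_le (n : ℕ) : ∃ L : ℝ≥0, ∀ {u : Euc n → ℝ}
    {g : Euc n → Euc n}, SobolevPair u g → ∀ (x₀ : Euc n) {ρ : ℝ}, 0 < ρ →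
      ∫⁻ y, ‖localizeGrad x₀ ρ u g y‖ₑ ≤ L * ∫⁻ y in ball x₀ (2 * ρ), ‖g y‖ₑ := by
  obtain ⟨L, hL⟩ := exists_norm_gradient_cutoff_le n
  refine ⟨1 + L * 4 ^ (n + 1), fun {u g} h x₀ ρ hρ => ?_⟩
  have hz : ∀ y ∉ ball x₀ (2 * ρ), ‖localizeGrad x₀ ρ u g y‖ₑ = 0 := by
    intro y hy
    rw [localizeGrad, gradient_cutoff_eq_zero hρ hy,
      cutoff_eq_zero hρ fun h' => hy (ball_subset_ball (by linarith) h')]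
    simp
  have hp := h.poincare x₀ hρ (by linarith : ρ ≤ 2 * ρ)
  have hgm := h.memLp_grad.1.enorm
  calc ∫⁻ y, ‖localizeGrad x₀ ρ u g y‖ₑ = ∫⁻ y in ball x₀ (2 * ρ), ‖localizeGrad x₀ ρ u g y‖ₑ :=
        (setLIntegral_eq_of_support_subset (fun y hy => by_contra fun h => hy (hz y h))).symm
    _ ≤ ∫⁻ y in ball x₀ (2 * ρ), (‖g y‖ₑ + ENNReal.ofReal (L / ρ) * ‖u y - ballAvg u x₀ ρ‖ₑ) := by
        refine lintegral_mono fun y => (enorm_add_le _ _).trans (add_le_add ?_ ?_)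
        · rw [enorm_smul, Real.enorm_of_nonneg (cutoff_nonneg y)]
          exact mul_le_of_le_one_left' (ENNReal.ofReal_le_one.2 (cutoff_le_one y))
        · rw [enorm_smul, mul_comm, ← ofReal_norm (gradient _ y)]
          gcongr
          exact hL x₀ hρ y
    _ = (∫⁻ y in ball x₀ (2 * ρ), ‖g y‖ₑ) +
          ENNReal.ofReal (L / ρ) * ∫⁻ y in ball x₀ (2 * ρ), ‖u y - ballAvg u x₀ ρ‖ₑ := by
        rw [lintegral_add_left' hgm.restrict, lintegral_const_mul' _ _ ENNReal.ofReal_ne_top]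
    _ ≤ (∫⁻ y in ball x₀ (2 * ρ), ‖g y‖ₑ) + ENNReal.ofReal (L / ρ) *
          (ENNReal.ofReal (2 * (2 * ρ) * (2 * (2 * ρ) / ρ) ^ n) *
            ∫⁻ y in ball x₀ (2 * ρ), ‖g y‖ₑ) := by gcongr
    _ = _ := by
        rw [← mul_assoc, ← ENNReal.ofReal_mul (by positivity)]
        have : (L : ℝ) / ρ * (2 * (2 * ρ) * (2 * (2 * ρ) / ρ) ^ n) = (L * 4 ^ (n + 1) : ℝ≥0) := by
          push_cast
          have : 2 * (2 * ρ) / ρ = 4 := by field_simp; norm_num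
          rw [this]
          field_simp
          ring
        rw [this, ENNReal.ofReal_coe_nnreal]
        push_cast
        ring

end Localization

/-! ### Oscillation of the gradient of a far part -/

section Oscillation

variable {n : ℕ} {v : Euc n → ℝ} {g : Euc n → Euc n} {x₀ : Euc n} {ρ N : ℝ}

/-- If the averages of `|∇v|` over all balls of radius at least `ρ` around `x₀` are bounded, then
the mean values of `v` over such balls grow at most linearly. -/
theorem SobolevPair.abs_ballAvg_sub_le (h : SobolevPair v g) (hρ : 0 < ρ) (hN : 0 ≤ N)
    (hg : ∀ r, ρ ≤ r → ∫⁻ y in ball x₀ r, ‖g y‖ₑ ≤ ENNReal.ofReal (N * r ^ n)) (j : ℕ) :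
    |ballAvg v x₀ (2 ^ j * ρ) - ballAvg v x₀ ρ| ≤
      2 ^ (2 * n + 2) / unitVol n * N * (2 ^ j * ρ) := by
  have hV := unitVol_pos (n := n)
  have step : ∀ j : ℕ, |ballAvg v x₀ (2 ^ (j + 1) * ρ) - ballAvg v x₀ (2 ^ j * ρ)| ≤
      2 ^ (2 * n + 2) / unitVol n * N * (2 ^ j * ρ) := by
    intro j
    set r := 2 ^ j * ρ with hr
    have hr0 : 0 < r := by positivity
    have e2 : (2 : ℝ) ^ (j + 1) * ρ = 2 * r := by rw [hr]; ring
    rw [e2]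
    have h1r : ρ ≤ 2 * r := by
      have : (1 : ℝ) ≤ 2 ^ j := one_le_pow₀ one_le_two
      nlinarith
    have h1 := enorm_sub_ballAvg_le h.weak.1 x₀ hr0 (ballAvg v x₀ (2 * r))
    have h2 := h.poincare x₀ (by positivity : 0 < 2 * r) le_rfl
    have h3 : ‖ballAvg v x₀ (2 * r) - ballAvg v x₀ r‖ₑ ≤
        ENNReal.ofReal (2 ^ (2 * n + 2) / unitVol n * N * r) := by
      calc _ ≤ (volume (ball x₀ r))⁻¹ * ∫⁻ y in ball x₀ (2 * r), ‖v y - ballAvg v x₀ (2 * r)‖ₑ := by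
            refine h1.trans (mul_le_mul_right ?_ _)
            refine (lintegral_mono_set (ball_subset_ball (by linarith : r ≤ 2 * r))).trans_eq ?_
            exact lintegral_congr fun z => enorm_sub_rev _ _
        _ ≤ (volume (ball x₀ r))⁻¹ * (ENNReal.ofReal (2 * (2 * r) * (2 * (2 * r) / (2 * r)) ^ n) *
              ENNReal.ofReal (N * (2 * r) ^ n)) := by
            gcongr
            exact h2.trans (mul_le_mul_right (hg _ h1r) _)
        _ = _ := by
            rw [volume_ball_eq x₀ hr0, ← ENNReal.ofReal_inv_of_pos (by positivity),
              ← ENNReal.ofReal_mul (by positivity), ← ENNReal.ofReal_mul (by positivity)]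
            congr 1
            rw [mul_div_cancel_right₀ _ (by positivity : 2 * r ≠ 0), mul_pow, pow_add, pow_mul']
            field_simp
            ring
    rw [Real.enorm_eq_ofReal_abs] at h3
    exact (ENNReal.ofReal_le_ofReal_iff (by positivity)).1 h3
  induction j with
  | zero =>
    simp only [pow_zero, one_mul, sub_self, abs_zero]
    positivity
  | succ j ih =>
    have := abs_sub_le (ballAvg v x₀ (2 ^ (j + 1) * ρ)) (ballAvg v x₀ (2 ^ j * ρ)) (ballAvg v x₀ ρ)
    have h2 := step j
    rw [pow_succ (2 : ℝ) j, mul_comm ((2 : ℝ) ^ j) 2, mul_assoc 2] at this h2 ⊢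
    linarith

/-- The linear growth of the mean values gives the growth of the integrals of `|v - c|`, where `c`
is the mean value over the smallest ball. The power `n + 1` is just below the decay `n + 2` of the
second derivatives of the kernel. -/
theorem SobolevPair.lintegral_sub_ballAvg_le (h : SobolevPair v g) (hρ : 0 < ρ) (hN : 0 ≤ N)
    (hg : ∀ r, ρ ≤ r → ∫⁻ y in ball x₀ r, ‖g y‖ₑ ≤ ENNReal.ofReal (N * r ^ n)) (j : ℕ) :
    ∫⁻ y in ball x₀ (2 ^ j * ρ), ‖v y - ballAvg v x₀ ρ‖ₑ ≤
      ENNReal.ofReal (2 ^ (2 * n + 3) * N * (2 ^ j * ρ) ^ (n + 1)) := by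
  have hV := unitVol_pos (n := n)
  have h0 := h.abs_ballAvg_sub_le hρ hN hg j
  set r := 2 ^ j * ρ with hr
  have hr0 : 0 < r := by positivity
  have h1r : ρ ≤ r := by
    have : (1 : ℝ) ≤ 2 ^ j := one_le_pow₀ one_le_two
    nlinarith
  have h2 := h.poincare x₀ hr0 le_rfl
  have hm : AEMeasurable (fun y => ‖v y - ballAvg v x₀ r‖ₑ) (volume.restrict (ball x₀ r)) :=
    (h.memLp.1.sub aestronglyMeasurable_const).enorm.restrict
  calc _ ≤ ∫⁻ y in ball x₀ r, (‖v y - ballAvg v x₀ r‖ₑ + ‖ballAvg v x₀ r - ballAvg v x₀ ρ‖ₑ) := by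
        refine lintegral_mono fun y => ?_
        rw [← sub_add_sub_cancel (v y) (ballAvg v x₀ r)]
        exact enorm_add_le _ _
    _ = (∫⁻ y in ball x₀ r, ‖v y - ballAvg v x₀ r‖ₑ) +
          ‖ballAvg v x₀ r - ballAvg v x₀ ρ‖ₑ * volume (ball x₀ r) := by
        rw [lintegral_add_left' hm, setLIntegral_const]
    _ ≤ ENNReal.ofReal (2 * r * (2 * r / r) ^ n) * ENNReal.ofReal (N * r ^ n) +
          ENNReal.ofReal (2 ^ (2 * n + 2) / unitVol n * N * r) *
            ENNReal.ofReal (r ^ n * unitVol n) := by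
        rw [volume_ball_eq x₀ hr0]
        gcongr
        · exact h2.trans (mul_le_mul_right (hg _ h1r) _)
        · rw [Real.enorm_eq_ofReal_abs]
          exact ENNReal.ofReal_le_ofReal h0
    _ ≤ _ := by
        rw [← ENNReal.ofReal_mul (by positivity), ← ENNReal.ofReal_mul (by positivity),
          ← ENNReal.ofReal_add (by positivity) (by positivity)]
        refine ENNReal.ofReal_le_ofReal ?_
        rw [mul_div_cancel_right₀ _ hr0.ne']
        have e1 : 2 * r * 2 ^ n * (N * r ^ n) = 2 ^ (n + 1) * (N * r ^ (n + 1)) := by ring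
        have e2 : 2 ^ (2 * n + 2) / unitVol n * N * r * (r ^ n * unitVol n) =
            2 ^ (2 * n + 2) * (N * r ^ (n + 1)) := by
          field_simp
          ring
        have e3 : (2 : ℝ) ^ (2 * n + 3) * N * r ^ (n + 1) =
            2 ^ (2 * n + 2) * (N * r ^ (n + 1)) + 2 ^ (2 * n + 2) * (N * r ^ (n + 1)) := by ring
        rw [e1, e2, e3]
        have e4 : (2 : ℝ) ^ (n + 1) ≤ 2 ^ (2 * n + 2) := pow_le_pow_right₀ one_le_two (by omega)
        exact add_le_add (mul_le_mul_of_nonneg_right e4 (by positivity)) le_rfl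

theorem HasCompactSupport.integrable_of_memLp_two {F : Euc n → ℝ} (hF : HasCompactSupport F)
    (hF' : MemLp F 2) : Integrable F := by
  rw [← integrableOn_iff_integrable_of_support_subset (subset_tsupport F)]
  exact (hF'.locallyIntegrable (by norm_num)).integrableOn_isCompact hF

variable {K : Euc n → Euc n → ℝ} {T : L2 n →L[ℝ] L2 n} {C : ℝ}

/-- The integral that represents the gradient of `T F` converges absolutely at a point near which
`F` is equal to `c`. -/
theorem KernelBound.integrable_kernelDeriv_mul (hn : 1 ≤ n) (hK : KernelBound K C)
    {F : Euc n → ℝ} (hF : Integrable F) {c : ℝ} {x : Euc n} {s : ℝ} (hs : 0 < s)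
    (hFc : ∀ y ∈ ball x s, F y = c) (e : Euc n) :
    Integrable fun y => kernelDeriv K e x y * (F y - c) := by
  have hC := hK.1
  refine ⟨(aestronglyMeasurable_right hn (hK.continuousOn_kernelDeriv e) x).mul
    (hF.1.sub aestronglyMeasurable_const), ?_⟩
  have hpt : ∀ y, ‖kernelDeriv K e x y * (F y - c)‖ₑ ≤ (ball x s)ᶜ.indicator (fun y =>
      ENNReal.ofReal (C * ‖e‖) * ((ENNReal.ofReal (1 / s ^ (n + 1)) * ‖F y‖ₑ) +
        ‖c‖ₑ * ENNReal.ofReal (1 / ‖y - x‖ ^ (n + 1)))) y := by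
    intro y
    by_cases hy : y ∈ ball x s
    · simp [hFc y hy]
    have hy' : s ≤ ‖y - x‖ := by simpa [dist_eq_norm] using hy
    have hne : x ≠ y := by rintro rfl; exact hy (mem_ball_self hs)
    rw [indicator_of_mem hy, enorm_mul, Real.enorm_eq_ofReal_abs (kernelDeriv _ _ _ _)]
    have h1 := hK.abs_kernelDeriv_le hne e
    rw [← mul_one_div, norm_sub_rev] at h1
    calc _ ≤ ENNReal.ofReal (C * ‖e‖ * (1 / ‖y - x‖ ^ (n + 1))) * (‖F y‖ₑ + ‖c‖ₑ) := by
          gcongr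
          exact enorm_sub_le
      _ = ENNReal.ofReal (C * ‖e‖) * (ENNReal.ofReal (1 / ‖y - x‖ ^ (n + 1)) * ‖F y‖ₑ +
            ‖c‖ₑ * ENNReal.ofReal (1 / ‖y - x‖ ^ (n + 1))) := by
          rw [ENNReal.ofReal_mul (by positivity)]; ring
      _ ≤ _ := by gcongr
  have hfin : ∫⁻ y, ‖F y‖ₑ ≠ ⊤ := hF.2.ne
  refine ((lintegral_mono hpt).trans_lt ?_)
  rw [lintegral_indicator measurableSet_ball.compl, lintegral_const_mul' _ _ ENNReal.ofReal_ne_top,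
    lintegral_add_left' (hF.1.enorm.restrict.const_mul _),
    lintegral_const_mul' _ _ ENNReal.ofReal_ne_top, lintegral_const_mul' _ _ enorm_ne_top]
  refine ENNReal.mul_lt_top ENNReal.ofReal_lt_top (ENNReal.add_lt_top.2 ⟨?_, ?_⟩)
  · exact ENNReal.mul_lt_top ENNReal.ofReal_lt_top
      ((setLIntegral_le_lintegral _ _).trans_lt hF.2)
  · exact ENNReal.mul_lt_top (by simp)
      ((lintegral_compl_ball_le x hs).trans_lt ENNReal.ofReal_lt_top)

/-- The part of `v` outside `B(x₀, ρ)` contributes to the gradient of `T v` on `B(x₀, ρ/2)` a field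
of small oscillation: the second derivatives of the kernel gain a power of the distance. -/
theorem IsTGradient.exists_osc_le (hn : 1 ≤ n) (hK : KernelBound K C) (hT : IsCZOperator T K)
    (hT1 : TOneEqZero T K) (h : SobolevPair v g) (hvc : HasCompactSupport v) (hρ : 0 < ρ)
    (hN : 0 ≤ N)
    (hg : ∀ r, ρ ≤ r → ∫⁻ y in ball x₀ r, ‖g y‖ₑ ≤ ENNReal.ofReal (N * r ^ n))
    {k : Euc n → Euc n} (hk : IsTGradient T (v - localize x₀ ρ v) k) :
    ∃ w : Euc n, ∀ᵐ x, x ∈ ball x₀ (ρ / 2) →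
      ‖k x - w‖ₑ ≤ ENNReal.ofReal (n * C * 2 ^ (4 * n + 7) * N) := by
  have hC := hK.1
  set W := v - localize x₀ ρ v with hW
  set c := ballAvg v x₀ ρ with hc
  have hWc : HasCompactSupport W := hvc.sub (hasCompactSupport_localize hρ v)
  have hWi : Integrable W := hWc.integrable_of_memLp_two hk.1
  have hWU : ∀ y ∈ ball x₀ ρ, W y = c := by
    intro y hy
    rw [hW, Pi.sub_apply, localize_of_mem hρ v hy]
    ring
  have hWle : ∀ y, ‖W y - c‖ₑ ≤ ‖v y - c‖ₑ := by
    intro y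
    have e : W y - c = (1 - cutoff x₀ ρ y) * (v y - c) := by
      rw [hW, Pi.sub_apply, localize]; ring
    rw [e, enorm_mul]
    refine mul_le_of_le_one_left' ?_
    rw [Real.enorm_of_nonneg (by linarith [cutoff_le_one (x₀ := x₀) (ρ := ρ) y])]
    exact ENNReal.ofReal_le_one.2 (by linarith [cutoff_nonneg (x₀ := x₀) (ρ := ρ) y])
  have hrep := ae_all_iff.2 fun i : Fin n =>
    hk.inner_eq_integral hn hK hT hT1 hWc isOpen_ball hWU (EuclideanSpace.single i 1)
  have hsum : ∫⁻ y in (ball x₀ ρ)ᶜ, ‖v y - c‖ₑ * ENNReal.ofReal (1 / ‖y - x₀‖ ^ (n + 2)) ≤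
      ENNReal.ofReal (2 * (2 ^ (3 * n + 4) * N / ρ)) := by
    refine (lintegral_compl_ball_mul_le x₀ hρ (n + 2)
      (h.memLp.1.sub aestronglyMeasurable_const).enorm).trans ?_
    rw [← tsum_ofReal_mul_half_pow (by positivity)]
    refine ENNReal.tsum_le_tsum fun j => ?_
    calc _ ≤ ENNReal.ofReal (1 / (2 ^ j * ρ) ^ (n + 2)) *
          ENNReal.ofReal (2 ^ (2 * n + 3) * N * (2 ^ (j + 1) * ρ) ^ (n + 1)) := by
          gcongr
          exact h.lintegral_sub_ballAvg_le hρ hN hg (j + 1)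
      _ = _ := by
          rw [← ENNReal.ofReal_mul (by positivity)]
          congr 1
          have e1 : (2 : ℝ) ^ (j + 1) * ρ = 2 * (2 ^ j * ρ) := by ring
          rw [e1, mul_pow 2, one_div_pow]
          have e2 : (2 : ℝ) ^ j * ρ = ρ * 2 ^ j := by ring
          have e3 : (2 : ℝ) ^ (3 * n + 4) = 2 ^ (2 * n + 3) * 2 ^ (n + 1) := by
            rw [← pow_add]; congr 1; ring
          rw [e3, pow_succ (2 ^ j * ρ) (n + 1)]
          have hj : (0 : ℝ) < 2 ^ j := by positivity
          generalize (2 : ℝ) ^ j = a at hj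
          field_simp
  refine ⟨∑ i, (∫ y, kernelDeriv K (EuclideanSpace.single i 1) x₀ y * (W y - c)) •
    EuclideanSpace.single i (1 : ℝ), ?_⟩
  filter_upwards [hrep] with x hx hxU
  have hxρ : x ∈ ball x₀ ρ := ball_subset_ball (by linarith) hxU
  have hxs : ball x (ρ / 2) ⊆ ball x₀ ρ := by
    refine ball_subset_ball' ?_
    have := mem_ball.1 hxU
    linarith
  have e : ENNReal.ofReal (n * C * 2 ^ (4 * n + 7) * N) =
      n * ENNReal.ofReal (C * 2 ^ (4 * n + 7) * N) := by
    rw [← ENNReal.ofReal_natCast n, ← ENNReal.ofReal_mul (Nat.cast_nonneg n)]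
    congr 1
    ring
  rw [e]
  refine enorm_le_of_inner_single fun i => ?_
  have hw : inner ℝ (∑ j, (∫ y, kernelDeriv K (EuclideanSpace.single j 1) x₀ y * (W y - c)) •
      EuclideanSpace.single j (1 : ℝ)) (EuclideanSpace.single i (1 : ℝ)) =
      ∫ y, kernelDeriv K (EuclideanSpace.single i 1) x₀ y * (W y - c) := by
    rw [EuclideanSpace.inner_single_right]
    simp [Finset.sum_apply, Pi.single_apply]
  rw [inner_sub_left, hx i hxρ, hw, ← integral_sub
    (hK.integrable_kernelDeriv_mul hn hWi (half_pos hρ) (fun y hy => hWU y (hxs hy)) _)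
    (hK.integrable_kernelDeriv_mul hn hWi hρ hWU _)]
  refine (enorm_integral_le_lintegral_enorm _).trans ?_
  calc _ ≤ ∫⁻ y, (ball x₀ ρ)ᶜ.indicator (fun y => ENNReal.ofReal (C * 2 ^ (n + 2) * ρ) *
        (‖v y - c‖ₑ * ENNReal.ofReal (1 / ‖y - x₀‖ ^ (n + 2)))) y := by
        refine lintegral_mono fun y => ?_
        by_cases hy : y ∈ ball x₀ ρ
        · simp [hWU y hy]
        have hy' : ρ ≤ ‖y - x₀‖ := by simpa [dist_eq_norm] using hy
        rw [indicator_of_mem hy, ← sub_mul, enorm_mul, Real.enorm_eq_ofReal_abs (_ - _),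
          mul_left_comm, ← ENNReal.ofReal_mul (by positivity), mul_comm]
        have h1 := hK.abs_kernelDeriv_sub_le hρ hxU hy' (EuclideanSpace.single i 1)
        rw [PiLp.norm_single, norm_one, mul_one, ← mul_one_div] at h1
        exact mul_le_mul' (hWle y) (ENNReal.ofReal_le_ofReal h1)
    _ ≤ ENNReal.ofReal (C * 2 ^ (n + 2) * ρ) * ENNReal.ofReal (2 * (2 ^ (3 * n + 4) * N / ρ)) := by
        rw [lintegral_indicator measurableSet_ball.compl,
          lintegral_const_mul' _ _ ENNReal.ofReal_ne_top]
        gcongr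
    _ = _ := by
        rw [← ENNReal.ofReal_mul (by positivity)]
        congr 1
        have : (2 : ℝ) ^ (4 * n + 7) = 2 ^ (n + 2) * (2 * 2 ^ (3 * n + 4)) := by
          rw [← pow_succ', ← pow_add]; congr 1; ring
        rw [this]
        field_simp

end Oscillation

/-! ### Convergence of localizations to large balls -/

section Exhaustion

variable {n : ℕ}

theorem tendsto_eLpNorm_indicator_compl_ball {g : Euc n → Euc n} (hg : MemLp g 2) :
    Tendsto (fun k : ℕ => eLpNorm ((ball (0 : Euc n) k)ᶜ.indicator g) 2 volume) atTop (𝓝 0) := by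
  have hsq : Tendsto (fun k : ℕ => ∫⁻ x, ‖(ball (0 : Euc n) k)ᶜ.indicator g x‖ₑ ^ 2) atTop
      (𝓝 (∫⁻ _ : Euc n, 0)) := by
    refine tendsto_lintegral_of_dominated_convergence' (fun x => ‖g x‖ₑ ^ 2) (fun k => ?_)
      (fun k => Eventually.of_forall fun x => ?_) ?_ (Eventually.of_forall fun x => ?_)
    · exact (hg.1.indicator measurableSet_ball.compl).enorm.pow_const 2
    · dsimp only
      gcongr
      exact enorm_indicator_le_enorm_self _ _
    · rw [← eLpNorm_two_sq]
      exact ENNReal.pow_ne_top hg.2.ne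
    · obtain ⟨k₀, hk₀⟩ := exists_nat_gt ‖x‖
      refine tendsto_const_nhds.congr' ?_
      filter_upwards [eventually_ge_atTop k₀] with k hk
      have : x ∉ (ball (0 : Euc n) k)ᶜ := by
        have h2 : (k₀ : ℝ) ≤ k := by exact_mod_cast hk
        simpa using hk₀.trans_le h2
      rw [indicator_of_notMem this]
      simp
  rw [lintegral_zero] at hsq
  have h2 := hsq.ennrpow_const (1 / 2 : ℝ)
  rw [ENNReal.zero_rpow_of_pos (by norm_num)] at h2
  refine h2.congr fun k => ?_
  rw [← eLpNorm_two_sq, ← ENNReal.rpow_natCast, ← ENNReal.rpow_mul]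
  norm_num

/-- The localizations of `f` to large balls around the origin approximate `f` in the energy norm. -/
theorem exists_eLpNorm_sub_localizeGrad_le (n : ℕ) : ∃ L : ℝ≥0, ∀ {f : Euc n → ℝ}
    {g : Euc n → Euc n}, SobolevPair f g → ∀ {x₀ : Euc n} {ρ R : ℝ}, 0 < ρ →
      ball 0 R ⊆ ball x₀ ρ → eLpNorm (g - localizeGrad x₀ ρ f g) 2 volume ≤
        eLpNorm ((ball (0 : Euc n) R)ᶜ.indicator g) 2 volume +
          ENNReal.ofReal (L / ρ) * eLpNorm f 2 volume := by
  obtain ⟨L, hL⟩ := exists_norm_gradient_cutoff_le n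
  refine ⟨L * (1 + 2 ^ n), fun {f g} h {x₀ ρ R} hρ hR => ?_⟩
  have hV := unitVol_pos (n := n)
  set c := ballAvg f x₀ ρ with hc
  set B := ball x₀ (2 * ρ) with hB
  have hvol0 : volume (ball x₀ ρ) ≠ 0 := (measure_ball_pos _ _ hρ).ne'
  have hvolt : volume (ball x₀ ρ) ≠ ⊤ := measure_ball_lt_top.ne
  have hcv : ‖c‖ₑ * volume (ball x₀ ρ) ^ (1 / 2 : ℝ) ≤ eLpNorm f 2 volume := by
    have h1 := enorm_sub_ballAvg_le h.weak.1 x₀ hρ 0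
    simp only [zero_sub, enorm_neg] at h1
    have h2 := setLIntegral_enorm_le_eLpNorm_two h.memLp.1 (ball x₀ ρ)
    have h3 : ‖c‖ₑ ≤ (volume (ball x₀ ρ))⁻¹ * (eLpNorm f 2 volume *
        volume (ball x₀ ρ) ^ (1 / 2 : ℝ)) := h1.trans (by gcongr)
    calc _ ≤ (volume (ball x₀ ρ))⁻¹ * (eLpNorm f 2 volume *
          volume (ball x₀ ρ) ^ (1 / 2 : ℝ)) * volume (ball x₀ ρ) ^ (1 / 2 : ℝ) := by gcongr
      _ = (volume (ball x₀ ρ))⁻¹ * eLpNorm f 2 volume *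
          (volume (ball x₀ ρ) ^ (1 / 2 : ℝ) * volume (ball x₀ ρ) ^ (1 / 2 : ℝ)) := by ring
      _ = _ := by
          rw [← ENNReal.rpow_add _ _ hvol0 hvolt, mul_right_comm]
          norm_num
          rw [ENNReal.inv_mul_cancel hvol0 hvolt, one_mul]
  have hvolB : volume B ^ (1 / 2 : ℝ) ≤ 2 ^ n * volume (ball x₀ ρ) ^ (1 / 2 : ℝ) := by
    have e : volume B = 2 ^ n * volume (ball x₀ ρ) := by
      rw [hB, volume_ball_eq _ hρ, volume_ball_eq _ (by positivity), mul_pow, mul_assoc,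
        ENNReal.ofReal_mul (by positivity), ENNReal.ofReal_pow (by norm_num)]
      norm_num
    rw [e, ENNReal.mul_rpow_of_nonneg _ _ (by norm_num)]
    gcongr
    calc ((2 : ℝ≥0∞) ^ n) ^ (1 / 2 : ℝ) ≤ (2 ^ n) ^ (1 : ℝ) :=
          ENNReal.rpow_le_rpow_of_exponent_le (one_le_pow₀ one_le_two) (by norm_num)
      _ = _ := ENNReal.rpow_one _
  have hpt : ∀ x, ‖(g - localizeGrad x₀ ρ f g) x‖ ≤
      ‖(‖(ball (0 : Euc n) R)ᶜ.indicator g x‖ + L / ρ * ‖f x‖) +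
        B.indicator (fun _ => L / ρ * |c|) x‖ := by
    intro x
    have e : (g - localizeGrad x₀ ρ f g) x =
        (1 - cutoff x₀ ρ x) • g x - f x • gradient (cutoff x₀ ρ) x +
          c • gradient (cutoff x₀ ρ) x := by
      simp only [Pi.sub_apply, localizeGrad, ← hc]
      module
    have b1 : ‖(1 - cutoff x₀ ρ x) • g x‖ ≤ ‖(ball (0 : Euc n) R)ᶜ.indicator g x‖ := by
      by_cases hx : x ∈ ball (0 : Euc n) R
      · rw [cutoff_eq_one hρ (hR hx), sub_self, zero_smul, norm_zero]
        exact norm_nonneg _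
      · rw [indicator_of_mem hx, norm_smul,
          Real.norm_of_nonneg (by linarith [cutoff_le_one (x₀ := x₀) (ρ := ρ) x])]
        exact mul_le_of_le_one_left (norm_nonneg _)
          (by linarith [cutoff_nonneg (x₀ := x₀) (ρ := ρ) x])
    have b2 : ‖f x • gradient (cutoff x₀ ρ) x‖ ≤ L / ρ * ‖f x‖ := by
      rw [norm_smul, mul_comm]
      gcongr
      exact hL x₀ hρ x
    have b3 : ‖c • gradient (cutoff x₀ ρ) x‖ ≤ B.indicator (fun _ => L / ρ * |c|) x := by
      by_cases hx : x ∈ B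
      · rw [indicator_of_mem hx, norm_smul, mul_comm, Real.norm_eq_abs]
        gcongr
        exact hL x₀ hρ x
      · rw [indicator_of_notMem hx, gradient_cutoff_eq_zero hρ hx, smul_zero, norm_zero]
    rw [e]
    refine le_trans ?_ (le_abs_self _)
    exact (norm_add_le _ _).trans (add_le_add ((norm_sub_le _ _).trans (add_le_add b1 b2)) b3)
  have m1 : AEStronglyMeasurable (fun x => ‖(ball (0 : Euc n) R)ᶜ.indicator g x‖) volume :=
    (h.memLp_grad.1.indicator measurableSet_ball.compl).norm
  have m2 : AEStronglyMeasurable (fun x => (L : ℝ) / ρ * ‖f x‖) volume :=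
    h.memLp.1.norm.const_mul _
  have m3 : AEStronglyMeasurable (B.indicator (fun _ => (L : ℝ) / ρ * |c|)) volume :=
    aestronglyMeasurable_const.indicator measurableSet_ball
  have e2 : eLpNorm (fun x => (L : ℝ) / ρ * ‖f x‖) 2 volume =
      ENNReal.ofReal (L / ρ) * eLpNorm f 2 volume := by
    rw [← eLpNorm_norm f]
    have := eLpNorm_const_smul ((L : ℝ) / ρ) (fun x => ‖f x‖) 2 (volume : Measure (Euc n))
    rw [Real.enorm_of_nonneg (by positivity)] at this
    exact this
  have e3 : eLpNorm (B.indicator (fun _ => (L : ℝ) / ρ * |c|)) 2 volume ≤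
      ENNReal.ofReal (L / ρ) * (2 ^ n * eLpNorm f 2 volume) := by
    rw [eLpNorm_indicator_const measurableSet_ball (by norm_num) (by norm_num), enorm_mul,
      Real.enorm_of_nonneg (by positivity), Real.enorm_abs, mul_assoc, ENNReal.toReal_ofNat]
    refine mul_le_mul_right ?_ _
    calc _ ≤ ‖c‖ₑ * (2 ^ n * volume (ball x₀ ρ) ^ (1 / 2 : ℝ)) := mul_le_mul_right hvolB _
      _ = 2 ^ n * (‖c‖ₑ * volume (ball x₀ ρ) ^ (1 / 2 : ℝ)) := by ring
      _ ≤ _ := mul_le_mul_right hcv _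
  calc _ ≤ eLpNorm _ 2 volume := eLpNorm_mono hpt
    _ ≤ eLpNorm _ 2 volume + eLpNorm _ 2 volume + eLpNorm _ 2 volume :=
        (eLpNorm_add_le (m1.add m2) m3 (by norm_num)).trans
          (add_le_add (eLpNorm_add_le m1 m2 (by norm_num)) le_rfl)
    _ ≤ eLpNorm ((ball (0 : Euc n) R)ᶜ.indicator g) 2 volume +
          ENNReal.ofReal (L / ρ) * eLpNorm f 2 volume +
          ENNReal.ofReal (L / ρ) * (2 ^ n * eLpNorm f 2 volume) := by
        rw [e2, eLpNorm_norm]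
        gcongr
    _ = _ := by
        have : ((L * (1 + 2 ^ n) : ℝ≥0) : ℝ) / ρ = L / ρ * (1 + 2 ^ n) := by push_cast; ring
        rw [this, ENNReal.ofReal_mul (by positivity),
          ENNReal.ofReal_add zero_le_one (by positivity), ENNReal.ofReal_pow (by norm_num)]
        norm_num
        ring

end Exhaustion

/-! ### The half-open dyadic grid with all shifts equal to `1/3` -/

section Grid

variable {n : ℕ}

/-- Indices `(k, m)` of dyadic cubes of side length `2⁻ᵏ`. -/
abbrev GridIndex (n : ℕ) : Type := ℤ × (Fin n → ℤ)

/-- The position `m` of the cube of side length `2⁻ᵏ` that contains `x`. -/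
def gridPos (k : ℤ) (x : Euc n) (i : Fin n) : ℤ := ⌊(2 : ℝ) ^ k * x i - (-1) ^ k / 3⌋

/-- The half-open cube `2⁻ᵏ([0,1)ⁿ + m + (-1)ᵏ/3)`, for `q = (k, m)`. Unlike for the unshifted grid,
every bounded set is contained in one of these cubes. -/
def gridCube (q : GridIndex n) : Set (Euc n) := {x | gridPos q.1 x = q.2}

/-- The index of the cube of side length `2⁻ᵏ` that contains `x`. -/
def gridAt (k : ℤ) (x : Euc n) : GridIndex n := (k, gridPos k x)

theorem mem_gridCube {q : GridIndex n} {x : Euc n} : x ∈ gridCube q ↔ gridPos q.1 x = q.2 := Iff.rfl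

theorem mem_gridCube_gridAt (k : ℤ) (x : Euc n) : x ∈ gridCube (gridAt k x) := rfl

theorem gridAt_eq {q : GridIndex n} {x : Euc n} (hx : x ∈ gridCube q) : gridAt q.1 x = q :=
  Prod.ext rfl hx

/-- The signs of the shifts of two consecutive levels are integers `±1` and opposite to each other.
-/
theorem exists_int_eq_neg_one_zpow (k : ℤ) :
    ∃ s : ℤ, (s : ℝ) = (-1) ^ k ∧ ((-1 : ℝ) ^ (k + 1)) = -s ∧ (s = 1 ∨ s = -1) := by
  rcases Int.even_or_odd k with h | h
  · exact ⟨1, by simp [h.neg_one_zpow], by simp [h.add_one.neg_one_zpow], Or.inl rfl⟩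
  · exact ⟨-1, by simp [h.neg_one_zpow], by simp [h.add_one.neg_one_zpow], Or.inr rfl⟩

/-- The grids of consecutive levels are nested. -/
theorem gridPos_eq_of_succ {k : ℤ} {x y : Euc n} (h : gridPos (k + 1) x = gridPos (k + 1) y) :
    gridPos k x = gridPos k y := by
  obtain ⟨s, hs, hs', -⟩ := exists_int_eq_neg_one_zpow k
  have key : ∀ z : Euc n, ∀ i, gridPos k z i = (gridPos (k + 1) z i - s) / 2 := by
    intro z i
    have e : (2 : ℝ) ^ k * z i - (-1) ^ k / 3 =
        (((2 : ℝ) ^ (k + 1) * z i - (-1) ^ (k + 1) / 3) - s) / (2 : ℕ) := by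
      rw [hs', ← hs, zpow_add_one₀ (by norm_num)]
      push_cast
      ring
    simp only [gridPos]
    rw [e, Int.floor_div_natCast, Int.floor_sub_intCast]
    rfl
  funext i
  rw [key, key, h]

theorem gridPos_eq_of_le {j k : ℤ} (hjk : j ≤ k) {x y : Euc n} (h : gridPos k x = gridPos k y) :
    gridPos j x = gridPos j y := by
  obtain ⟨d, rfl⟩ := Int.le.dest hjk
  induction d with
  | zero => simpa using h
  | succ d ih =>
    refine ih (by omega) (gridPos_eq_of_succ ?_)
    push_cast at h
    rwa [add_assoc]

theorem gridCube_subset {q p : GridIndex n} (hqp : q.1 ≤ p.1) {x : Euc n} (hxq : x ∈ gridCube q)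
    (hxp : x ∈ gridCube p) : gridCube p ⊆ gridCube q := by
  intro y hy
  rw [mem_gridCube, ← mem_gridCube.1 hxq]
  exact gridPos_eq_of_le hqp ((mem_gridCube.1 hy).trans (mem_gridCube.1 hxp).symm)

theorem gridIndex_eq {q p : GridIndex n} (hqp : q.1 = p.1) {x : Euc n} (hxq : x ∈ gridCube q)
    (hxp : x ∈ gridCube p) : q = p := by
  rw [← gridAt_eq hxq, ← gridAt_eq hxp, hqp]

/-- The lower corner of a cube. -/
def corner (q : GridIndex n) : Euc n :=
  WithLp.toLp 2 fun i => (2 : ℝ) ^ (-q.1) * (q.2 i + (-1) ^ q.1 / 3)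

theorem corner_apply (q : GridIndex n) (i : Fin n) :
    corner q i = (2 : ℝ) ^ (-q.1) * (q.2 i + (-1) ^ q.1 / 3) := rfl

theorem mem_gridCube_iff {q : GridIndex n} {x : Euc n} :
    x ∈ gridCube q ↔ ∀ i, x i ∈ Ico (corner q i) (corner q i + (2 : ℝ) ^ (-q.1)) := by
  rw [mem_gridCube, funext_iff]
  refine forall_congr' fun i => ?_
  have h2 : (0 : ℝ) < 2 ^ q.1 := by positivity
  rw [gridPos, Int.floor_eq_iff, mem_Ico, corner_apply, zpow_neg]
  have e1 : ((2 : ℝ) ^ q.1)⁻¹ * (q.2 i + (-1) ^ q.1 / 3) ≤ x i ↔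
      (q.2 i : ℝ) + (-1) ^ q.1 / 3 ≤ 2 ^ q.1 * x i := by
    rw [inv_mul_le_iff₀ h2]
  have e2 : x i < ((2 : ℝ) ^ q.1)⁻¹ * (q.2 i + (-1) ^ q.1 / 3) + (2 ^ q.1)⁻¹ ↔
      2 ^ q.1 * x i < (q.2 i : ℝ) + (-1) ^ q.1 / 3 + 1 := by
    rw [← mul_add_one, lt_inv_mul_iff₀ h2]
  rw [e1, e2, le_sub_iff_add_le]
  constructor <;> rintro ⟨h, h'⟩ <;> exact ⟨h, by linarith⟩

theorem corner_mem_gridCube (q : GridIndex n) : corner q ∈ gridCube q :=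
  mem_gridCube_iff.2 fun i => ⟨le_rfl, by have : (0 : ℝ) < 2 ^ (-q.1) := by positivity
                                          linarith⟩

theorem gridCube_eq_preimage (q : GridIndex n) :
    gridCube q = WithLp.ofLp ⁻¹' (univ.pi fun i => Ico (corner q i) (corner q i + 2 ^ (-q.1))) := by
  ext x
  simp [mem_gridCube_iff]

theorem measurableSet_gridCube (q : GridIndex n) : MeasurableSet (gridCube q) := by
  rw [gridCube_eq_preimage]
  exact (MeasurableSet.univ_pi fun i => measurableSet_Ico).preimage
    (PiLp.volume_preserving_ofLp (Fin n)).measurable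

theorem volume_gridCube (q : GridIndex n) :
    volume (gridCube q) = ENNReal.ofReal ((2 ^ (-q.1)) ^ n) := by
  rw [gridCube_eq_preimage, (PiLp.volume_preserving_ofLp (Fin n)).measure_preimage
    (MeasurableSet.univ_pi fun i => measurableSet_Ico).nullMeasurableSet, Real.volume_pi_Ico]
  simp only [add_sub_cancel_left]
  rw [Finset.prod_const, Finset.card_univ, Fintype.card_fin, ENNReal.ofReal_pow (by positivity)]

theorem volume_gridCube_ne_zero (q : GridIndex n) : volume (gridCube q) ≠ 0 := by
  rw [volume_gridCube, ENNReal.ofReal_ne_zero_iff]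
  positivity

theorem volume_gridCube_ne_top (q : GridIndex n) : volume (gridCube q) ≠ ⊤ := by
  rw [volume_gridCube]
  exact ENNReal.ofReal_ne_top

theorem volume_gridCube_eq_of_succ {q p : GridIndex n} (h : p.1 = q.1 + 1) :
    volume (gridCube q) = 2 ^ n * volume (gridCube p) := by
  rw [volume_gridCube, volume_gridCube, h, ← ENNReal.ofReal_ofNat 2, ← ENNReal.ofReal_pow (by simp),
    ← ENNReal.ofReal_mul (by positivity), ← mul_pow]
  congr 2
  rw [neg_add, zpow_add₀ (by norm_num), mul_left_comm]
  norm_num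

theorem norm_le_mul_of_abs_le {z : Euc n} {b : ℝ} (hz : ∀ i, |z i| ≤ b) : ‖z‖ ≤ n * b := by
  refine (norm_le_sum_abs_inner z).trans ?_
  calc _ ≤ ∑ _i : Fin n, b := Finset.sum_le_sum fun i _ => by
        rw [EuclideanSpace.inner_single_right]
        simpa using hz i
    _ = n * b := by simp

theorem norm_sub_le_of_mem_gridCube {q : GridIndex n} {x y : Euc n} (hx : x ∈ gridCube q)
    (hy : y ∈ gridCube q) : ‖x - y‖ ≤ n * 2 ^ (-q.1) := by
  rw [mem_gridCube_iff] at hx hy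
  refine norm_le_mul_of_abs_le fun i => ?_
  rw [PiLp.sub_apply, abs_le]
  constructor <;> linarith [(hx i).1, (hx i).2, (hy i).1, (hy i).2]

/-- The cubes that contain the origin exhaust the space. -/
theorem ball_subset_gridCube (J : ℤ) :
    ball (0 : Euc n) (2 ^ J / 3) ⊆ gridCube (gridAt (-J) 0) := by
  intro x hx
  rw [mem_ball_zero_iff] at hx
  rw [mem_gridCube]
  funext i
  change gridPos (-J) x i = gridPos (-J) 0 i
  have hxi : |x i| < 2 ^ J / 3 := (PiLp.norm_apply_le x i).trans_lt hx
  have h2 : (0 : ℝ) < 2 ^ J := by positivity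
  have hy : |(2 : ℝ) ^ (-J) * x i| < 1 / 3 := by
    rw [abs_mul, abs_of_pos (by positivity), zpow_neg, inv_mul_lt_iff₀ h2]
    linarith
  rw [abs_lt] at hy
  obtain ⟨s, hs, -, h1 | h1⟩ := exists_int_eq_neg_one_zpow (-J)
  · have e : ∀ t : ℝ, -1 / 3 < t → t < 1 / 3 → ⌊t - (-1) ^ (-J) / 3⌋ = -1 := by
      intro t h3 h4
      rw [← hs, h1, Int.floor_eq_iff]
      push_cast
      constructor <;> linarith
    simp only [gridPos]
    rw [e _ (by linarith) (by linarith), e _ (by norm_num) (by norm_num)]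
  · have e : ∀ t : ℝ, -1 / 3 < t → t < 1 / 3 → ⌊t - (-1) ^ (-J) / 3⌋ = 0 := by
      intro t h3 h4
      rw [← hs, h1, Int.floor_eq_iff]
      push_cast
      constructor <;> linarith
    simp only [gridPos]
    rw [e _ (by linarith) (by linarith), e _ (by norm_num) (by norm_num)]

end Grid

/-! ### The stopping-time construction -/

section Stopping

variable {n : ℕ} {O : GridIndex n → Set (Euc n)} {q p r : GridIndex n} {x : Euc n}

/-- The proper subcube `p` of `q` is selected if it contains the origin or if the exceptional set
`O q` occupies a substantial part of it. -/
def Selected (O : GridIndex n → Set (Euc n)) (q p : GridIndex n) : Prop :=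
  q.1 < p.1 ∧ gridCube p ⊆ gridCube q ∧
    (0 ∈ gridCube p ∨ volume (gridCube p) < 2 ^ (n + 1) * volume (gridCube p ∩ O q))

/-- The maximal selected subcubes: no selected subcube of larger side length contains `p`. -/
def IsChild (O : GridIndex n → Set (Euc n)) (q p : GridIndex n) : Prop :=
  Selected O q p ∧ ∀ r, Selected O q r → gridCube p ⊆ gridCube r → p.1 ≤ r.1

/-- The part of a cube that is not covered by its children. -/
def mainPart (O : GridIndex n → Set (Euc n)) (q : GridIndex n) : Set (Euc n) :=
  gridCube q \ ⋃ (p) (_ : IsChild O q p), gridCube p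

theorem IsChild.lt (h : IsChild O q p) : q.1 < p.1 := h.1.1

theorem IsChild.subset (h : IsChild O q p) : gridCube p ⊆ gridCube q := h.1.2.1

/-- The children of a cube are pairwise disjoint. -/
theorem IsChild.unique (hp : IsChild O q p) (hr : IsChild O q r) (hxp : x ∈ gridCube p)
    (hxr : x ∈ gridCube r) : p = r := by
  refine gridIndex_eq ?_ hxp hxr
  rcases le_total p.1 r.1 with h | h
  · exact le_antisymm h (hr.2 p hp.1 (gridCube_subset h hxp hxr))
  · exact le_antisymm (hp.2 r hr.1 (gridCube_subset h hxr hxp)) h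

/-- A point of a selected subcube belongs to a child. -/
theorem Selected.exists_isChild (h : Selected O q p) (hx : x ∈ gridCube p) :
    ∃ r, IsChild O q r ∧ x ∈ gridCube r := by
  obtain ⟨k, hk, hmin⟩ := Int.exists_least_of_bdd (P := fun k => Selected O q (gridAt k x))
    ⟨q.1, fun z hz => hz.1.le⟩ ⟨p.1, by rwa [gridAt_eq hx]⟩
  refine ⟨gridAt k x, ⟨hk, fun r hr hsub => ?_⟩, mem_gridCube_gridAt k x⟩
  refine hmin r.1 ?_
  rwa [gridAt_eq (hsub (mem_gridCube_gridAt k x))]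

/-- The exceptional set occupies at most half of each child. -/
theorem IsChild.volume_inter_le (h : IsChild O q p)
    (hO : 2 ^ (n + 3) * volume (O q) ≤ volume (gridCube q)) :
    2 * volume (gridCube p ∩ O q) ≤ volume (gridCube p) := by
  -- the parent of `p` is not selected
  have hx := corner_mem_gridCube p
  set r := gridAt (p.1 - 1) (corner p) with hr
  have hxr : corner p ∈ gridCube r := mem_gridCube_gridAt _ _
  have hpr : gridCube p ⊆ gridCube r := gridCube_subset (sub_le_self _ zero_le_one) hxr hx
  have hvol := volume_gridCube_eq_of_succ (q := r) (p := p) (sub_add_cancel p.1 1).symm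
  have key : 2 ^ (n + 1) * volume (gridCube r ∩ O q) ≤ volume (gridCube r) := by
    rcases (Int.le_sub_one_of_lt h.lt).eq_or_lt with h1 | h1
    · have hqr : q = r := gridIndex_eq h1 (h.subset hx) hxr
      rw [← hqr]
      refine le_trans ?_ hO
      gcongr
      · norm_num
      · omega
      · exact inter_subset_right
    · by_contra! hlt
      have hs : Selected O q r :=
        ⟨h1, gridCube_subset h1.le (h.subset hx) hxr, Or.inr hlt⟩
      have := h.2 r hs hpr
      change p.1 ≤ p.1 - 1 at this
      omega
  rw [hvol, pow_succ, mul_assoc] at key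
  have h3 := (ENNReal.mul_le_mul_iff_right (by simp) (by finiteness)).1 key
  exact le_trans (by gcongr) h3

theorem measurableSet_mainPart (O : GridIndex n → Set (Euc n)) (q : GridIndex n) :
    MeasurableSet (mainPart O q) :=
  (measurableSet_gridCube q).diff
    (MeasurableSet.iUnion fun p => MeasurableSet.iUnion fun _ => measurableSet_gridCube p)

/-- The children cover at most three quarters of the cube. Those that contain the origin lie in one
cube of the next level, of relative volume `2⁻ⁿ ≤ 1/2`; the others have total relative volume at
most `1/4`, by the smallness of the exceptional set. -/
theorem volume_gridCube_le_mainPart (hn : 1 ≤ n) (hOm : MeasurableSet (O q))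
    (hO : 2 ^ (n + 3) * volume (O q) ≤ volume (gridCube q)) :
    volume (gridCube q) ≤ 4 * volume (mainPart O q) := by
  set v := volume (gridCube q) with hv
  have hvt : v ≠ ⊤ := volume_gridCube_ne_top q
  -- the children that do not contain the origin
  set S : Set (GridIndex n) := {p | IsChild O q p ∧ (0 : Euc n) ∉ gridCube p} with hS
  have h1 : 4 * volume (⋃ p ∈ S, gridCube p) ≤ v := by
    have hdisj : S.PairwiseDisjoint fun p => gridCube p ∩ O q := by
      intro p hp r hr hpr
      refine disjoint_left.2 fun x hx hx' => hpr (hp.1.unique hr.1 hx.1 hx'.1)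
    calc 4 * volume (⋃ p ∈ S, gridCube p) ≤ 4 * ∑' p : S, volume (gridCube (p : GridIndex n)) := by
          gcongr
          exact measure_biUnion_le _ S.to_countable _
      _ ≤ 4 * ∑' p : S, 2 ^ (n + 1) * volume (gridCube (p : GridIndex n) ∩ O q) := by
          gcongr with p
          exact (p.2.1.1.2.2.resolve_left p.2.2).le
      _ = 2 ^ (n + 3) * volume (⋃ p ∈ S, gridCube p ∩ O q) := by
          rw [ENNReal.tsum_mul_left, measure_biUnion S.to_countable hdisj
            fun p _ => (measurableSet_gridCube p).inter hOm, ← mul_assoc]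
          congr 1
          rw [pow_add, pow_add]
          norm_num
          ring
      _ ≤ 2 ^ (n + 3) * volume (O q) := by
          gcongr
          exact iUnion₂_subset fun p _ => inter_subset_right
      _ ≤ v := hO
  have h2 : 2 * volume (gridCube (gridAt (q.1 + 1) (0 : Euc n))) ≤ v := by
    rw [hv, volume_gridCube_eq_of_succ (q := q) (p := gridAt (q.1 + 1) 0) rfl]
    gcongr
    exact le_self_pow₀ one_le_two (by omega)
  have hcover : (⋃ (p) (_ : IsChild O q p), gridCube p) ⊆
      (⋃ p ∈ S, gridCube p) ∪ gridCube (gridAt (q.1 + 1) (0 : Euc n)) := by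
    refine iUnion₂_subset fun p hp => ?_
    by_cases h0 : (0 : Euc n) ∈ gridCube p
    · exact (gridCube_subset (Int.add_one_le_of_lt hp.lt) (mem_gridCube_gridAt _ _) h0).trans
        subset_union_right
    · exact (subset_biUnion_of_mem (u := gridCube) (show p ∈ S from ⟨hp, h0⟩)).trans
        subset_union_left
  have h3 : 4 * volume (⋃ (p) (_ : IsChild O q p), gridCube p) ≤ 3 * v := by
    calc _ ≤ 4 * (volume (⋃ p ∈ S, gridCube p) +
          volume (gridCube (gridAt (q.1 + 1) (0 : Euc n)))) := by
          gcongr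
          exact (measure_mono hcover).trans (measure_union_le _ _)
      _ = 4 * volume (⋃ p ∈ S, gridCube p) +
          2 * (2 * volume (gridCube (gridAt (q.1 + 1) (0 : Euc n)))) := by ring
      _ ≤ v + 2 * v := by gcongr
      _ = 3 * v := by ring
  have h4 : v ≤ volume (mainPart O q) + volume (⋃ (p) (_ : IsChild O q p), gridCube p) := by
    refine (measure_mono ?_).trans (measure_union_le _ _)
    rw [mainPart, sdiff_union_self]
    exact subset_union_left
  have h5 : v + 3 * v ≤ 4 * volume (mainPart O q) + 3 * v := by
    calc v + 3 * v = 4 * v := by ring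
      _ ≤ 4 * (volume (mainPart O q) + volume (⋃ (p) (_ : IsChild O q p), gridCube p)) := by gcongr
      _ ≤ _ := by
          rw [mul_add]
          gcongr
  exact (ENNReal.add_le_add_iff_right (by finiteness)).1 h5

/-- The cubes that are reached from the cube `r` by repeatedly passing to children. -/
def Descendants (O : GridIndex n → Set (Euc n)) (r : GridIndex n) : Set (GridIndex n) :=
  {q | Relation.ReflTransGen (IsChild O) r q}

theorem Descendants.subset (hq : q ∈ Descendants O r) : gridCube q ⊆ gridCube r := by
  induction hq with
  | refl => exact subset_rfl
  | tail _ h ih => exact h.subset.trans ih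

/-- Two intersecting descendants of the same cube are descendants of each other. -/
theorem Descendants.of_mem (hq : q ∈ Descendants O r) (hp : p ∈ Descendants O r)
    (hxq : x ∈ gridCube q) (hxp : x ∈ gridCube p) (hqp : q.1 ≤ p.1) : p ∈ Descendants O q := by
  induction hq with
  | refl => exact hp
  | tail h1 h2 ih =>
    rename_i b c
    have h3 := ih (h2.subset hxq) (h2.lt.le.trans hqp)
    rcases Relation.ReflTransGen.cases_head h3 with rfl | ⟨d, hd, hdp⟩
    · exact absurd h2.lt (not_lt.2 hqp)
    · have : d = c := hd.unique h2 (Descendants.subset hdp hxp) hxq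
      exact this ▸ hdp

/-- The main parts of different descendants of a cube are disjoint. -/
theorem Descendants.disjoint_mainPart (hq : q ∈ Descendants O r) (hp : p ∈ Descendants O r)
    (hqp : q ≠ p) : Disjoint (mainPart O q) (mainPart O p) := by
  have key : ∀ {q p : GridIndex n}, q ∈ Descendants O r → p ∈ Descendants O r → q ≠ p →
      q.1 ≤ p.1 → ∀ x, x ∈ mainPart O q → x ∉ mainPart O p := by
    intro q p hq hp hqp hle x hx hx'
    have h := Descendants.of_mem hq hp hx.1 hx'.1 hle
    rcases Relation.ReflTransGen.cases_head h with h | ⟨d, hd, hdp⟩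
    · exact hqp h
    · exact hx.2 (mem_iUnion₂.2 ⟨d, hd, Descendants.subset hdp hx'.1⟩)
  rcases le_total q.1 p.1 with h | h
  · exact disjoint_left.2 fun x hx hx' => key hq hp hqp h x hx hx'
  · exact disjoint_left.2 fun x hx hx' => key hp hq hqp.symm h x hx' hx

/-- The descendants of the cubes that contain the origin. -/
def stoppingFamily (O : GridIndex n → Set (Euc n)) : Set (GridIndex n) :=
  ⋃ J : ℕ, Descendants O (gridAt (-(J : ℤ)) 0)

/-- The cube of the next level that contains the origin is always a child. This makes the stopping
cubes below the different cubes that contain the origin into one increasing family. -/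
theorem isChild_gridAt_zero (k : ℤ) : IsChild O (gridAt k 0) (gridAt (k + 1) 0) := by
  have hk : (gridAt k (0 : Euc n)).1 < (gridAt (k + 1) (0 : Euc n)).1 := lt_add_one k
  refine ⟨⟨hk, gridCube_subset hk.le (mem_gridCube_gridAt _ _) (mem_gridCube_gridAt _ _),
    Or.inl (mem_gridCube_gridAt _ _)⟩, fun r hr _ => ?_⟩
  exact Int.add_one_le_of_lt hr.1

theorem monotone_descendants :
    Monotone fun J : ℕ => Descendants O (gridAt (-(J : ℤ)) (0 : Euc n)) := by
  refine monotone_nat_of_le_succ fun J q hq => ?_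
  have h := isChild_gridAt_zero (O := O) (n := n) (-((J + 1 : ℕ) : ℤ))
  have e : -((J + 1 : ℕ) : ℤ) + 1 = -(J : ℤ) := by push_cast; ring
  rw [e] at h
  exact Relation.ReflTransGen.head h hq

theorem pairwiseDisjoint_mainPart : (stoppingFamily O).PairwiseDisjoint (mainPart O) := by
  intro q hq p hp hqp
  obtain ⟨J, hJ⟩ := mem_iUnion.1 hq
  obtain ⟨J', hJ'⟩ := mem_iUnion.1 hp
  exact Descendants.disjoint_mainPart (monotone_descendants (le_max_left J J') hJ)
    (monotone_descendants (le_max_right J J') hJ') hqp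

/-- Almost every point belongs to finitely many descendants of a cube. -/
theorem ae_finite_descendants (hn : 1 ≤ n) (hOm : ∀ q, MeasurableSet (O q))
    (hO : ∀ q, 2 ^ (n + 3) * volume (O q) ≤ volume (gridCube q)) (r : GridIndex n) :
    ∀ᵐ x, {q : Descendants O r | x ∈ gridCube (q : GridIndex n)}.Finite := by
  refine ae_finite_setOfPred_mem (ne_top_of_le_ne_top (b := 4 * volume (gridCube r))
    (ENNReal.mul_ne_top (by simp) (volume_gridCube_ne_top r)) ?_)
  calc ∑' q : Descendants O r, volume (gridCube (q : GridIndex n))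
      ≤ ∑' q : Descendants O r, 4 * volume (mainPart O (q : GridIndex n)) := by
        gcongr with q
        exact volume_gridCube_le_mainPart hn (hOm _) (hO _)
    _ = 4 * volume (⋃ q ∈ Descendants O r, mainPart O q) := by
        rw [ENNReal.tsum_mul_left, measure_biUnion (Descendants O r).to_countable
          (fun q hq p hp h => Descendants.disjoint_mainPart hq hp h)
          fun q _ => measurableSet_mainPart O q]
    _ ≤ 4 * volume (gridCube r) := by
        gcongr
        exact iUnion₂_subset fun q hq => sdiff_subset.trans (Descendants.subset hq)

/-- The main part avoids the open exceptional set: small cubes around a point of `O q` are contained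
in `O q`, hence selected. -/
theorem mem_mainPart_notMem (hO : IsOpen (O q)) (hx : x ∈ mainPart O q) : x ∉ O q := by
  intro hxO
  obtain ⟨ε, hε, hball⟩ := Metric.isOpen_iff.1 hO x hxO
  obtain ⟨N, hN⟩ := exists_pow_lt_of_lt_one (show 0 < ε / (n + 1) by positivity)
    (show (1 / 2 : ℝ) < 1 by norm_num)
  -- a cube around `x` that is contained in `O q`
  set k := max (q.1 + 1) N with hk
  have hsub : gridCube (gridAt k x) ⊆ O q := by
    refine fun y hy => hball ?_
    rw [mem_ball_iff_norm]
    refine (norm_sub_le_of_mem_gridCube hy (mem_gridCube_gridAt k x)).trans_lt ?_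
    have h1 : (2 : ℝ) ^ (-k) ≤ (1 / 2) ^ N := by
      rw [one_div_pow, ← zpow_natCast, one_div, ← zpow_neg]
      exact zpow_le_zpow_right₀ one_le_two (neg_le_neg (le_max_right _ _))
    have h2 : (n : ℝ) * 2 ^ (-k) ≤ n * (1 / 2) ^ N := by gcongr
    rw [lt_div_iff₀ (by positivity)] at hN
    have h3 : (0 : ℝ) < (1 / 2) ^ N := by positivity
    change (n : ℝ) * 2 ^ (-k) < ε
    nlinarith
  have hlt : q.1 < k := Int.lt_of_add_one_le (le_max_left _ _)
  have hsel : Selected O q (gridAt k x) := by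
    refine ⟨hlt, gridCube_subset hlt.le hx.1 (mem_gridCube_gridAt k x), Or.inr ?_⟩
    rw [inter_eq_self_of_subset_left hsub]
    have h0 := volume_gridCube_ne_zero (gridAt k x)
    have ht := volume_gridCube_ne_top (gridAt k x)
    calc volume (gridCube (gridAt k x)) = 1 * volume (gridCube (gridAt k x)) := (one_mul _).symm
      _ < 2 ^ (n + 1) * volume (gridCube (gridAt k x)) := by
          refine ENNReal.mul_lt_mul_left h0 ht ?_
          exact ENNReal.one_lt_two.trans_le (le_self_pow₀ one_le_two (by omega))
  obtain ⟨r, hr, hxr⟩ := hsel.exists_isChild (mem_gridCube_gridAt k x)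
  exact hx.2 (mem_iUnion₂.2 ⟨r, hr, hxr⟩)

/-- The iteration of the local estimates along the stopping cubes. Almost every point lies in
finitely many of them, so the iteration ends after finitely many steps, at a cube whose main part
contains the point and where the first estimate applies. The bounds for all the cubes that
contain the origin are sums over one and the same family. -/
theorem ae_le_tsum_stoppingFamily (hn : 1 ≤ n) (hOo : ∀ q, IsOpen (O q))
    (hO : ∀ q, 2 ^ (n + 3) * volume (O q) ≤ volume (gridCube q))
    {H : GridIndex n → Euc n → ℝ≥0∞} {a : GridIndex n → ℝ≥0∞}
    (h1 : ∀ q, ∀ᵐ x, x ∈ gridCube q → x ∉ O q → H q x ≤ a q)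
    (h2 : ∀ q p, q.1 < p.1 → gridCube p ⊆ gridCube q →
      2 * volume (gridCube p ∩ O q) ≤ volume (gridCube p) →
      ∀ᵐ x, x ∈ gridCube p → H q x ≤ a q + H p x) :
    ∀ᵐ x, ∀ J : ℕ, x ∈ gridCube (gridAt (-(J : ℤ)) (0 : Euc n)) →
      H (gridAt (-(J : ℤ)) 0) x ≤
        ∑' q : stoppingFamily O, (gridCube (q : GridIndex n)).indicator (fun _ => a q) x := by
  have hchild : ∀ q p, ∀ᵐ x, IsChild O q p → x ∈ gridCube p → H q x ≤ a q + H p x := by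
    intro q p
    by_cases h : IsChild O q p
    · filter_upwards [h2 q p h.lt h.subset (h.volume_inter_le (hO q))] with x hx _ using hx
    · exact Eventually.of_forall fun x hx => absurd hx h
  have hfin := ae_all_iff.2 fun J : ℕ =>
    ae_finite_descendants hn (fun q => (hOo q).measurableSet) hO (gridAt (-(J : ℤ)) (0 : Euc n))
  filter_upwards [ae_all_iff.2 h1, ae_all_iff.2 fun q => ae_all_iff.2 (hchild q), hfin]
    with x hx1 hx2 hx3 J hxJ
  set D := Descendants O (gridAt (-(J : ℤ)) (0 : Euc n)) with hD
  -- the levels of the descendants that contain `x` are bounded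
  obtain ⟨M, hM⟩ : ∃ M : ℤ, ∀ q ∈ D, x ∈ gridCube q → q.1 ≤ M := by
    obtain ⟨M, hM⟩ := ((hx3 J).image fun q : D => (q : GridIndex n).1).bddAbove
    exact ⟨M, fun q hq hxq => hM ⟨⟨q, hq⟩, hxq, rfl⟩⟩
  have key : ∀ d : ℕ, ∀ q ∈ D, x ∈ gridCube q → M - q.1 ≤ d →
      H q x ≤ ∑' p : GridIndex n, {p | p ∈ D ∧ x ∈ gridCube p ∧ q.1 ≤ p.1}.indicator a p := by
    intro d
    induction d with
    | zero =>
      intro q hq hxq hd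
      have hmain : x ∈ mainPart O q := by
        refine ⟨hxq, fun h => ?_⟩
        obtain ⟨c, hc, hxc⟩ := mem_iUnion₂.1 h
        have := hM c (Relation.ReflTransGen.tail hq hc) hxc
        have := hc.lt
        push_cast at hd
        omega
      refine (hx1 q hxq (mem_mainPart_notMem (hOo q) hmain)).trans ?_
      refine le_trans ?_ (ENNReal.le_tsum q)
      rw [indicator_of_mem (show q ∈ {p | p ∈ D ∧ x ∈ gridCube p ∧ q.1 ≤ p.1} from
        ⟨hq, hxq, le_rfl⟩)]
    | succ d ih =>
      intro q hq hxq hd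
      by_cases hmain : x ∈ mainPart O q
      · refine (hx1 q hxq (mem_mainPart_notMem (hOo q) hmain)).trans ?_
        refine le_trans ?_ (ENNReal.le_tsum q)
        rw [indicator_of_mem (show q ∈ {p | p ∈ D ∧ x ∈ gridCube p ∧ q.1 ≤ p.1} from
          ⟨hq, hxq, le_rfl⟩)]
      · obtain ⟨c, hc, hxc⟩ : ∃ c, IsChild O q c ∧ x ∈ gridCube c := by
          by_contra! h
          exact hmain ⟨hxq, fun h' => by
            obtain ⟨c, hc, hxc⟩ := mem_iUnion₂.1 h'
            exact h c hc hxc⟩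
        have hlt := hc.lt
        have hcD : c ∈ D := Relation.ReflTransGen.tail hq hc
        have hi := ih c hcD hxc (by push_cast at hd; omega)
        calc H q x ≤ a q + H c x := hx2 q c hc hxc
          _ ≤ a q + ∑' p, {p | p ∈ D ∧ x ∈ gridCube p ∧ c.1 ≤ p.1}.indicator a p := by gcongr
          _ = ∑' p, ((Pi.single q (a q) : GridIndex n → ℝ≥0∞) p +
                {p | p ∈ D ∧ x ∈ gridCube p ∧ c.1 ≤ p.1}.indicator a p) := by
              rw [ENNReal.tsum_add, tsum_pi_single]
          _ ≤ _ := by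
              refine ENNReal.tsum_le_tsum fun p => ?_
              rcases eq_or_ne p q with rfl | hpq
              · rw [Pi.single_eq_same, indicator_of_notMem (fun h => by have := h.2.2; omega),
                  add_zero, indicator_of_mem (show p ∈ {r | r ∈ D ∧ x ∈ gridCube r ∧ p.1 ≤ r.1} from
                    ⟨hq, hxq, le_rfl⟩)]
              · rw [Pi.single_eq_of_ne hpq, zero_add]
                refine indicator_le_indicator_of_subset ?_ (fun _ => zero_le) p
                exact fun r hr => ⟨hr.1, hr.2.1, hlt.le.trans hr.2.2⟩
  have hself : gridAt (-(J : ℤ)) 0 ∈ D := Relation.ReflTransGen.refl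
  refine (key (M - (gridAt (-(J : ℤ)) (0 : Euc n)).1).toNat _ hself hxJ
    (Int.self_le_toNat _)).trans ?_
  rw [tsum_subtype (stoppingFamily O) fun q => (gridCube q).indicator (fun _ => a q) x]
  refine ENNReal.tsum_le_tsum fun p => ?_
  by_cases hp : p ∈ D ∧ x ∈ gridCube p ∧ (gridAt (-(J : ℤ)) (0 : Euc n)).1 ≤ p.1
  · rw [indicator_of_mem (show p ∈ {p | p ∈ D ∧ x ∈ gridCube p ∧ _ ≤ p.1} from hp),
      indicator_of_mem (show p ∈ stoppingFamily O from mem_iUnion.2 ⟨J, hp.1⟩),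
      indicator_of_mem hp.2.1]
  · rw [indicator_of_notMem (show p ∉ {p | p ∈ D ∧ x ∈ gridCube p ∧ _ ≤ p.1} from hp)]
    exact zero_le

end Stopping

/-! ### Local estimates on the cubes of the grid -/

section LocalEstimate

variable {n : ℕ}

/-- The radius of the ball around the corner of a cube to which functions are localized. -/
def gridRadius (q : GridIndex n) : ℝ := 4 * n * 2 ^ (-q.1)

theorem gridRadius_pos (hn : 1 ≤ n) (q : GridIndex n) : 0 < gridRadius q := by
  have : (0 : ℝ) < n := by exact_mod_cast hn
  unfold gridRadius
  positivity

theorem gridCube_subset_ball (hn : 1 ≤ n) (q : GridIndex n) :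
    gridCube q ⊆ ball (corner q) (gridRadius q / 2) := by
  intro x hx
  rw [mem_ball_iff_norm]
  have h1 := norm_sub_le_of_mem_gridCube hx (corner_mem_gridCube q)
  have h2 := gridRadius_pos hn q
  unfold gridRadius at *
  linarith

/-- The support of the localization to a proper subcube lies in the ball on which the localization
to the larger cube differs from the function by a constant. -/
theorem ball_corner_subset (hn : 1 ≤ n) {q p : GridIndex n} (hlt : q.1 < p.1)
    (hsub : gridCube p ⊆ gridCube q) :
    ball (corner p) (3 / 2 * gridRadius p) ⊆ ball (corner q) (gridRadius q) := by
  refine ball_subset_ball' ?_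
  have h1 := norm_sub_le_of_mem_gridCube (hsub (corner_mem_gridCube p)) (corner_mem_gridCube q)
  have h2 : (2 : ℝ) ^ (-p.1) ≤ 2 ^ (-q.1) / 2 := by
    rw [div_eq_mul_inv, ← zpow_sub_one₀ (by norm_num)]
    exact zpow_le_zpow_right₀ one_le_two (by omega)
  have h3 : (0 : ℝ) < n := by exact_mod_cast hn
  rw [dist_eq_norm]
  unfold gridRadius
  have h4 : (n : ℝ) * 2 ^ (-p.1) ≤ n * (2 ^ (-q.1) / 2) := by gcongr
  linarith

/-- The localization of `f` to the ball that belongs to the cube `q`. -/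
def cubeLocalize (q : GridIndex n) (f : Euc n → ℝ) : Euc n → ℝ :=
  localize (corner q) (gridRadius q) f

/-- The integral of `|g|` over a ball that is comparable to the cube `q`. -/
def cubeMass (g : Euc n → Euc n) (q : GridIndex n) : ℝ≥0∞ :=
  ∫⁻ y in ball (corner q) (2 * gridRadius q), ‖g y‖ₑ

theorem cubeMass_ne_top {g : Euc n → Euc n} (hg : MemLp g 2) (q : GridIndex n) :
    cubeMass g q ≠ ⊤ := by
  refine ne_top_of_le_ne_top (ENNReal.mul_ne_top hg.2.ne ?_)
    (setLIntegral_enorm_le_eLpNorm_two hg.1 _)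
  exact ENNReal.rpow_ne_top_of_nonneg (by norm_num) measure_ball_lt_top.ne

variable {K : Euc n → Euc n → ℝ} {T : L2 n →L[ℝ] L2 n} {C : ℝ} {A : ℝ≥0}

/-- If `|∇Tv|` and the maximal function of `|∇v|` are bounded by `t` on half of the cube `p`, then
on `p` the gradient of `T v` differs from the gradient of `T` of the localization of `v` to `p` by a
multiple of `t`. The weak-type estimate provides a point of `p` where both gradients are small, and
their difference oscillates little. -/
theorem GradientBound.exists_enorm_le_add (hA : GradientBound T A) (hn : 1 ≤ n)
    (hK : KernelBound K C) (hT : IsCZOperator T K) (hT1 : TOneEqZero T K) :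
    ∃ B : ℝ≥0, 1 ≤ B ∧ ∀ {v : Euc n → ℝ} {G h : Euc n → Euc n}, SobolevPair v G →
      HasCompactSupport v → IsTGradient T v h → ∀ {t : ℝ}, 0 < t →
      ∀ {O : Set (Euc n)}, MeasurableSet O → {x | ENNReal.ofReal t < ‖h x‖ₑ} ⊆ O →
      maximalSet (fun x => ‖G x‖ₑ) t ⊆ O →
      ∀ {p : GridIndex n}, 2 * volume (gridCube p ∩ O) ≤ volume (gridCube p) →
      ∀ {hp : Euc n → Euc n}, IsTGradient T (cubeLocalize p v) hp →
        ∀ᵐ x, x ∈ gridCube p → ‖h x‖ₑ ≤ B * ENNReal.ofReal t + ‖hp x‖ₑ := by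
  obtain ⟨D, hD, hweak⟩ := hA.weak_type hn hK hT hT1
  obtain ⟨L, hL⟩ := exists_lintegral_localizeGrad_le n
  have hC := hK.1
  -- `M` is large enough for the weak-type estimate at height `M t` to give a quarter of the cube
  set M : ℝ≥0 := 4 * (D.toNNReal * L * (16 * n) ^ n) + 1 with hM
  set C' : ℝ≥0 := (n * C * 2 ^ (4 * n + 7) * 2 ^ n).toNNReal with hC'
  refine ⟨1 + M + C' + C', by rw [add_assoc, add_assoc]; exact le_self_add, ?_⟩
  intro v G h hv hvc hh t ht O hOm hO1 hO2 p hpO hp hhp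
  set S := ENNReal.ofReal t with hS
  have hρ := gridRadius_pos hn p
  have hS0 : S ≠ 0 := by simpa [hS] using ht
  have hSt : S ≠ ⊤ := ENNReal.ofReal_ne_top
  have hvol0 := volume_gridCube_ne_zero p
  have hvolt := volume_gridCube_ne_top p
  have hhalf : volume (gridCube p) ≤ 2 * volume (gridCube p \ O) := by
    have h1 := measure_inter_add_sdiff₀ (μ := volume) (gridCube p) hOm.nullMeasurableSet
    have h2 : 2 * volume (gridCube p ∩ O) + 2 * volume (gridCube p \ O) =
        volume (gridCube p) + volume (gridCube p) := by
      rw [← mul_add, h1, two_mul]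
    have h3 : volume (gridCube p) + volume (gridCube p) ≤
        volume (gridCube p) + 2 * volume (gridCube p \ O) := by
      rw [← h2]
      gcongr
    exact (ENNReal.add_le_add_iff_left hvolt).1 h3
  -- a point of the cube outside `O` bounds the averages over all large balls around the corner
  have hg : ∀ r, gridRadius p ≤ r →
      ∫⁻ y in ball (corner p) r, ‖G y‖ₑ ≤ ENNReal.ofReal (2 ^ n * t * r ^ n) := by
    intro r hr
    obtain ⟨z, hzp, hzO⟩ : (gridCube p \ O).Nonempty := by
      refine nonempty_of_measure_ne_zero (μ := volume) fun h0 => ?_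
      rw [h0, mul_zero] at hhalf
      exact hvol0 (le_antisymm hhalf zero_le)
    have hz := mem_ball'.1 (gridCube_subset_ball hn p hzp)
    have hsub : ball (corner p) r ⊆ ball z (2 * r) := ball_subset_ball' (by linarith)
    refine (lintegral_mono_set hsub).trans ?_
    by_contra! hlt
    refine hzO (hO2 ⟨2 * r, by linarith, lt_of_eq_of_lt ?_ hlt⟩)
    rw [mul_pow]
    congr 1
    ring
  -- the oscillation estimate
  obtain ⟨w, hw⟩ := (hh.sub hhp).exists_osc_le hn hK hT hT1 hv hvc hρ
    (by positivity : 0 ≤ 2 ^ n * t) hg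
  have hw : ∀ᵐ x, x ∈ gridCube p → ‖(h - hp) x - w‖ₑ ≤ C' * S := by
    filter_upwards [hw] with x hx hxp
    refine (hx (gridCube_subset_ball hn p hxp)).trans_eq ?_
    rw [hC', hS, ← ENNReal.ofReal, ← ENNReal.ofReal_mul (by positivity)]
    congr 1
    ring
  -- the weak-type estimate for the localization of `v` to `p`
  have hmass : ∫⁻ y, ‖localizeGrad (corner p) (gridRadius p) v G y‖ₑ ≤
      L * ((16 * n) ^ n * S * volume (gridCube p)) := by
    refine (hL hv _ hρ).trans (mul_le_mul_right ((hg _ (by linarith)).trans_eq ?_) _)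
    have e1 : (16 * n : ℝ≥0∞) ^ n = ENNReal.ofReal ((16 * n) ^ n) := by
      rw [ENNReal.ofReal_pow (by positivity), ENNReal.ofReal_mul (by positivity)]
      simp
    rw [volume_gridCube, hS, e1, ← ENNReal.ofReal_mul (by positivity),
      ← ENNReal.ofReal_mul (by positivity)]
    congr 1
    have e2 : 2 * gridRadius p = 8 * n * 2 ^ (-p.1) := by unfold gridRadius; ring
    have e3 : (16 * n : ℝ) ^ n = 2 ^ n * (8 * n) ^ n := by rw [← mul_pow]; ring
    rw [e2, e3, mul_pow (8 * n : ℝ)]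
    ring
  have hsmall : 4 * volume {x | M * S < ‖hp x‖ₑ} < volume (gridCube p) := by
    have hM0 : (0 : ℝ) < M := by positivity
    have h1 := hweak _ _ hp (hv.localize hρ) (hasCompactSupport_localize hρ v) hhp (M * t)
      (by positivity)
    rw [ENNReal.ofReal_mul hM0.le, ENNReal.ofReal_coe_nnreal, ← hS] at h1
    have h2 : M * S * (4 * volume {x | M * S < ‖hp x‖ₑ}) < M * S * volume (gridCube p) := by
      calc M * S * (4 * volume {x | M * S < ‖hp x‖ₑ})
          = 4 * (M * S * volume {x | M * S < ‖hp x‖ₑ}) := by ring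
        _ ≤ 4 * (D * (L * ((16 * n) ^ n * S * volume (gridCube p)))) :=
            mul_le_mul_right (h1.trans (mul_le_mul_right hmass _)) _
        _ = (4 * (D.toNNReal * L * (16 * n) ^ n) : ℝ≥0) * (S * volume (gridCube p)) := by
            push_cast
            rw [ENNReal.coe_toNNReal hD]
            ring
        _ < M * (S * volume (gridCube p)) := by
            refine ENNReal.mul_lt_mul_left (mul_ne_zero hS0 hvol0) (ENNReal.mul_ne_top hSt hvolt) ?_
            rw [hM]
            exact_mod_cast lt_add_one _
        _ = _ := by ring
    exact lt_of_mul_lt_mul_left' h2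
  -- a point where both gradients are small
  obtain ⟨z, hzp, hz1, hz2, hz3⟩ : ∃ z ∈ gridCube p, ‖h z‖ₑ ≤ S ∧ ‖hp z‖ₑ ≤ M * S ∧
      ‖(h - hp) z - w‖ₑ ≤ C' * S := by
    by_contra! hcon
    have hsub : gridCube p \ O ⊆ {x | M * S < ‖hp x‖ₑ} ∪
        {x | ¬(x ∈ gridCube p → ‖(h - hp) x - w‖ₑ ≤ C' * S)} := by
      rintro x ⟨hxp, hxO⟩
      by_cases hx : M * S < ‖hp x‖ₑ
      · exact Or.inl hx
      · refine Or.inr fun h' => ?_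
        exact absurd (h' hxp)
          (not_le.2 (hcon x hxp (not_lt.1 fun h2 => hxO (hO1 h2)) (not_lt.1 hx)))
    have h1 : volume (gridCube p \ O) ≤ volume {x | M * S < ‖hp x‖ₑ} := by
      refine (measure_mono hsub).trans ((measure_union_le _ _).trans ?_)
      rw [ae_iff.1 hw, add_zero]
    have h2 : volume (gridCube p) < volume (gridCube p) := by
      calc volume (gridCube p) ≤ 2 * volume (gridCube p \ O) := hhalf
        _ ≤ 4 * volume {x | M * S < ‖hp x‖ₑ} := by gcongr; norm_num
        _ < _ := hsmall
    exact lt_irrefl _ h2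
  have hwle : ‖w‖ₑ ≤ (1 + M + C') * S := by
    calc ‖w‖ₑ = ‖h z - hp z - ((h - hp) z - w)‖ₑ := by congr 1; simp
      _ ≤ ‖h z‖ₑ + ‖hp z‖ₑ + ‖(h - hp) z - w‖ₑ :=
          enorm_sub_le.trans (by gcongr; exact enorm_sub_le)
      _ ≤ S + M * S + C' * S := by gcongr
      _ = _ := by ring
  filter_upwards [hw] with x hx hxp
  calc ‖h x‖ₑ = ‖w + ((h - hp) x - w) + hp x‖ₑ := by congr 1; simp
    _ ≤ ‖w‖ₑ + ‖(h - hp) x - w‖ₑ + ‖hp x‖ₑ :=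
        (enorm_add_le _ _).trans (by gcongr; exact enorm_add_le _ _)
    _ ≤ (1 + M + C') * S + C' * S + ‖hp x‖ₑ := by
        gcongr
        exact hx hxp
    _ = _ := by push_cast; ring

/-- The exceptional set of a cube, outside which the gradient of `T` of the localization to the cube
is bounded by the average of the gradient near the cube. -/
theorem GradientBound.exists_exceptional (hA : GradientBound T A) (hn : 1 ≤ n)
    (hK : KernelBound K C) (hT : IsCZOperator T K) (hT1 : TOneEqZero T K) :
    ∃ Γ : ℝ≥0, ∀ {f : Euc n → ℝ} {g : Euc n → Euc n}, SobolevPair f g →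
      ∀ {h : GridIndex n → Euc n → Euc n}, (∀ q, IsTGradient T (cubeLocalize q f) (h q)) →
      ∀ q, ∃ O : Set (Euc n), IsOpen O ∧ 2 ^ (n + 3) * volume O ≤ volume (gridCube q) ∧
        (∀ᵐ x, x ∈ gridCube q → x ∉ O →
          ‖h q x‖ₑ ≤ Γ * ((volume (gridCube q))⁻¹ * cubeMass g q)) ∧
        ∀ p, q.1 < p.1 → gridCube p ⊆ gridCube q →
          2 * volume (gridCube p ∩ O) ≤ volume (gridCube p) →
          ∀ᵐ x, x ∈ gridCube p →
            ‖h q x‖ₑ ≤ Γ * ((volume (gridCube q))⁻¹ * cubeMass g q) + ‖h p x‖ₑ := by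
  obtain ⟨D, hD, hweak⟩ := hA.weak_type hn hK hT hT1
  obtain ⟨L, hL⟩ := exists_lintegral_localizeGrad_le n
  obtain ⟨B, hB1, hB⟩ := hA.exists_enorm_le_add hn hK hT hT1
  have hV := unitVol_pos (n := n)
  set W : ℝ≥0 := D.toNNReal * L + (5 ^ n * unitVol n).toNNReal * L with hW
  set Λ : ℝ≥0 := 2 ^ (n + 3) * W + 1 with hΛ
  refine ⟨B * Λ, fun {f g} hf {h} hh q => ?_⟩
  have hρ := gridRadius_pos hn q
  have hvol0 := volume_gridCube_ne_zero q
  have hvolt := volume_gridCube_ne_top q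
  have hmt := cubeMass_ne_top hf.memLp_grad q
  have hS := hf.localize (x₀ := corner q) hρ
  have hGI := hL hf (corner q) hρ
  set v := cubeLocalize q f with hv
  set G := localizeGrad (corner q) (gridRadius q) f g with hG
  have hvc : HasCompactSupport v := hasCompactSupport_localize hρ f
  rcases eq_or_ne (cubeMass g q) 0 with h0 | h0
  · -- if the gradient vanishes near the cube then so does the localization
    have hG0 : ∫⁻ y, ‖G y‖ₑ = 0 := by
      refine le_antisymm (hGI.trans_eq ?_) zero_le
      change L * cubeMass g q = 0
      rw [h0, mul_zero]
    have hG0' : G =ᵐ[volume] 0 := by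
      rw [lintegral_eq_zero_iff' hS.memLp_grad.1.enorm] at hG0
      filter_upwards [hG0] with x hx
      simpa using hx
    have hq0 : h q =ᵐ[volume] 0 := by
      obtain ⟨hm, hle⟩ := (hA _ _ hS).2 _ (hh q)
      rw [eLpNorm_congr_ae hG0', eLpNorm_zero, mul_zero] at hle
      exact (eLpNorm_eq_zero_iff hm.1 (by norm_num)).1 (le_antisymm hle zero_le)
    refine ⟨∅, isOpen_empty, by simp, ?_, fun p _ _ _ => ?_⟩
    · filter_upwards [hq0] with x hx _ _
      simp [hx]
    · filter_upwards [hq0] with x hx _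
      simp [hx]
  -- the height of the level sets
  set a := (volume (gridCube q))⁻¹ * cubeMass g q with ha
  have ha0 : a ≠ 0 := mul_ne_zero (ENNReal.inv_ne_zero.2 hvolt) h0
  have hat : a ≠ ⊤ := ENNReal.mul_ne_top (ENNReal.inv_ne_top.2 hvol0) hmt
  set t : ℝ := Λ * a.toReal with ht
  have ht0 : 0 < t := by
    have := ENNReal.toReal_pos ha0 hat
    have : (0 : ℝ) < Λ := by positivity
    positivity
  have hte : ENNReal.ofReal t = Λ * a := by
    rw [ht, ENNReal.ofReal_mul (by positivity), ENNReal.ofReal_coe_nnreal,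
      ENNReal.ofReal_toReal hat]
  have hav : a * volume (gridCube q) = cubeMass g q := by
    rw [ha, mul_right_comm, ENNReal.inv_mul_cancel hvol0 hvolt, one_mul]
  set E := {x | ENNReal.ofReal t < ‖h q x‖ₑ} ∪ maximalSet (fun x => ‖G x‖ₑ) t with hE
  have hEle : ENNReal.ofReal t * volume E ≤ W * cubeMass g q := by
    have h1 := hweak _ _ _ hS hvc (hh q) t ht0
    have h2 := volume_maximalSet_le (G := fun x => ‖G x‖ₑ) hn
      (ne_top_of_le_ne_top (ENNReal.mul_ne_top (by simp) hmt) hGI) ht0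
    calc _ ≤ ENNReal.ofReal t * (volume {x | ENNReal.ofReal t < ‖h q x‖ₑ} +
          volume (maximalSet (fun x => ‖G x‖ₑ) t)) := by
          gcongr
          exact measure_union_le _ _
      _ ≤ D * (L * cubeMass g q) + ENNReal.ofReal (5 ^ n * unitVol n) * (L * cubeMass g q) := by
          rw [mul_add]
          exact add_le_add (h1.trans (mul_le_mul_right hGI _)) (h2.trans (mul_le_mul_right hGI _))
      _ = _ := by
          rw [hW]
          push_cast
          rw [ENNReal.coe_toNNReal hD, ← ENNReal.ofReal]
          ring
  have hElt : 2 ^ (n + 3) * volume E < volume (gridCube q) := by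
    have h2 : Λ * a * (2 ^ (n + 3) * volume E) < Λ * a * volume (gridCube q) := by
      calc Λ * a * (2 ^ (n + 3) * volume E) = 2 ^ (n + 3) * (ENNReal.ofReal t * volume E) := by
            rw [hte]; ring
        _ ≤ 2 ^ (n + 3) * (W * (a * volume (gridCube q))) := by
            rw [hav]
            exact mul_le_mul_right hEle _
        _ = (2 ^ (n + 3) * W : ℝ≥0) * (a * volume (gridCube q)) := by push_cast; ring
        _ < Λ * (a * volume (gridCube q)) := by
            refine ENNReal.mul_lt_mul_left (mul_ne_zero ha0 hvol0) (ENNReal.mul_ne_top hat hvolt) ?_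
            rw [hΛ]
            exact_mod_cast lt_add_one _
        _ = _ := by ring
    exact lt_of_mul_lt_mul_left' h2
  obtain ⟨O, hEO, hOo, hOlt⟩ := E.exists_isOpen_lt_of_lt (μ := volume)
    (volume (gridCube q) / 2 ^ (n + 3))
    ((ENNReal.lt_div_iff_mul_lt (by simp) (by simp)).2 (by rwa [mul_comm]))
  have hΓ : ((B * Λ : ℝ≥0) : ℝ≥0∞) * a = B * ENNReal.ofReal t := by
    rw [hte, ENNReal.coe_mul, mul_assoc]
  rw [hΓ]
  refine ⟨O, hOo, ?_, Eventually.of_forall fun x _ hxO => ?_, fun p hlt hsub hpO => ?_⟩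
  · rw [mul_comm]
    exact ((ENNReal.lt_div_iff_mul_lt (by simp) (by simp)).1 hOlt).le
  · have : ‖h q x‖ₑ ≤ ENNReal.ofReal t := not_lt.1 fun h' => hxO (hEO (Or.inl h'))
    exact this.trans (le_mul_of_one_le_left' (by exact_mod_cast hB1))
  · have hloc : cubeLocalize p v = cubeLocalize p f :=
      localize_localize hf.weak.1 (gridRadius_pos hn p) hρ (ball_corner_subset hn hlt hsub)
    exact hB hS hvc (hh q) ht0 hOo.measurableSet (fun x hx => hEO (Or.inl hx))
      (fun x hx => hEO (Or.inr hx)) hpO (hloc ▸ hh p)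

/-- The gradient of `T f` is the limit in `L²` of the gradients that belong to the localizations of
`f` to the cubes that contain the origin. -/
theorem GradientBound.tendsto_eLpNorm_sub (hA : GradientBound T A) (hn : 1 ≤ n) {f : Euc n → ℝ}
    {g h : Euc n → Euc n} (hf : SobolevPair f g) (hh : IsTGradient T f h)
    {k : GridIndex n → Euc n → Euc n} (hk : ∀ q, IsTGradient T (cubeLocalize q f) (k q)) :
    Tendsto (fun J : ℕ => eLpNorm (k (gridAt (-(J : ℤ)) 0) - h) 2 volume) atTop (𝓝 0) := by
  obtain ⟨L, hL⟩ := exists_eLpNorm_sub_localizeGrad_le n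
  have hn' : (1 : ℝ) ≤ n := by exact_mod_cast hn
  have hR : ∀ J : ℕ, (J : ℝ) + 1 ≤ 4 * n * 2 ^ J := by
    intro J
    have h1 : (J : ℝ) + 1 ≤ 2 ^ J := by exact_mod_cast Nat.lt_two_pow_self
    have h2 : (0 : ℝ) ≤ 2 ^ J := by positivity
    nlinarith
  have hbd : ∀ J : ℕ, eLpNorm (k (gridAt (-(J : ℤ)) 0) - h) 2 volume ≤
      A * (eLpNorm ((ball (0 : Euc n) J)ᶜ.indicator g) 2 volume +
        L * ((J : ℝ≥0∞) + 1)⁻¹ * eLpNorm f 2 volume) := by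
    intro J
    set q : GridIndex n := gridAt (-(J : ℤ)) 0 with hq
    have hρ := gridRadius_pos hn q
    have hρe : gridRadius q = 4 * n * 2 ^ J := by
      rw [hq, gridRadius, gridAt, neg_neg, zpow_natCast]
    have hsub : ball (0 : Euc n) J ⊆ ball (corner q) (gridRadius q) := by
      refine ball_subset_ball' ?_
      have h1 := mem_ball.1 (gridCube_subset_ball hn q (mem_gridCube_gridAt _ _))
      have h2 : (J : ℝ) + 1 ≤ 2 ^ J := by exact_mod_cast Nat.lt_two_pow_self
      have h3 : 2 * (2 : ℝ) ^ J ≤ gridRadius q := by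
        rw [hρe]
        have : (0 : ℝ) ≤ 2 ^ J := by positivity
        nlinarith
      linarith
    have hS : SobolevPair (f - cubeLocalize q f) _ := hf.sub (hf.localize hρ)
    have h1 := ((hA _ _ hS).2 _ (hh.sub (hk q))).2
    rw [← eLpNorm_neg, neg_sub]
    refine h1.trans (mul_le_mul_right ((hL hf hρ hsub).trans ?_) _)
    gcongr
    rw [div_eq_mul_inv, ENNReal.ofReal_mul (by positivity), ENNReal.ofReal_coe_nnreal]
    gcongr
    rw [ENNReal.ofReal_inv_of_pos hρ]
    gcongr
    have e : (J : ℝ≥0∞) + 1 = ENNReal.ofReal (J + 1) := by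
      rw [ENNReal.ofReal_add (by positivity) zero_le_one]; simp
    rw [e, hρe]
    exact ENNReal.ofReal_le_ofReal (hR J)
  have hlim : Tendsto (fun J : ℕ => ((J : ℝ≥0∞) + 1)⁻¹) atTop (𝓝 0) := by
    have := (tendsto_add_atTop_iff_nat 1).2 ENNReal.tendsto_inv_nat_nhds_zero
    simpa using this
  have l1 := ENNReal.Tendsto.const_mul (a := (L : ℝ≥0∞)) hlim (Or.inr (by finiteness))
  have l2 := ENNReal.Tendsto.mul_const (b := eLpNorm f 2 volume) l1 (Or.inr hf.memLp.2.ne)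
  have l3 := ENNReal.Tendsto.const_mul (a := (A : ℝ≥0∞))
    ((tendsto_eLpNorm_indicator_compl_ball hf.memLp_grad).add l2) (Or.inr (by finiteness))
  rw [mul_zero, zero_mul, add_zero, mul_zero] at l3
  exact tendsto_of_tendsto_of_tendsto_of_le_of_le tendsto_const_nhds l3 (fun _ => zero_le) hbd

end LocalEstimate

/-! ### Enclosing cubes in the full dyadic collection -/

section Enclosing

variable {n : ℕ}

/-- The one-third trick in dimension one: an interval of length at most one third is contained in
an interval `[m, m + 1]` or in an interval `[m + s/3, m + 1 + s/3]`, for either sign `s`. -/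
theorem exists_shift_Icc (y : ℝ) {s : ℤ} (hs : s = 1 ∨ s = -1) :
    ∃ (α : ℝ) (m : ℤ), (α = 0 ∨ α = 1 / 3) ∧ ∀ z, |z - y| ≤ 1 / 6 →
      z ∈ Icc (m + s * α) (1 + m + s * α) := by
  have h1 := Int.floor_le y
  have h2 := Int.lt_floor_add_one y
  set m := ⌊y⌋ with hm
  by_cases hlow : (m : ℝ) + 1 / 6 ≤ y ∧ y ≤ m + 5 / 6
  · refine ⟨0, m, Or.inl rfl, fun z hz => ?_⟩
    rw [abs_le] at hz
    constructor <;> linarith [hlow.1, hlow.2]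
  -- otherwise `y` is close to an integer `j`
  obtain ⟨j, hj⟩ : ∃ j : ℤ, |y - j| ≤ 1 / 6 := by
    by_cases h3 : (m : ℝ) + 1 / 6 ≤ y
    · have h4 : (m : ℝ) + 5 / 6 < y := by
        by_contra! h
        exact hlow ⟨h3, h⟩
      refine ⟨m + 1, ?_⟩
      push_cast
      rw [abs_le]
      constructor <;> linarith
    · refine ⟨m, ?_⟩
      rw [abs_le]
      constructor <;> linarith
  rw [abs_le] at hj
  rcases hs with rfl | rfl
  · refine ⟨1 / 3, j - 1, Or.inr rfl, fun z hz => ?_⟩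
    rw [abs_le] at hz
    push_cast
    constructor <;> linarith
  · refine ⟨1 / 3, j, Or.inr rfl, fun z hz => ?_⟩
    rw [abs_le] at hz
    push_cast
    constructor <;> linarith

/-- The one-third trick: a ball is contained in a dyadic cube of comparable size. -/
theorem exists_ball_subset_dyadicCube (x : Euc n) (k : ℤ) {r : ℝ} (hr : r ≤ 2 ^ (-k) / 6) :
    ∃ (α : Fin n → ℝ) (m : Fin n → ℤ), (∀ i, α i = 0 ∨ α i = 1 / 3) ∧
      ball x r ⊆ dyadicCube α k m := by
  obtain ⟨s, hs, -, hs1⟩ := exists_int_eq_neg_one_zpow k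
  have h2 : (0 : ℝ) < 2 ^ k := by positivity
  choose α m hα hm using fun i => exists_shift_Icc ((2 : ℝ) ^ k * x i) hs1
  refine ⟨α, m, hα, fun y hy i => ?_⟩
  have hyi : |y i - x i| < r := (PiLp.norm_apply_le (y - x) i).trans_lt (mem_ball_iff_norm.1 hy)
  have h3 : |(2 : ℝ) ^ k * y i - 2 ^ k * x i| ≤ 1 / 6 := by
    rw [← mul_sub, abs_mul, abs_of_pos h2]
    calc (2 : ℝ) ^ k * |y i - x i| ≤ 2 ^ k * (2 ^ (-k) / 6) := by
          gcongr
          exact hyi.le.trans hr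
      _ = 1 / 6 := by rw [zpow_neg]; field_simp
  have h4 := hm i _ h3
  rw [hs] at h4
  rw [mem_Icc, zpow_neg, inv_mul_le_iff₀ h2, le_inv_mul_iff₀ h2]
  exact h4

theorem dyadicCube_eq_preimage (α : Fin n → ℝ) (k : ℤ) (m : Fin n → ℤ) :
    dyadicCube α k m = WithLp.ofLp ⁻¹' (univ.pi fun i =>
      Icc ((2 : ℝ) ^ (-k) * (m i + (-1 : ℝ) ^ k * α i))
        ((2 : ℝ) ^ (-k) * (1 + m i + (-1 : ℝ) ^ k * α i))) := by
  ext x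
  simp only [mem_preimage, mem_univ_pi]
  rfl

theorem volume_dyadicCube (α : Fin n → ℝ) (k : ℤ) (m : Fin n → ℤ) :
    volume (dyadicCube α k m) = ENNReal.ofReal ((2 ^ (-k)) ^ n) := by
  rw [dyadicCube_eq_preimage, (PiLp.volume_preserving_ofLp (Fin n)).measure_preimage
    (MeasurableSet.univ_pi fun i => measurableSet_Icc).nullMeasurableSet, volume_pi_pi]
  have : ∀ i, (2 : ℝ) ^ (-k) * (1 + m i + (-1 : ℝ) ^ k * α i) -
      2 ^ (-k) * (m i + (-1 : ℝ) ^ k * α i) = 2 ^ (-k) := fun i => by ring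
  simp only [Real.volume_Icc, this]
  rw [Finset.prod_const, Finset.card_univ, Fintype.card_fin, ENNReal.ofReal_pow (by positivity)]

/-- Every cube of the grid has an enclosing dyadic cube, larger by the factor `2⁶ⁿ`, that contains
the ball that belongs to it. -/
theorem exists_enclosing (hn : 1 ≤ n) (q : GridIndex n) :
    ∃ Q ∈ dyadicCubes n, ball (corner q) (2 * gridRadius q) ⊆ Q ∧
      volume Q = (2 ^ (6 * n)) ^ n * volume (gridCube q) := by
  obtain ⟨α, m, hα, hsub⟩ := exists_ball_subset_dyadicCube (corner q) (q.1 - 6 * n)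
    (r := 2 * gridRadius q) (by
      have h1 : (2 : ℝ) ^ (-(q.1 - 6 * n)) = 2 ^ (6 * n) * 2 ^ (-q.1) := by
        rw [neg_sub, sub_eq_add_neg, zpow_add₀ (by norm_num)]
        norm_cast
      have h2 : (48 * n : ℝ) ≤ 2 ^ (6 * n) := by
        have h3 : n + 1 ≤ 2 ^ n := Nat.lt_two_pow_self
        have h4 : 48 * n ≤ 2 ^ (6 * n) := by
          calc 48 * n ≤ 64 ^ n := by
                have : ∀ k : ℕ, 48 * (k + 1) ≤ 64 ^ (k + 1) := by
                  intro k
                  induction k with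
                  | zero => norm_num
                  | succ k ih => rw [pow_succ]; omega
                obtain ⟨k, rfl⟩ : ∃ k, n = k + 1 := ⟨n - 1, by omega⟩
                exact this k
            _ = 2 ^ (6 * n) := by rw [pow_mul]; norm_num
        exact_mod_cast h4
      rw [h1, gridRadius]
      have h5 : (0 : ℝ) < 2 ^ (-q.1) := by positivity
      nlinarith)
  refine ⟨_, ⟨α, hα, _, m, rfl⟩, hsub, ?_⟩
  rw [volume_dyadicCube, volume_gridCube]
  have e : ((2 : ℝ≥0∞) ^ (6 * n)) ^ n = ENNReal.ofReal ((2 ^ (6 * n)) ^ n) := by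
    rw [ENNReal.ofReal_pow (by positivity), ENNReal.ofReal_pow (by positivity)]
    norm_num
  rw [e, ← ENNReal.ofReal_mul (by positivity), ← mul_pow]
  congr 2
  rw [neg_sub, sub_eq_add_neg, zpow_add₀ (by norm_num)]
  norm_cast

/-- Passage from a family of cubes of the grid with large disjoint parts to a sparse family in the
full dyadic collection. -/
theorem exists_isSparse (hn : 1 ≤ n) {F : Set (GridIndex n)} {E : GridIndex n → Set (Euc n)}
    (hEm : ∀ q ∈ F, MeasurableSet (E q)) (hEq : ∀ q ∈ F, E q ⊆ gridCube q)
    (hEv : ∀ q ∈ F, volume (gridCube q) ≤ 4 * volume (E q)) (hE : F.PairwiseDisjoint E)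
    (g : Euc n → Euc n) :
    ∃ S : Set (Set (Euc n)), IsSparse (1 / (4 * (2 ^ (6 * n)) ^ n)) S ∧
      ∀ x, ∑' q : F, (gridCube (q : GridIndex n)).indicator
        (fun _ => (volume (gridCube (q : GridIndex n)))⁻¹ * cubeMass g q) x ≤
          (2 ^ (6 * n)) ^ n * sparseOp S g x := by
  choose P hPD hPsub hPvol using fun q : GridIndex n => exists_enclosing hn q
  have hρ := gridRadius_pos (n := n) hn
  have hqP : ∀ q, gridCube q ⊆ P q := fun q => (gridCube_subset_ball hn q).trans
    ((ball_subset_ball (by linarith [hρ q])).trans (hPsub q))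
  -- a representative of each enclosing cube
  choose! rep hrep using fun (Q : Set (Euc n)) (hQ : Q ∈ P '' F) => hQ
  have hc0 : ((2 : ℝ≥0∞) ^ (6 * n)) ^ n ≠ 0 := by positivity
  have hct : ((2 : ℝ≥0∞) ^ (6 * n)) ^ n ≠ ⊤ := by finiteness
  refine ⟨P '' F, ⟨?_, fun Q => E (rep Q), ?_,
    fun Q hQ => ⟨hEm _ (hrep Q hQ).1, ?_, ?_⟩⟩, fun x => ?_⟩
  · rintro _ ⟨q, -, rfl⟩
    exact hPD q
  · intro Q hQ Q' hQ' hne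
    refine hE (hrep Q hQ).1 (hrep Q' hQ').1 fun h => hne ?_
    rw [← (hrep Q hQ).2, ← (hrep Q' hQ').2, h]
  · conv_rhs => rw [← (hrep Q hQ).2]
    exact (hEq _ (hrep Q hQ).1).trans (hqP _)
  · conv_lhs => rw [← (hrep Q hQ).2]
    rw [hPvol, one_div, ENNReal.ofReal_inv_of_pos (by positivity),
      ENNReal.ofReal_mul (by norm_num), ENNReal.ofReal_pow (by positivity),
      ENNReal.ofReal_pow (by positivity), ENNReal.ofReal_ofNat, ENNReal.ofReal_ofNat,
      ENNReal.mul_inv (by simp) (by simp), mul_assoc, ← mul_assoc _ _ (volume _),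
      ENNReal.inv_mul_cancel hc0 hct, one_mul]
    refine (mul_le_mul_right (hEv _ (hrep Q hQ).1) _).trans_eq ?_
    rw [← mul_assoc, ENNReal.inv_mul_cancel (by norm_num) (by norm_num), one_mul]
  · rw [sparseOp, ← ENNReal.tsum_mul_left]
    -- only the cubes that contain `x` matter, and they are determined by their enclosing cubes
    set F' : Set F := {q | x ∈ gridCube (q : GridIndex n)} with hF'
    have e1 : ∑' q : F, (gridCube (q : GridIndex n)).indicator
        (fun _ => (volume (gridCube (q : GridIndex n)))⁻¹ * cubeMass g q) x =
        ∑' q : F', (volume (gridCube (q : GridIndex n)))⁻¹ * cubeMass g q := by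
      rw [tsum_subtype F' fun q : F => (volume (gridCube (q : GridIndex n)))⁻¹ * cubeMass g q]
      exact tsum_congr fun q => rfl
    rw [e1]
    have hinj : Function.Injective
        fun q : F' => (⟨P q, mem_image_of_mem P q.1.2⟩ : (P '' F : Set (Set (Euc n)))) := by
      intro q q' h
      have h1 : P q = P q' := congrArg Subtype.val h
      have h2 := hPvol (q : GridIndex n)
      rw [h1, hPvol] at h2
      have h3 := (ENNReal.mul_right_inj hc0 hct).1 h2
      rw [volume_gridCube, volume_gridCube,
        ENNReal.ofReal_eq_ofReal_iff (by positivity) (by positivity),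
        pow_left_inj₀ (by positivity) (by positivity) (by omega)] at h3
      have h4 := zpow_right_injective₀ (by norm_num) (by norm_num) h3
      exact Subtype.ext (Subtype.ext (gridIndex_eq (neg_injective h4).symm q.2 q'.2))
    refine le_trans (ENNReal.tsum_le_tsum fun q => ?_)
      (ENNReal.tsum_comp_le_tsum_of_injective hinj _)
    rw [indicator_of_mem (hqP _ q.2), setLAverage_eq, ENNReal.div_eq_inv_mul, hPvol,
      ENNReal.mul_inv (Or.inl hc0) (Or.inl hct), ← mul_assoc, ← mul_assoc,
      ENNReal.mul_inv_cancel hc0 hct, one_mul]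
    exact mul_le_mul_right (lintegral_mono_set (hPsub _)) _

end Enclosing

/-! ### Sparse domination and the weak-type estimate -/

section Domination

variable {n : ℕ} {K : Euc n → Euc n → ℝ} {T : L2 n →L[ℝ] L2 n} {C : ℝ} {A : ℝ≥0}

theorem IsW12.sobolevPair {f : L2 n} {g : Euc n → Euc n} (h : IsW12 f g) : SobolevPair f g :=
  ⟨Lp.memLp f, h.1, h.2⟩

theorem HasWeakGradient.isTGradient {f : L2 n} {h : Euc n → Euc n}
    (hh : HasWeakGradient (T f) h) : IsTGradient T f h :=
  ⟨Lp.memLp f, by rwa [Lp.toLp_coeFn]⟩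

/-- A choice of the gradients of `T` of all the localizations of `f` to cubes of the grid. -/
theorem GradientBound.exists_cube_gradients (hA : GradientBound T A) (hn : 1 ≤ n) {f : Euc n → ℝ}
    {g : Euc n → Euc n} (hf : SobolevPair f g) :
    ∃ k : GridIndex n → Euc n → Euc n, ∀ q, IsTGradient T (cubeLocalize q f) (k q) := by
  choose k hk using fun q : GridIndex n => (hA _ _ (hf.localize (gridRadius_pos hn q))).1
  exact ⟨k, hk⟩

/-- Pointwise domination of the gradient of `T f` by a sparse operator applied to `∇f`. -/
theorem GradientBound.exists_sparse_domination (hA : GradientBound T A) (hn : 1 ≤ n)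
    (hK : KernelBound K C) (hT : IsCZOperator T K) (hT1 : TOneEqZero T K) :
    ∃ Γ : ℝ≥0, ∀ {f : Euc n → ℝ} {g h : Euc n → Euc n}, SobolevPair f g → IsTGradient T f h →
      ∃ S : Set (Set (Euc n)), IsSparse (1 / (4 * (2 ^ (6 * n)) ^ n)) S ∧
        ∀ᵐ x, ‖h x‖ₑ ≤ Γ * sparseOp S g x := by
  obtain ⟨Γ, hΓ⟩ := hA.exists_exceptional hn hK hT hT1
  refine ⟨Γ * (2 ^ (6 * n)) ^ n, fun {f g h} hf hh => ?_⟩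
  obtain ⟨k, hk⟩ := hA.exists_cube_gradients hn hf
  choose O hOo hOv h1 h2 using hΓ hf hk
  obtain ⟨S, hS, hle⟩ := exists_isSparse hn (F := stoppingFamily O) (E := mainPart O)
    (fun q _ => measurableSet_mainPart O q) (fun q _ => sdiff_subset)
    (fun q _ => volume_gridCube_le_mainPart hn (hOo q).measurableSet (hOv q))
    pairwiseDisjoint_mainPart g
  refine ⟨S, hS, ?_⟩
  have hdom := ae_le_tsum_stoppingFamily hn hOo hOv (H := fun q x => ‖k q x‖ₑ) h1 h2
  -- a subsequence of the gradients of the localizations converges almost everywhere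
  have hconv : TendstoInMeasure volume (fun (J : ℕ) => k (gridAt (-(J : ℤ)) 0)) atTop h :=
    tendstoInMeasure_of_tendsto_eLpNorm two_ne_zero
      (fun J => (hk _).2.2.1.aestronglyMeasurable) hh.2.2.1.aestronglyMeasurable
      (hA.tendsto_eLpNorm_sub hn hf hh hk)
  obtain ⟨ns, hns, hlim⟩ := hconv.exists_seq_tendsto_ae
  filter_upwards [hdom, hlim] with x hx hxlim
  have hmem : ∀ᶠ i in atTop, x ∈ gridCube (gridAt (-(ns i : ℤ)) (0 : Euc n)) := by
    have h3 : Tendsto (fun i => (2 : ℝ) ^ ns i) atTop atTop :=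
      (tendsto_pow_atTop_atTop_of_one_lt one_lt_two).comp hns.tendsto_atTop
    filter_upwards [h3.eventually_gt_atTop (3 * ‖x‖)] with i hi
    refine ball_subset_gridCube _ ?_
    rw [mem_ball_zero_iff, zpow_natCast]
    linarith
  refine le_of_tendsto hxlim.enorm ?_
  filter_upwards [hmem] with i hi
  refine (hx (ns i) hi).trans ?_
  calc _ = ∑' q : stoppingFamily O, Γ * (gridCube (q : GridIndex n)).indicator
        (fun _ => (volume (gridCube (q : GridIndex n)))⁻¹ * cubeMass g q) x := by
        refine tsum_congr fun q => ?_
        by_cases hxq : x ∈ gridCube (q : GridIndex n)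
        · rw [indicator_of_mem hxq, indicator_of_mem hxq]
        · rw [indicator_of_notMem hxq, indicator_of_notMem hxq, mul_zero]
    _ ≤ Γ * ((2 ^ (6 * n)) ^ n * sparseOp S g x) := by
        rw [ENNReal.tsum_mul_left]
        exact mul_le_mul_right (hle x) _
    _ = _ := by push_cast; rw [mul_assoc]

/-- The weak-type `(1,1)` estimate for the map `∇f ↦ ∇Tf`. -/
theorem GradientBound.exists_weakL1Norm_le (hA : GradientBound T A) (hn : 1 ≤ n)
    (hK : KernelBound K C) (hT : IsCZOperator T K) (hT1 : TOneEqZero T K) :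
    ∃ Γ : ℝ≥0, ∀ {f : Euc n → ℝ} {g h : Euc n → Euc n}, SobolevPair f g → IsTGradient T f h →
      weakL1Norm h ≤ Γ * eLpNorm g 1 volume := by
  obtain ⟨D, hD, hweak⟩ := hA.weak_type hn hK hT hT1
  obtain ⟨L, hL⟩ := exists_lintegral_localizeGrad_le n
  refine ⟨2 * (D.toNNReal * L), fun {f g h} hf hh => ?_⟩
  obtain ⟨k, hk⟩ := hA.exists_cube_gradients hn hf
  have hlim := hA.tendsto_eLpNorm_sub hn hf hh hk
  refine iSup_le fun t => ?_
  rcases eq_or_ne t 0 with rfl | ht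
  · simp
  obtain ⟨s, hs, rfl⟩ : ∃ s : ℝ≥0, s ≠ 0 ∧ t = 2 * s :=
    ⟨t / 2, by positivity, by rw [mul_div_cancel₀ _ two_ne_zero]⟩
  have key : (s : ℝ≥0∞) * volume {x | 2 * (s : ℝ≥0∞) < ‖h x‖ₑ} ≤
      D * (L * eLpNorm g 1 volume) := by
    refine mul_volume_le_of_forall_exists (by simpa using hs) (by simp) fun ε hε _ => ?_
    obtain ⟨J, hJ⟩ := ((tendsto_order.1 hlim).2 ε hε).exists
    set q : GridIndex n := gridAt (-(J : ℤ)) 0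
    have hρ := gridRadius_pos hn q
    refine ⟨k q, hh.2.2.1.aestronglyMeasurable.sub (hk q).2.2.1.aestronglyMeasurable, ?_, ?_⟩
    · rw [← eLpNorm_neg, neg_sub]
      exact hJ.le
    · have h1 := hweak _ _ _ (hf.localize hρ) (hasCompactSupport_localize hρ f) (hk q) s
        (by positivity)
      rw [ENNReal.ofReal_coe_nnreal] at h1
      refine h1.trans (mul_le_mul_right ((hL hf _ hρ).trans (mul_le_mul_right ?_ _)) _)
      rw [eLpNorm_one_eq_lintegral_enorm]
      exact setLIntegral_le_lintegral _ _
  push_cast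
  rw [ENNReal.coe_toNNReal hD]
  calc _ = 2 * ((s : ℝ≥0∞) * volume {x | 2 * (s : ℝ≥0∞) < ‖h x‖ₑ}) := mul_assoc _ _ _
    _ ≤ 2 * (D * (L * eLpNorm g 1 volume)) := mul_le_mul_right key _
    _ = _ := by ring

end Domination

theorem mainTheorem3 (n : ℕ) (hn : 1 ≤ n)
    (K : EuclideanSpace ℝ (Fin n) → EuclideanSpace ℝ (Fin n) → ℝ)
    (T : L2 n →L[ℝ] L2 n)
    (hT : IsCZOperator T K)
    (hK : HasKernelDerivBounds K)
    (hT1 : TOneEqZero T K)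
    (hgrad : GradientL2Bound T) :
    (∃ η : ℝ, 0 < η ∧ η < 1 ∧ ∃ C : ℝ≥0,
      ∀ (f : L2 n) (g h : EuclideanSpace ℝ (Fin n) → EuclideanSpace ℝ (Fin n)),
        IsW12 f g → HasWeakGradient (T f) h →
          ∃ S : Set (Set (EuclideanSpace ℝ (Fin n))), IsSparse η S ∧
            ∀ᵐ x, ‖h x‖ₑ ≤ C * sparseOp S g x) ∧
    (∃ C : ℝ≥0,
      ∀ (f : L2 n) (g h : EuclideanSpace ℝ (Fin n) → EuclideanSpace ℝ (Fin n)),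
        IsW12 f g → MemLp g 1 → HasWeakGradient (T f) h →
          weakL1Norm h ≤ C * eLpNorm g 1 volume) := by
  obtain ⟨A, hA⟩ := hgrad.exists_gradientBound
  obtain ⟨C, hC⟩ := hK.exists_kernelBound
  obtain ⟨Γ, hΓ⟩ := hA.exists_sparse_domination hn hC hT hT1
  obtain ⟨Γ', hΓ'⟩ := hA.exists_weakL1Norm_le hn hC hT hT1
  have h1 : (1 : ℝ) ≤ (2 ^ (6 * n)) ^ n := one_le_pow₀ (one_le_pow₀ one_le_two)
  refine ⟨⟨1 / (4 * (2 ^ (6 * n)) ^ n), by positivity, ?_, Γ, fun f g h hfg hh =>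
    hΓ hfg.sobolevPair hh.isTGradient⟩, Γ', fun f g h hfg _ hh =>
      hΓ' hfg.sobolevPair hh.isTGradient⟩
  rw [div_lt_one (by positivity)]
  linarith

end
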